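/- **Conventions.** Fix $m\ge 0$. A differential field is a field of characteristic $0$ with $m$ commuting derivations $\delta_1,\dots,\delta_m$. Let $K$ be a differential field and let $\mathcal U\supseteq K$ be a saturated differentially closed field with $|K|<|\mathcal U|$. For $x=(x_1,\dots,x_n)$ let $K\{x\}$ be the differential polynomial ring, i.e. the polynomial ring over $K$ in the indeterminates $\delta^\xi x_i$ ($\xi\in\mathbb N^m$, $1\le i\le n$); those with $|\xi|=\xi_1+\dots+\xi_m\le r$ are indexed by a finite set $\Gamma_n(r)$, and $\nabla_r(a)=(\delta^\xi a_i)_{(\xi,i)\in\Gamma_n(r)}$. Rank the $\delta^\xi x_i$ by the lexicographic order of $(|\xi|,i,\xi_1,\dots,\xi_m)$. * For $f\in K\{x\}\setminus K$ let $v_f$ be the leader (highest ranking indeterminate in $f$), $d_f$ the degree of $f$ in $v_f$, $S_f=\partial f/\partial v_f$ the separant and $I_f$ the initial (the leading coefficient of $f$ in $v_f$); the rank of $f$ is $(v_f,d_f)$, ordered lexicographically. $g$ is reduced with respect to $f$ if no proper derivative of $v_f$ appears in $g$ and $g$ has degree $<d_f$ in $v_f$. A finite set $\Lambda\subseteq K\{x\}\setminus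 K$ is autoreduced if each element is reduced with respect to every other one. For autoreduced sets listed by increasing rank, $\{g_1,\dots,g_k\}<\{f_1,\dots,f_l\}$ means that $\operatorname{rk} g_i<\operatorname{rk} f_i$ at the first index $i\le k,l$ where the ranks differ, or that $k>l$ and the first $l$ ranks agree. A characteristic set of a prime differential ideal $P$ is a minimal autoreduced subset $\Lambda$ of $P$. Put $H_\Lambda=\prod_{f\in\Lambda}I_fS_f$ and let $\Lambda^{(r)}$ be the set of all $\delta^\xi f$ of order $\le r$ with $f\in\Lambda$. Write $\mathcal V$ for zero sets in $\mathcal U^n$ of differential polynomials, and $\mathcal V_r$ for zero sets in $\mathcal U^{\Gamma_n(r)}$ of differential polynomials of order $\le r$, viewed as polynomials in the indeterminates $\delta^\xi x_i$, $|\xi|\le r$. * $K\models \mathrm{UC}_m$ means: for every $n$ and every characteristic set $\Lambda$ of a prime differential ideal of $K\{x_1,\dots,x_n\}$, if for some $r$ with all elements of $\Lambda$ of order $\le r$ the set $\mathcal V_r(\Lambda^{(r)})\setminus\mathcal V_r(H_\Lambda)$ has a smooth $K$-point, then $\mathcal V(\Lambda)\setminus\mathcal V(H_\Lambda)$ has a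 point in $K^n$. * $K$ is large as a field if every irreducible affine variety over $K$ with a smooth $K$-point has a Zariski-dense set of $K$-points. $K$ is existentially closed (e.c.) in $L$ as a field (resp. as a differential field) if every algebraic (resp. differential) variety over $K$ with an $L$-point has a $K$-point. * A differential variety over $K$ is a relatively Kolchin-closed (over $K$) subset $V$ of a quasi-projective algebraic variety $X\subseteq\mathbb P^N(\mathcal U)$ over $K$. It is $K$-irreducible if it is irreducible in the Kolchin topology over $K$. Its $r$-th jet $\mathrm{Jet}_r(V)$ is the Zariski closure of $\nabla_r(V)$ in the $r$-th prolongation $\tau_rX$; over a standard affine chart $\mathcal U^N$ of $\mathbb P^N$ this is the part, lying over $X$, of the Zariski closure in $\mathcal U^{\Gamma_N(r)}$ of the image of the points of $V$ in that chart under $\nabla_r$. **Theorem 5.2.** Let $K$ be a differential field that is large as a field. Then the following are equivalent. 1. $K\models\mathrm{UC}_m$. 2. For every differential field extension $L/K$ such that $K$ is e.c. in $L$ as a field, $K$ is e.c. in $L$ as a differential field. 3. For every $K$-irreducible differential variety $V$ such that $\mathrm{Jet}_r(V)$ has a smooth $K$-point for infinitely many $r\ge 0$, the set of $K$-rational points of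 $V$ is Kolchin-dense over $K$ in $V$. Moreover, for every $K$-irreducible differential variety $V$, the jet $\mathrm{Jet}_r(V)$ has a smooth $K$-point for infinitely many $r\ge0$ if and only if it has one for all $r\ge 0$. -/

import Mathlib

open MvPolynomial Topology

universe u v w

/-! ### Rings with `m` commuting derivations -/

/-- `m` commuting derivations `δ₁, …, δ_m` on a commutative ring. -/
class DiffRing (m : ℕ) (R : Type*) [CommRing R] where
  δ : Fin m → R → R
  δ_add : ∀ (k : Fin m) (a b : R), δ k (a + b) = δ k a + δ k b
  δ_mul : ∀ (k : Fin m) (a b : R), δ k (a * b) = a * δ k b + b * δ k a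
  δ_comm : ∀ (i j : Fin m) (a : R), δ i (δ j a) = δ j (δ i a)

namespace DiffRing

/-- The operator `δ^ξ = δ₁^{ξ₁} ⋯ δ_m^{ξ_m}`. -/
def iter {m : ℕ} {R : Type*} [CommRing R] [DiffRing m R] (ξ : Fin m → ℕ) : R → R :=
  (List.ofFn fun k : Fin m => (δ k : R → R)^[ξ k]).foldr (· ∘ ·) id

/-- A differential ideal: an ideal that is stable under all the derivations. -/
def IsDiffIdeal (m : ℕ) {R : Type*} [CommRing R] [DiffRing m R] (I : Ideal R) : Prop :=
  ∀ (k : Fin m), ∀ a ∈ I, δ k a ∈ I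

/-- A derivation as an additive map. -/
def δHom {m : ℕ} {R : Type*} [CommRing R] [DiffRing m R] (k : Fin m) : R →+ R :=
  AddMonoidHom.mk' (δ k) (δ_add k)

theorem δ_zero {m : ℕ} {R : Type*} [CommRing R] [DiffRing m R] (k : Fin m) :
    δ k (0 : R) = 0 := (δHom k).map_zero

theorem δ_one {m : ℕ} {R : Type*} [CommRing R] [DiffRing m R] (k : Fin m) :
    δ k (1 : R) = 0 := by
  have h := δ_mul k (1 : R) 1
  simp only [mul_one, one_mul] at h
  exact left_eq_add.1 h

end DiffRing

/-- `L` is a differential extension of `K`: the structure map commutes with the derivations. -/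
class DiffExt (m : ℕ) (K L : Type*) [CommRing K] [CommRing L] [DiffRing m K] [DiffRing m L]
    [Algebra K L] : Prop where
  map_δ : ∀ (k : Fin m) (a : K),
    algebraMap K L (DiffRing.δ k a) = DiffRing.δ k (algebraMap K L a)

/-! ### Differential polynomials -/

/-- The algebraic indeterminates `δ^ξ x_i` of the differential polynomial ring in the
differential indeterminates `x_1, …, x_n`. -/
@[ext] structure DVar (m n : ℕ) where
  /-- the index `i` of the differential indeterminate -/
  idx : Fin n
  /-- the exponent `ξ` of the derivative -/
  exp : Fin m → ℕ

namespace DVar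

variable {m n : ℕ}

/-- The order `ξ₁ + ⋯ + ξ_m` of `δ^ξ x_i`. -/
def order (v : DVar m n) : ℕ := ∑ k, v.exp k

/-- The sequence `(ξ₁ + ⋯ + ξ_m, i, ξ₁, …, ξ_m)`, in a lexicographically ordered set. -/
def key (v : DVar m n) : ℕ ×ₗ (Fin n ×ₗ Lex (Fin m → ℕ)) :=
  toLex (v.order, toLex (v.idx, toLex v.exp))

theorem key_injective : Function.Injective (key : DVar m n → _) := by
  intro v w h
  have h2 : (v.idx, toLex v.exp) = (w.idx, toLex w.exp) :=
    toLex.injective (Prod.ext_iff.1 (toLex.injective h)).2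
  exact DVar.ext (Prod.ext_iff.1 h2).1 (toLex.injective (Prod.ext_iff.1 h2).2)

/-- The canonical orderly ranking of the indeterminates `δ^ξ x_i`. -/
noncomputable instance : LinearOrder (DVar m n) := LinearOrder.lift' key key_injective

/-- The indeterminate `δ_k δ^ξ x_i`. -/
def shift (k : Fin m) (v : DVar m n) : DVar m n := ⟨v.idx, v.exp + Pi.single k 1⟩

/-- `w` is a proper derivative of `v`. -/
def IsProperDerivative (w v : DVar m n) : Prop := w.idx = v.idx ∧ v.exp < w.exp

end DVar

/-- The differential polynomial ring `K{x_1, …, x_n}` in `m` commuting derivations. -/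
abbrev DiffPoly (m n : ℕ) (K : Type*) [CommRing K] := MvPolynomial (DVar m n) K

/-- The `k`-th derivation of the coefficient ring applied to all coefficients of a polynomial. -/
noncomputable def coeffDer {m : ℕ} {σ K : Type*} [CommRing K] [DiffRing m K] (k : Fin m)
    (p : MvPolynomial σ K) : MvPolynomial σ K :=
  ∑ s ∈ p.support, monomial s (DiffRing.δ k (coeff s p))

theorem coeff_coeffDer {m : ℕ} {σ K : Type*} [CommRing K] [DiffRing m K] (k : Fin m)
    (p : MvPolynomial σ K) (s : σ →₀ ℕ) :
    coeff s (coeffDer k p) = DiffRing.δ k (coeff s p) := by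
  classical
  simp only [coeffDer, coeff_sum, coeff_monomial, Finset.sum_ite_eq', mem_support_iff]
  split_ifs with h
  · rfl
  · rw [not_not.1 h, DiffRing.δ_zero]

/-- The derivation `δ_k` of `K{x}`: it extends `δ_k` on `K` and maps `δ^ξ x_i` to
`δ_k δ^ξ x_i`. -/
noncomputable def polyDer {m n : ℕ} {K : Type*} [CommRing K] [DiffRing m K] (k : Fin m)
    (f : DiffPoly m n K) : DiffPoly m n K :=
  coeffDer k f + mkDerivation K (fun v : DVar m n => (X (v.shift k) : DiffPoly m n K)) f

theorem polyDer_add {m n : ℕ} {K : Type*} [CommRing K] [DiffRing m K] (k : Fin m)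
    (f g : DiffPoly m n K) : polyDer k (f + g) = polyDer k f + polyDer k g := by
  have h : coeffDer k (f + g) = coeffDer k f + coeffDer k g := by
    ext s
    simp only [coeff_coeffDer, coeff_add, DiffRing.δ_add]
  rw [polyDer, polyDer, polyDer, h, map_add]
  ring

theorem polyDer_mul {m n : ℕ} {K : Type*} [CommRing K] [DiffRing m K] (k : Fin m)
    (f g : DiffPoly m n K) : polyDer k (f * g) = f * polyDer k g + g * polyDer k f := by
  classical
  have h : coeffDer k (f * g) = f * coeffDer k g + g * coeffDer k f := by
    ext s
    rw [mul_comm g, coeff_coeffDer, coeff_add, coeff_mul, coeff_mul, coeff_mul,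
      ← Finset.sum_add_distrib]
    refine (map_sum (DiffRing.δHom (R := K) k) _ _).trans (Finset.sum_congr rfl fun x _ => ?_)
    refine (DiffRing.δ_mul k _ _).trans ?_
    simp only [coeff_coeffDer]
    ring
  rw [polyDer, polyDer, polyDer, h, Derivation.leibniz, smul_eq_mul, smul_eq_mul]
  ring

theorem polyDer_C {m n : ℕ} {K : Type*} [CommRing K] [DiffRing m K] (k : Fin m) (a : K) :
    polyDer k (C a : DiffPoly m n K) = C (DiffRing.δ k a) := by
  classical
  have h : coeffDer k (C a : DiffPoly m n K) = C (DiffRing.δ k a) := by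
    ext s
    rw [coeff_coeffDer, coeff_C, coeff_C]
    split_ifs
    · rfl
    · exact DiffRing.δ_zero k
  rw [polyDer, h, derivation_C, add_zero]

theorem polyDer_X {m n : ℕ} {K : Type*} [CommRing K] [DiffRing m K] (k : Fin m) (v : DVar m n) :
    polyDer k (X v : DiffPoly m n K) = X (v.shift k) := by
  classical
  have h : coeffDer k (X v : DiffPoly m n K) = 0 := by
    ext s
    rw [coeff_coeffDer, coeff_X, coeff_zero]
    split_ifs
    · exact DiffRing.δ_one k
    · exact DiffRing.δ_zero k
  rw [polyDer, h, mkDerivation_X, zero_add]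

/-- The differential ring structure of `K{x_1, …, x_n}`. -/
noncomputable instance {m n : ℕ} {K : Type*} [CommRing K] [DiffRing m K] :
    DiffRing m (DiffPoly m n K) where
  δ := polyDer
  δ_add := polyDer_add
  δ_mul := polyDer_mul
  δ_comm i j p := by
    induction p using MvPolynomial.induction_on with
    | C a => simp only [polyDer_C, DiffRing.δ_comm i j]
    | add p q hp hq => simp only [polyDer_add, hp, hq]
    | mul_X p v hp =>
      have h : (v.shift j).shift i = (v.shift i).shift j := by
        ext1
        · rfl
        · simp only [DVar.shift, add_assoc, add_comm (Pi.single j 1 : Fin m → ℕ)]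
      simp only [polyDer_mul, polyDer_add, polyDer_X, hp, h]
      ring

/-- The tuple `(δ^ξ a_i)` of all derivatives of a point `a`. -/
noncomputable def nablaAll (m : ℕ) {n : ℕ} {L : Type*} [CommRing L] [DiffRing m L]
    (a : Fin n → L) : DVar m n → L :=
  fun v => DiffRing.iter v.exp (a v.idx)

/-- The value `f(a)` of a differential polynomial `f` over `K` at a point `a` of an
extension of `K`. -/
noncomputable def DiffPoly.val {m n : ℕ} {K L : Type*} [CommRing K] [CommRing L] [DiffRing m L]
    [Algebra K L] (f : DiffPoly m n K) (a : Fin n → L) : L :=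
  aeval (nablaAll m a) f

/-! ### Existentially closed, differentially closed and saturated fields -/

/-- `K` is existentially closed in `L` as a field: every (affine) algebraic variety over `K`
with an `L`-point has a `K`-point. -/
def FieldEC (K L : Type*) [Field K] [Field L] [Algebra K L] : Prop :=
  ∀ (n : ℕ) (S : Set (MvPolynomial (Fin n) K)),
    (∃ a : Fin n → L, ∀ f ∈ S, aeval a f = 0) → ∃ a : Fin n → K, ∀ f ∈ S, aeval a f = 0

/-- `K` is existentially closed in `L` as a differential field: every (affine) differential
variety over `K` with an `L`-point has a `K`-point. -/
def DiffEC (m : ℕ) (K L : Type*) [Field K] [Field L] [Algebra K L]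
    [DiffRing m K] [DiffRing m L] : Prop :=
  ∀ (n : ℕ) (S : Set (DiffPoly m n K)),
    (∃ a : Fin n → L, ∀ f ∈ S, f.val a = 0) → ∃ a : Fin n → K, ∀ f ∈ S, f.val a = 0

/-- `U` is a differentially closed field: it is existentially closed in all its differential
field extensions. -/
def IsDiffClosed (m : ℕ) (U : Type u) [Field U] [DiffRing m U] : Prop :=
  ∀ (L : Type u) [Field L] [DiffRing m L] [Algebra U L] [DiffExt m U L], DiffEC m U L

/-- Saturation of a differentially closed field `U`: every complete type in finitely many
variables over a differential subfield `F` of smaller cardinality is realised in `U`. By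
quantifier elimination such a type is given by the prime differential ideal of the differential
polynomials over `F` that vanish at a realisation. -/
def IsDiffSaturated (m : ℕ) (U : Type u) [Field U] [DiffRing m U] : Prop :=
  ∀ (F : Type u) [Field F] [DiffRing m F] [Algebra F U] [DiffExt m F U],
    Cardinal.mk F < Cardinal.mk U →
    ∀ (n : ℕ) (P : Ideal (DiffPoly m n F)), P.IsPrime → DiffRing.IsDiffIdeal m P →
      ∃ a : Fin n → U, ∀ f : DiffPoly m n F, f ∈ P ↔ f.val a = 0

/-! ### Algebraic varieties, smooth points, large fields -/

/-- `a` is a smooth `K`-point of the affine variety over `K` with coordinate ring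
`K[x] / I`: it is a zero of `I`, and `K[x] / I` is smooth over `K` at the maximal ideal
of `a`. -/
def IsSmoothPoint {σ K : Type*} [Field K] (I : Ideal (MvPolynomial σ K)) (a : σ → K) : Prop :=
  ∃ h : ∀ f ∈ I, (aeval a : MvPolynomial σ K →ₐ[K] K) f = 0,
    (⟨RingHom.ker (Ideal.Quotient.liftₐ I (aeval a) h), RingHom.ker_isPrime _⟩ :
      PrimeSpectrum (MvPolynomial σ K ⧸ I)) ∈ Algebra.smoothLocus K (MvPolynomial σ K ⧸ I)

/-- `F` is a large field: every irreducible affine variety over `F` with a smooth `F`-point has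
a Zariski-dense set of `F`-points. -/
def IsLargeField (F : Type*) [Field F] : Prop :=
  ∀ (n : ℕ) (P : Ideal (MvPolynomial (Fin n) F)), P.IsPrime →
    (∃ a : Fin n → F, IsSmoothPoint P a) →
    ∀ g : MvPolynomial (Fin n) F, g ∉ P →
      ∃ a : Fin n → F, (∀ f ∈ P, aeval a f = 0) ∧ aeval a g ≠ 0

/-- `Z ⊆ U^σ` is a locally closed set for the Zariski topology over `K`. It has a smooth
`K`-point: a point of `Z` with coordinates in `K` that is a smooth point of the Zariski
closure of `Z` (in which `Z` is open). -/
def HasSmoothKPoint (K : Type*) {U σ : Type*} [Field K] [Field U] [Algebra K U]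
    (Z : Set (σ → U)) : Prop :=
  ∃ a : σ → K, (fun s => algebraMap K U (a s)) ∈ Z ∧ IsSmoothPoint (vanishingIdeal K Z) a

/-- The Zariski topology over `K` on `U^σ`: the closed sets are the zero sets of polynomials
with coefficients in `K`. -/
@[reducible] def zariskiTopology (K U σ : Type*) [Field K] [Field U] [Algebra K U] :
    TopologicalSpace (σ → U) :=
  TopologicalSpace.ofClosed
    {Z | ∃ S : Set (MvPolynomial σ K), Z = {a | ∀ f ∈ S, aeval a f = 0}}
    ⟨{1}, by ext a; simp⟩
    (by
      intro A hA
      refine ⟨{f | ∃ Z ∈ A, ∀ a ∈ Z, aeval a f = 0}, ?_⟩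
      ext a
      simp only [Set.mem_sInter, Set.mem_ofPred_eq]
      constructor
      · rintro h f ⟨Z, hZ, hf⟩
        exact hf a (h Z hZ)
      · intro h Z hZ
        obtain ⟨S, rfl⟩ := hA hZ
        intro f hf
        exact h f ⟨_, hZ, fun b hb => hb f hf⟩)
    (by
      rintro _ ⟨S, rfl⟩ _ ⟨T, rfl⟩
      refine ⟨{f | ∃ g ∈ S, ∃ h ∈ T, f = g * h}, ?_⟩
      ext a
      simp only [Set.mem_union, Set.mem_ofPred_eq]
      constructor
      · rintro (h | h) f ⟨g, hg, k, hk, rfl⟩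
        · simp [h g hg]
        · simp [h k hk]
      · intro h
        by_contra! hc
        obtain ⟨⟨g, hg, hg'⟩, k, hk, hk'⟩ := hc
        exact mul_ne_zero hg' hk' (by rw [← map_mul]; exact h _ ⟨g, hg, k, hk, rfl⟩))

/-! ### Jet coordinates -/

/-- The index set `Γ_n(r)` of the indeterminates of order at most `r`. -/
abbrev JetVar (m n r : ℕ) := {v : DVar m n // v.order ≤ r}

/-- The nabla map `∇_r(a) = (δ^ξ a_i : ξ₁ + ⋯ + ξ_m ≤ r)`. -/
noncomputable def nabla (m : ℕ) {n : ℕ} (r : ℕ) {L : Type*} [CommRing L] [DiffRing m L]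
    (a : Fin n → L) : JetVar m n r → L :=
  fun v => nablaAll m a v.1

/-- `f` is a differential polynomial of order at most `r`. -/
def OrderLE {m n : ℕ} {K : Type*} [CommRing K] (r : ℕ) (f : DiffPoly m n K) : Prop :=
  ∀ v ∈ f.vars, v.order ≤ r

/-- A differential polynomial of order at most `r`, seen as a polynomial in the
indeterminates of order at most `r` (the value is only used for such polynomials). -/
noncomputable def toPol {m n : ℕ} {K : Type*} [CommRing K] (r : ℕ) (f : DiffPoly m n K) :
    MvPolynomial (JetVar m n r) K :=
  killCompl (Subtype.val_injective (p := fun v : DVar m n => v.order ≤ r)) f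

/-- The algebraic zero set `𝒱_r(S)` in the space with coordinates `Γ_n(r)`. -/
def algZeros {m n : ℕ} {K : Type*} (U : Type*) [Field K] [Field U] [Algebra K U] (r : ℕ)
    (S : Set (DiffPoly m n K)) : Set (JetVar m n r → U) :=
  {p | ∀ f ∈ S, aeval p (toPol r f) = 0}

/-! ### Characteristic sets -/

section CharacteristicSets

variable {m n : ℕ} {K : Type*} [Field K]

/-- `v` is the leader of `f`: the highest ranking indeterminate that appears in `f`. -/
def IsLeader (f : DiffPoly m n K) (v : DVar m n) : Prop := f.vars.max = (v : WithBot (DVar m n))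

/-- The rank `(v_f, d_f)` of a non-constant `f`, where `v_f` is the leader and `d_f` the degree
of `v_f` in `f`; ranks are ordered lexicographically. (Constants get the rank `(⊥, 0)`, which
is never used.) -/
noncomputable def polyRank (f : DiffPoly m n K) : WithBot (DVar m n) ×ₗ ℕ :=
  toLex (f.vars.max, if h : f.vars.Nonempty then f.degreeOf (f.vars.max' h) else 0)

/-- The separant: the partial derivative of a non-constant `f` with respect to its leader. -/
noncomputable def separant (f : DiffPoly m n K) : DiffPoly m n K :=
  if h : f.vars.Nonempty then pderiv (f.vars.max' h) f else 0

/-- The leading coefficient of `f` as a polynomial in the indeterminate `v`. -/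
noncomputable def leadingCoeffIn (v : DVar m n) (f : DiffPoly m n K) : DiffPoly m n K :=
  ∑ s ∈ f.support with s v = f.degreeOf v, monomial (s.erase v) (coeff s f)

/-- The initial: the leading coefficient of a non-constant `f` as a polynomial in its leader. -/
noncomputable def initial (f : DiffPoly m n K) : DiffPoly m n K :=
  if h : f.vars.Nonempty then leadingCoeffIn (f.vars.max' h) f else 0

/-- `H_Λ = ∏_{f ∈ Λ} I_f S_f`. -/
noncomputable def HProd (Λ : Finset (DiffPoly m n K)) : DiffPoly m n K :=
  ∏ f ∈ Λ, initial f * separant f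

/-- `g` is reduced with respect to `f`: no proper derivative of the leader of `f` appears in
`g`, and the degree of the leader in `g` is less than its degree in `f`. -/
def IsReducedWrt (g f : DiffPoly m n K) : Prop :=
  ∀ v, IsLeader f v →
    (∀ w ∈ g.vars, ¬ w.IsProperDerivative v) ∧ g.degreeOf v < f.degreeOf v

/-- An autoreduced set: non-constant differential polynomials, each reduced with respect to
all the others. -/
def IsAutoreduced (Λ : Finset (DiffPoly m n K)) : Prop :=
  (∀ f ∈ Λ, f.vars.Nonempty) ∧ ∀ f ∈ Λ, ∀ g ∈ Λ, f ≠ g → IsReducedWrt g f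

/-- The ranks of the elements of `Λ`, in nondecreasing order. -/
noncomputable def rankList (Λ : Finset (DiffPoly m n K)) :
    List (WithBot (DVar m n) ×ₗ ℕ) :=
  (Λ.val.map polyRank).sort (· ≤ ·)

/-- The ranking of autoreduced sets `{g_1, …, g_r} < {f_1, …, f_s}`: at the first place where
the ranks differ, that of `g` is lower; or `r > s` and the first `s` ranks coincide. -/
def AutoreducedLT (G F : Finset (DiffPoly m n K)) : Prop :=
  (∃ i : ℕ, (∀ j < i, (rankList G)[j]? = (rankList F)[j]?) ∧
      ∃ a ∈ (rankList G)[i]?, ∃ b ∈ (rankList F)[i]?, a < b) ∨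
    (F.card < G.card ∧ ∀ j < F.card, (rankList G)[j]? = (rankList F)[j]?)

/-- A characteristic set of `P`: a minimal autoreduced subset of `P`. -/
def IsCharSet (Λ : Finset (DiffPoly m n K)) (P : Ideal (DiffPoly m n K)) : Prop :=
  (IsAutoreduced Λ ∧ (Λ : Set (DiffPoly m n K)) ⊆ P) ∧
    ∀ Λ' : Finset (DiffPoly m n K), IsAutoreduced Λ' → (Λ' : Set (DiffPoly m n K)) ⊆ P →
      ¬ AutoreducedLT Λ' Λ

/-- `S^{(r)}`: the derivatives `δ^ξ f` of order at most `r` of elements `f` of `S`. -/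
def derivsUpTo [DiffRing m K] (r : ℕ) (S : Set (DiffPoly m n K)) : Set (DiffPoly m n K) :=
  {g | OrderLE r g ∧ ∃ f ∈ S, ∃ ξ : Fin m → ℕ, g = DiffRing.iter ξ f}

end CharacteristicSets

/-- `K` is a model of the uniform companion `UC_m`. Algebraic sets are subsets of
powers of the universal domain `U`. -/
def IsModelUC (m : ℕ) (K U : Type*) [Field K] [Field U] [Algebra K U] [DiffRing m K] : Prop :=
  ∀ (n : ℕ) (P : Ideal (DiffPoly m n K)), P.IsPrime → DiffRing.IsDiffIdeal m P →
    ∀ Λ : Finset (DiffPoly m n K), IsCharSet Λ P →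
      (∃ r : ℕ, (∀ f ∈ Λ, OrderLE r f) ∧
        HasSmoothKPoint K
          (algZeros U r (derivsUpTo r (Λ : Set (DiffPoly m n K))) \ algZeros U r {HProd Λ})) →
      ∃ a : Fin n → K, (∀ f ∈ Λ, f.val a = 0) ∧ (HProd Λ).val a ≠ 0

/-! ### Differential varieties in quasi-projective varieties -/

/-- The Kolchin topology over `K` on `U^n`: the closed sets are the zero sets of differential
polynomials with coefficients in `K`. -/
@[reducible] noncomputable def kolchinTopology (m : ℕ) (K U : Type*) (n : ℕ) [Field K] [Field U] [Algebra K U]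
    [DiffRing m U] : TopologicalSpace (Fin n → U) :=
  (zariskiTopology K U (DVar m n)).induced (nablaAll m)

/-- Projective space `ℙ^N(U)`. -/
abbrev ProjSpace (U : Type*) [Field U] (N : ℕ) := Projectivization U (Fin (N + 1) → U)

/-- The `j`-th standard affine chart `U^N → ℙ^N(U)`, which inserts the homogeneous coordinate
`1` at place `j`. -/
def chart {U : Type*} [Field U] {N : ℕ} (j : Fin (N + 1)) (a : Fin N → U) : ProjSpace U N :=
  Projectivization.mk U (j.insertNth (α := fun _ => U) 1 a) (fun h => by
    have := congrFun h j
    simp at this)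

/-- The points of `ℙ^N(U)` with homogeneous coordinates in `K`. -/
def projKPoints (K U : Type*) [Field K] [Field U] [Algebra K U] (N : ℕ) : Set (ProjSpace U N) :=
  {p | ∃ (a : Fin (N + 1) → K) (h : (fun i => algebraMap K U (a i)) ≠ 0),
    p = Projectivization.mk U (fun i => algebraMap K U (a i)) h}

/-- The Zariski topology over `K` on `ℙ^N(U)`: a set is closed when its intersections with the
standard affine charts are closed. -/
@[reducible] def projZariski (K U : Type*) [Field K] [Field U] [Algebra K U] (N : ℕ) :
    TopologicalSpace (ProjSpace U N) :=
  ⨆ j : Fin (N + 1), (zariskiTopology K U (Fin N)).coinduced (chart j)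

/-- The Kolchin topology over `K` on `ℙ^N(U)`: a set is closed when its intersections with the
standard affine charts are closed. -/
@[reducible] noncomputable def projKolchin (m : ℕ) (K U : Type*) [Field K] [Field U] [Algebra K U]
    [DiffRing m U] (N : ℕ) : TopologicalSpace (ProjSpace U N) :=
  ⨆ j : Fin (N + 1), (kolchinTopology m K U N).coinduced (chart j)

/-- A differential variety over `K`, given as a differential subvariety (a relatively
Kolchin-closed subset) of a quasi-projective algebraic variety `X ⊆ ℙ^N(U)` over `K`. -/
structure DiffVariety (m : ℕ) (K U : Type*) [Field K] [Field U] [Algebra K U]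
    [DiffRing m U] (N : ℕ) where
  /-- the ambient quasi-projective variety -/
  ambient : Set (ProjSpace U N)
  /-- the set of points of the differential variety -/
  points : Set (ProjSpace U N)
  ambient_locallyClosed : ∃ A B : Set (ProjSpace U N),
    IsClosed[projZariski K U N] A ∧ IsClosed[projZariski K U N] B ∧ ambient = A \ B
  points_closed : ∃ C : Set (ProjSpace U N),
    IsClosed[projKolchin m K U N] C ∧ points = ambient ∩ C

namespace DiffVariety

variable {m : ℕ} {K U : Type*} [Field K] [Field U] [Algebra K U] [DiffRing m U] {N : ℕ}

/-- `V` is `K`-irreducible: it is irreducible in the Kolchin topology over `K`. -/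
def IsKIrreducible (V : DiffVariety m K U N) : Prop :=
  @IsIrreducible _ (projKolchin m K U N) V.points

/-- The part of the `r`-th jet `Jet_r V` over the `j`-th standard affine chart. Over the chart,
the prolongation of order `r` of the affine space `U^N` is the affine space with coordinates
`Γ_N(r)`, its projection `π_r` to `U^N` takes the coordinates of order `0`, and the prolongation
of `X` is open in that of the closure of `X`, namely the preimage of `X` under `π_r`. The jet is
the Zariski closure of `∇_r(V)` in the prolongation of `X`; as `V` is over `K`, this is also the
closure for the Zariski topology over `K`. -/
def jetChart (V : DiffVariety m K U N) (r : ℕ) (j : Fin (N + 1)) : Set (JetVar m N r → U) :=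
  closure[zariskiTopology K U (JetVar m N r)] (nabla m r '' (chart j ⁻¹' V.points)) ∩
    {p | chart j (fun i => p ⟨⟨i, 0⟩, by simp [DVar.order]⟩) ∈ V.ambient}

/-- `Jet_r V` has a smooth `K`-point; the sets `jetChart V r j` form an open cover of
`Jet_r V`. -/
def JetHasSmoothKPoint (V : DiffVariety m K U N) (r : ℕ) : Prop :=
  ∃ j : Fin (N + 1), HasSmoothKPoint K (V.jetChart r j)

/-- The `K`-rational points are Kolchin dense over `K` in `V`. -/
def KPointsDense (V : DiffVariety m K U N) : Prop :=
  V.points ⊆ closure[projKolchin m K U N] (V.points ∩ projKPoints K U N)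

end DiffVariety

/-! ### Iterated derivations -/

/-! Everything turns on one condition on a prime differential ideal `P` of `K{x}`: at every order
`r`, the `K`-points of the truncation of `P` to order `r` are dense (`DenseAtOrder`). Saturation
provides a generic zero `a` of `P` in `U`. If the condition holds, `K` is e.c. as a field in `K⟨a⟩`,
the field generated by all derivatives of `a`: finitely many elements of it are rational in
derivatives of bounded order, and these can be specialised (`fieldEC_adjoin`). Conversely, if `P`
has a generic zero in an extension in which `K` is e.c. as a field, then every truncation has a
smooth `K`-point, because a variety in characteristic zero is smooth at its generic point
(`FieldEC.exists_isSmoothPoint`). For `K` large, a smooth `K`-point of a truncation gives density at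
that order and below. This already yields the claim that infinitely many jets suffice for all of
them.

The link with characteristic sets is Ritt reduction. Modulo a characteristic set `Λ` of `P`, any
polynomial becomes reduced after multiplication by initials and separants, and a reduced element of
`P` is zero. Hence, off `H_Λ`, the derivatives of `Λ` up to order `r` define the truncation of `P`
(`IsCharSet.map_eq_zero`). Moreover, density at one order bounding `Λ` propagates to all orders
(`IsCharSet.exists_point`): above that order the principal derivatives are determined by equations
linear in them, whose coefficients are separants, and the other indeterminates are free.

From `UC_m` to differential existential closedness: the locus of an `L`-point acquires a smooth
`K`-point off `H_Λ`, and `UC_m` turns it into a differential `K`-point of `Λ` off `H_Λ`, hence of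
`P`. From there to density on varieties: infinitely many smooth jets give density at every order on
some chart, so `K` is e.c. in `K⟨a⟩` as a field, then as a differential field, and irreducibility
spreads the `K`-points over `V`. Back to `UC_m`: a smooth point of one truncation gives density at
all orders, so all jets of the variety of `P` have smooth `K`-points, and dense `K`-points include
one off `H_Λ`. -/

theorem foldr_comp_iterate_add_single {α : Type*} {m : ℕ} (f : Fin m → α → α)
    (hf : ∀ i j, Function.Commute (f i) (f j)) (ξ : Fin m → ℕ) (k : Fin m) :
    (List.ofFn fun i => (f i)^[(ξ + Pi.single k 1 : Fin m → ℕ) i]).foldr (· ∘ ·) id =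
      f k ∘ (List.ofFn fun i => (f i)^[ξ i]).foldr (· ∘ ·) id := by
  induction m with
  | zero => exact k.elim0
  | succ m ih =>
    simp only [List.ofFn_succ, List.foldr_cons]
    refine Fin.cases ?_ (fun j => ?_) k
    · simp only [Pi.add_apply, Pi.single_eq_same, Function.iterate_succ', ne_eq, Fin.succ_ne_zero,
        not_false_eq_true, Pi.single_eq_of_ne, add_zero, Function.comp_assoc]
    · have h := ih (fun i => f i.succ) (fun i l => hf _ _) (fun i => ξ i.succ) j
      have h' : ∀ i : Fin m, (ξ + Pi.single j.succ 1 : Fin (m + 1) → ℕ) i.succ =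
          ((fun i => ξ i.succ) + Pi.single j 1 : Fin m → ℕ) i := by
        intro i
        simp [Pi.single_apply, Fin.succ_inj]
      simp only [h', h]
      have h0 : (ξ + Pi.single j.succ 1 : Fin (m + 1) → ℕ) 0 = ξ 0 := by
        simp [(Fin.succ_ne_zero j).symm]
      rw [h0, ← Function.comp_assoc, ← Function.comp_assoc]
      congr 1
      exact ((hf 0 j.succ).iterate_left (ξ 0)).comp_eq

namespace DiffRing

variable {m : ℕ} {R : Type*} [CommRing R] [DiffRing m R]

theorem iter_zero (a : R) : iter (0 : Fin m → ℕ) a = a := by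
  have h : ∀ l : ℕ, (List.replicate l (id : R → R)).foldr (· ∘ ·) id = id := by
    intro l
    induction l with
    | zero => rfl
    | succ l ih => rw [List.replicate_succ, List.foldr_cons, ih]; rfl
  simp only [iter, Pi.zero_apply, Function.iterate_zero, List.ofFn_const, h, id]

theorem iter_add_single (ξ : Fin m → ℕ) (k : Fin m) (a : R) :
    iter (ξ + Pi.single k 1) a = δ k (iter ξ a) := by
  rw [iter, foldr_comp_iterate_add_single _ (fun i j => ?_) ξ k]
  · rfl
  · exact fun a => δ_comm i j a

/-- The extra factor `a` avoids the exponent `l - 1` in the power rule; the quotient rule below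
needs exactly this form. -/
theorem δ_pow_succ (k : Fin m) (a : R) (l : ℕ) :
    a * δ k (a ^ l) = l * a ^ l * δ k a := by
  induction l with
  | zero => simp [δ_one]
  | succ l ih =>
    rw [pow_succ, δ_mul, mul_add, mul_left_comm a a, ih]
    push_cast
    ring

end DiffRing

/-- Induction on the total order: a nonzero multi-index has a positive entry that can be lowered by
one. Statements about `δ^ξ` are thereby reduced to a single derivation. -/
theorem multiIndex_induction {m : ℕ} {p : (Fin m → ℕ) → Prop} (h0 : p 0)
    (h1 : ∀ ξ k, p ξ → p (ξ + Pi.single k 1)) (ξ : Fin m → ℕ) : p ξ := by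
  suffices h : ∀ l : ℕ, ∀ ξ : Fin m → ℕ, ∑ k, ξ k = l → p ξ from h _ ξ rfl
  intro l
  induction l with
  | zero =>
    intro ξ hξ
    have : ξ = 0 := by
      funext k
      exact (Finset.sum_eq_zero_iff.1 hξ) k (Finset.mem_univ k)
    rwa [this]
  | succ l ih =>
    intro ξ hξ
    obtain ⟨k, hk⟩ : ∃ k, ξ k ≠ 0 := by
      by_contra! h
      simp [h] at hξ
    have h2 : ξ = (ξ - Pi.single k 1) + Pi.single k 1 := by
      funext i
      by_cases hi : i = k
      · subst hi
        simp only [Pi.add_apply, Pi.sub_apply, Pi.single_eq_same]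
        omega
      · simp [Pi.single_eq_of_ne hi]
    rw [h2] at hξ ⊢
    refine h1 _ _ (ih _ ?_)
    simp only [Pi.add_apply, Finset.sum_add_distrib, Finset.sum_pi_single', Finset.mem_univ,
      if_true] at hξ
    omega

namespace DVar

variable {m n : ℕ}

theorem lt_iff_key {v w : DVar m n} : v < w ↔ v.key < w.key := Iff.rfl

/-- The ranking is pulled back from a lexicographic product of well-orders. Reduction and the
recursive construction of points both descend along it. -/
instance : WellFoundedLT (DVar m n) :=
  ⟨(InvImage.wf key (wellFounded_lt (α := ℕ ×ₗ (Fin n ×ₗ Lex (Fin m → ℕ)))))⟩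

theorem lt_of_order_lt {v w : DVar m n} (h : v.order < w.order) : v < w :=
  Prod.Lex.toLex_lt_toLex.2 (Or.inl h)

theorem order_le_of_le {v w : DVar m n} (h : v ≤ w) : v.order ≤ w.order := by
  by_contra! h'
  exact absurd h (not_le.2 (lt_of_order_lt h'))

/-- The derivative `δ^ξ v`. -/
def deriv (ξ : Fin m → ℕ) (v : DVar m n) : DVar m n := ⟨v.idx, v.exp + ξ⟩

theorem deriv_zero (v : DVar m n) : deriv 0 v = v := by
  ext1
  · rfl
  · simp [deriv]

theorem deriv_add_single (ξ : Fin m → ℕ) (k : Fin m) (v : DVar m n) :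
    deriv (ξ + Pi.single k 1) v = (deriv ξ v).shift k := by
  ext1
  · rfl
  · simp [deriv, shift, add_assoc]

theorem order_shift (k : Fin m) (v : DVar m n) : (v.shift k).order = v.order + 1 := by
  simp [order, shift, Finset.sum_add_distrib]

theorem lt_shift (k : Fin m) (v : DVar m n) : v < v.shift k :=
  lt_of_order_lt (by rw [order_shift]; omega)

theorem shift_lt_shift (k : Fin m) {v w : DVar m n} (h : v < w) : v.shift k < w.shift k := by
  rw [lt_iff_key, key, key, Prod.Lex.toLex_lt_toLex, Prod.Lex.toLex_lt_toLex] at h ⊢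
  rw [order_shift, order_shift]
  rcases h with h | ⟨h, h' | ⟨h', h''⟩⟩
  · exact Or.inl (by simpa using h)
  · exact Or.inr ⟨by simpa using h, Or.inl h'⟩
  · exact Or.inr ⟨by simpa using h, Or.inr ⟨h', by simpa [shift] using h''⟩⟩

theorem shift_le_shift (k : Fin m) {v w : DVar m n} (h : v ≤ w) : v.shift k ≤ w.shift k := by
  rcases h.eq_or_lt with rfl | h
  · exact le_rfl
  · exact (shift_lt_shift k h).le

theorem IsProperDerivative.lt {w v : DVar m n} (h : w.IsProperDerivative v) : v < w :=
  lt_of_order_lt (Finset.sum_lt_sum (fun k _ => h.2.le k)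
    (by obtain ⟨k, hk⟩ := (Pi.lt_def.1 h.2).2; exact ⟨k, Finset.mem_univ k, hk⟩))

theorem IsProperDerivative.exists_deriv {w v : DVar m n} (h : w.IsProperDerivative v) :
    ∃ ξ : Fin m → ℕ, ξ ≠ 0 ∧ w = deriv ξ v := by
  refine ⟨w.exp - v.exp, fun h0 => ?_, DVar.ext h.1 ?_⟩
  · exact absurd (tsub_eq_zero_iff_le.1 h0) (not_le_of_gt h.2)
  · exact (add_tsub_cancel_of_le h.2.le).symm

end DVar

/-! ### Evaluation of differential polynomials -/

theorem nablaAll_shift {m n : ℕ} {L : Type*} [CommRing L] [DiffRing m L] (a : Fin n → L)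
    (k : Fin m) (v : DVar m n) : nablaAll m a (v.shift k) = DiffRing.δ k (nablaAll m a v) :=
  DiffRing.iter_add_single _ _ _

theorem nablaAll_zero {m n : ℕ} {L : Type*} [CommRing L] [DiffRing m L] (a : Fin n → L)
    (i : Fin n) : nablaAll m a ⟨i, 0⟩ = a i :=
  DiffRing.iter_zero _

theorem δ_eq_polyDer {m n : ℕ} {K : Type*} [CommRing K] [DiffRing m K] (k : Fin m)
    (f : DiffPoly m n K) : DiffRing.δ k f = polyDer k f := rfl

theorem DiffPoly.val_δ {m n : ℕ} {K L : Type*} [CommRing K] [CommRing L] [DiffRing m K]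
    [DiffRing m L] [Algebra K L] [DiffExt m K L] (k : Fin m) (f : DiffPoly m n K)
    (a : Fin n → L) : (DiffRing.δ k f).val a = DiffRing.δ k (f.val a) := by
  rw [δ_eq_polyDer]
  unfold DiffPoly.val
  induction f using MvPolynomial.induction_on with
  | C c => rw [polyDer_C, aeval_C, aeval_C, DiffExt.map_δ]
  | add p q hp hq => rw [polyDer_add, map_add, hp, hq, map_add, DiffRing.δ_add]
  | mul_X p v hp =>
    rw [polyDer_mul, polyDer_X, map_add, map_mul, map_mul, map_mul, hp, aeval_X, aeval_X,
      DiffRing.δ_mul, nablaAll_shift]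

theorem DiffPoly.val_iter_eq_zero {m n : ℕ} {K L : Type*} [CommRing K] [CommRing L]
    [DiffRing m K] [DiffRing m L] [Algebra K L] [DiffExt m K L] {f : DiffPoly m n K}
    {a : Fin n → L} (h : f.val a = 0) (ξ : Fin m → ℕ) : (DiffRing.iter ξ f).val a = 0 := by
  induction ξ using multiIndex_induction with
  | h0 => rwa [DiffRing.iter_zero]
  | h1 ξ k ih => rw [DiffRing.iter_add_single, DiffPoly.val_δ, ih, DiffRing.δ_zero]

theorem DiffRing.IsDiffIdeal.iter_mem {m : ℕ} {R : Type*} [CommRing R] [DiffRing m R]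
    {I : Ideal R} (hI : DiffRing.IsDiffIdeal m I) {f : R} (h : f ∈ I) (ξ : Fin m → ℕ) :
    DiffRing.iter ξ f ∈ I := by
  induction ξ using multiIndex_induction with
  | h0 => rwa [DiffRing.iter_zero]
  | h1 ξ k ih => rw [DiffRing.iter_add_single]; exact hI k _ ih

theorem nablaAll_algebraMap {m n : ℕ} {K L : Type*} [CommRing K] [CommRing L] [DiffRing m K]
    [DiffRing m L] [Algebra K L] [DiffExt m K L] (a : Fin n → K) (v : DVar m n) :
    nablaAll m (fun i => algebraMap K L (a i)) v = algebraMap K L (nablaAll m a v) := by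
  unfold nablaAll
  generalize v.exp = ξ
  induction ξ using multiIndex_induction with
  | h0 => simp only [DiffRing.iter_zero]
  | h1 ξ k ih => rw [DiffRing.iter_add_single, DiffRing.iter_add_single, ih, DiffExt.map_δ]

theorem DiffPoly.val_algebraMap {m n : ℕ} {K F L : Type*} [CommRing K] [CommRing F] [CommRing L]
    [DiffRing m F] [DiffRing m L] [Algebra K F] [Algebra K L] [Algebra F L]
    [IsScalarTower K F L] [DiffExt m F L] (f : DiffPoly m n K) (a : Fin n → F) :
    f.val (fun i => algebraMap F L (a i)) = algebraMap F L (f.val a) := by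
  unfold DiffPoly.val
  have h : nablaAll m (fun i => algebraMap F L (a i)) =
      fun v => algebraMap F L (nablaAll m a v) := funext fun v => nablaAll_algebraMap a v
  rw [h]
  exact aeval_algebraMap_apply L (nablaAll m a) f

/-! ### Derivatives of a differential polynomial with a given leader -/

section Leader

variable {m n : ℕ} {K : Type*} [Field K]

theorem mem_supported_of_vars {σ : Type*} {s : Set σ} {p : MvPolynomial σ K}
    (h : ∀ v ∈ p.vars, v ∈ s) : p ∈ supported K s :=
  mem_supported.2 fun v hv => h v (Finset.mem_coe.1 hv)

theorem vars_of_mem_supported {σ : Type*} {s : Set σ} {p : MvPolynomial σ K}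
    (h : p ∈ supported K s) : ∀ v ∈ p.vars, v ∈ s :=
  fun _ hv => mem_supported.1 h (Finset.mem_coe.2 hv)

theorem δ_mem_supported [DiffRing m K] {s t : Set (DVar m n)} {k : Fin m} (hst : s ⊆ t)
    (h : ∀ v ∈ s, v.shift k ∈ t) {p : DiffPoly m n K} (hp : p ∈ supported K s) :
    DiffRing.δ k p ∈ supported K t := by
  refine Algebra.adjoin_induction (p := fun p _ => DiffRing.δ k p ∈ supported K t)
    ?_ ?_ ?_ ?_ hp
  · rintro _ ⟨v, hv, rfl⟩
    rw [δ_eq_polyDer, polyDer_X]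
    exact X_mem_supported.2 (h v hv)
  · intro c
    rw [δ_eq_polyDer, algebraMap_eq, polyDer_C]
    exact (supported K t).algebraMap_mem _
  · intro p q _ _ hp hq
    rw [DiffRing.δ_add]
    exact add_mem hp hq
  · intro p q hp' hq' hp hq
    rw [DiffRing.δ_mul]
    exact add_mem (mul_mem (supported_mono hst hp') hq) (mul_mem (supported_mono hst hq') hp)

theorem pderiv_mem_supported {σ : Type*} {s : Set σ} {p : MvPolynomial σ K} (v : σ)
    (hp : p ∈ supported K s) : pderiv v p ∈ supported K s := by
  classical
  refine Algebra.adjoin_induction (p := fun p _ => pderiv v p ∈ supported K s)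
    ?_ ?_ ?_ ?_ hp
  · rintro _ ⟨w, hw, rfl⟩
    rw [pderiv_X, Pi.single_apply]
    split_ifs
    · exact one_mem _
    · exact zero_mem _
  · intro c
    rw [algebraMap_eq, pderiv_C]
    exact zero_mem _
  · intro p q _ _ hp hq
    rw [map_add]
    exact add_mem hp hq
  · intro p q hp' hq' hp hq
    rw [Derivation.leibniz]
    exact add_mem (mul_mem hp' hq) (mul_mem hq' hp)

theorem coeffDer_mem_supported [DiffRing m K] {σ : Type*} {s : Set σ} {k : Fin m}
    {p : MvPolynomial σ K} (hp : p ∈ supported K s) : coeffDer k p ∈ supported K s := by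
  refine mem_supported_of_vars fun v hv => ?_
  obtain ⟨e, he, hve⟩ := (mem_vars_iff_mem_support v).1 hv
  refine vars_of_mem_supported hp v ((mem_vars_iff_mem_support v).2 ⟨e, ?_, hve⟩)
  rw [mem_support_iff] at he ⊢
  intro h0
  rw [coeff_coeffDer, h0, DiffRing.δ_zero] at he
  exact he rfl

theorem IsLeader.mem_vars {f : DiffPoly m n K} {v : DVar m n} (h : IsLeader f v) : v ∈ f.vars :=
  Finset.mem_of_max h

theorem IsLeader.le {f : DiffPoly m n K} {v w : DVar m n} (h : IsLeader f v) (hw : w ∈ f.vars) :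
    w ≤ v := by
  have := Finset.le_max hw
  rw [h] at this
  exact WithBot.coe_le_coe.1 this

theorem IsLeader.nonempty {f : DiffPoly m n K} {v : DVar m n} (h : IsLeader f v) :
    f.vars.Nonempty := ⟨v, h.mem_vars⟩

theorem IsLeader.max'_eq {f : DiffPoly m n K} {v : DVar m n} (h : IsLeader f v)
    (h' : f.vars.Nonempty) : f.vars.max' h' = v := by
  have := Finset.coe_max' h'
  rw [h] at this
  exact WithBot.coe_injective this

theorem exists_isLeader {f : DiffPoly m n K} (h : f.vars.Nonempty) : ∃ v, IsLeader f v :=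
  ⟨f.vars.max' h, (Finset.coe_max' h).symm⟩

theorem IsLeader.separant_eq {f : DiffPoly m n K} {v : DVar m n} (h : IsLeader f v) :
    separant f = pderiv v f := by
  rw [separant, dif_pos h.nonempty, h.max'_eq]

theorem IsLeader.initial_eq {f : DiffPoly m n K} {v : DVar m n} (h : IsLeader f v) :
    initial f = leadingCoeffIn v f := by
  rw [initial, dif_pos h.nonempty, h.max'_eq]

theorem IsLeader.polyRank_eq {f : DiffPoly m n K} {v : DVar m n} (h : IsLeader f v) :
    polyRank f = toLex ((v : WithBot (DVar m n)), f.degreeOf v) := by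
  rw [polyRank, dif_pos h.nonempty, h.max'_eq, h]

theorem IsLeader.mem_supported {f : DiffPoly m n K} {v : DVar m n} (h : IsLeader f v) :
    f ∈ supported K {w | w ≤ v} :=
  mem_supported_of_vars fun _ hw => h.le hw

/-- The chain rule. It isolates the term of the leader, whose coefficient is the separant. -/
theorem mkDerivation_eq_sum_pderiv {σ R : Type*} [CommRing R] (g : σ → MvPolynomial σ R)
    (f : MvPolynomial σ R) : mkDerivation R g f = ∑ v ∈ f.vars, pderiv v f * g v := by
  classical
  have h : ∀ f : MvPolynomial σ R, ∀ s : Finset σ, f.vars ⊆ s →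
      ∑ v ∈ s, pderiv v f * g v = ∑ v ∈ f.vars, pderiv v f * g v := by
    intro f s hs
    refine (Finset.sum_subset hs fun v _ hv => ?_).symm
    rw [pderiv_eq_zero_of_notMem_vars hv, zero_mul]
  induction f using MvPolynomial.induction_on with
  | C a => simp
  | add p q hp hq =>
    rw [← h _ _ (vars_add_subset p q), map_add, hp, hq,
      ← h p (p.vars ∪ q.vars) Finset.subset_union_left,
      ← h q (p.vars ∪ q.vars) Finset.subset_union_right, ← Finset.sum_add_distrib]
    exact Finset.sum_congr rfl fun v _ => by rw [map_add, add_mul]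
  | mul_X p w hp =>
    rw [Derivation.leibniz, hp, mkDerivation_X, smul_eq_mul, smul_eq_mul,
      ← h (p * X w) (insert w p.vars) ?_,
      ← h p (insert w p.vars) (Finset.subset_insert _ _), Finset.mul_sum]
    · have h2 : p * g w = ∑ v ∈ insert w p.vars, p * pderiv v (X w) * g v := by
        rw [Finset.sum_eq_single w]
        · simp
        · intro v _ hv
          rw [pderiv_X_of_ne hv.symm]
          simp
        · simp
      rw [h2, ← Finset.sum_add_distrib]
      refine Finset.sum_congr rfl fun v _ => ?_
      rw [Derivation.leibniz, smul_eq_mul, smul_eq_mul]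
      ring
    · refine (vars_mul p (X w)).trans (Finset.union_subset (Finset.subset_insert _ _) ?_)
      rcases subsingleton_or_nontrivial R with _ | _
      · rw [Subsingleton.elim (X w : MvPolynomial σ R) 0, vars_0]
        exact Finset.empty_subset _
      · rw [vars_X]
        exact Finset.singleton_subset_iff.2 (Finset.mem_insert_self _ _)

/-- By the chain rule the first derivation produces the derivative of the leader linearly, with the
separant as coefficient; all else ranks lower because the ranking is compatible with shifts. Further
derivations preserve this shape, since differentiating the separant only brings in lower
indeterminates. -/
theorem IsLeader.exists_iter_eq [DiffRing m K] {f : DiffPoly m n K} {v : DVar m n}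
    (h : IsLeader f v) {ξ : Fin m → ℕ} (hξ : ξ ≠ 0) :
    ∃ T ∈ supported K {w | w < v.deriv ξ},
      DiffRing.iter ξ f = separant f * X (v.deriv ξ) + T := by
  have hS : separant f ∈ supported K {w | w ≤ v} := by
    rw [h.separant_eq]
    exact pderiv_mem_supported v h.mem_supported
  -- The case `ξ = 0` is set apart because `f` itself need not be linear in its leader; the
  -- inequality is carried along to keep derivatives of the separant below the new leader.
  suffices H : ξ = 0 ∨ (v < v.deriv ξ ∧ ∃ T ∈ supported K {w | w < v.deriv ξ},
      DiffRing.iter ξ f = separant f * X (v.deriv ξ) + T) from (H.resolve_left hξ).2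
  clear hξ
  induction ξ using multiIndex_induction with
  | h0 => exact Or.inl rfl
  | h1 ξ k ih =>
    right
    rw [DVar.deriv_add_single, DiffRing.iter_add_single]
    rcases ih with rfl | ⟨hlt, T, hT, he⟩
    · rw [DiffRing.iter_zero, DVar.deriv_zero]
      refine ⟨DVar.lt_shift k v, DiffRing.δ k f - separant f * X (v.shift k), ?_, by ring⟩
      rw [δ_eq_polyDer, polyDer, mkDerivation_eq_sum_pderiv,
        ← Finset.add_sum_erase _ _ h.mem_vars, h.separant_eq]
      have : ∀ a b c : DiffPoly m n K, a + (b + c) - b = a + c := fun a b c => by ring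
      rw [this]
      have hle : {w | w ≤ v} ⊆ {w | w < v.shift k} := fun w hw =>
        lt_of_le_of_lt hw (DVar.lt_shift k v)
      refine add_mem (supported_mono hle (coeffDer_mem_supported h.mem_supported))
        (sum_mem fun w hw => mul_mem (supported_mono hle (pderiv_mem_supported w h.mem_supported))
          (X_mem_supported.2 ?_))
      rw [Finset.mem_erase] at hw
      exact DVar.shift_lt_shift k (lt_of_le_of_ne (h.le hw.2) hw.1)
    · refine ⟨hlt.trans (DVar.lt_shift k _),
        X (v.deriv ξ) * DiffRing.δ k (separant f) + DiffRing.δ k T, ?_, ?_⟩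
      · refine add_mem (mul_mem (X_mem_supported.2 (DVar.lt_shift k _)) ?_) ?_
        · exact δ_mem_supported (s := {w | w ≤ v}) (t := {w | w < (v.deriv ξ).shift k})
            (fun w hw => lt_of_le_of_lt hw (hlt.trans (DVar.lt_shift k _)))
            (fun w hw => lt_of_le_of_lt (DVar.shift_le_shift k hw) (DVar.shift_lt_shift k hlt)) hS
        · exact δ_mem_supported (s := {w | w < v.deriv ξ}) (t := {w | w < (v.deriv ξ).shift k})
            (fun w hw => lt_trans hw (DVar.lt_shift k _))
            (fun w hw => DVar.shift_lt_shift k hw) hT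
      · rw [he, DiffRing.δ_add, DiffRing.δ_mul, δ_eq_polyDer k (X _), polyDer_X]
        ring

end Leader

/-! ### Pseudo-division and Ritt reduction -/

section Reduction

variable {m n : ℕ} {K : Type*} [Field K]

theorem degreeOf_ne_zero_iff_mem_vars {σ : Type*} {v : σ} {p : MvPolynomial σ K} :
    p.degreeOf v ≠ 0 ↔ v ∈ p.vars :=
  mem_vars_iff_degreeOf_ne_zero.symm

theorem degreeOf_eq_zero_of_mem_supported {σ : Type*} {s : Set σ} {v : σ} {p : MvPolynomial σ K}
    (hp : p ∈ supported K s) (hv : v ∉ s) : p.degreeOf v = 0 := by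
  by_contra h
  exact hv (vars_of_mem_supported hp v (degreeOf_ne_zero_iff_mem_vars.1 h))

theorem leadingCoeffIn_mul_X_pow (v : DVar m n) (f : DiffPoly m n K) :
    leadingCoeffIn v f * X v ^ f.degreeOf v =
      ∑ s ∈ f.support with s v = f.degreeOf v, monomial s (coeff s f) := by
  rw [leadingCoeffIn, Finset.sum_mul]
  refine Finset.sum_congr rfl fun s hs => ?_
  rw [← (Finset.mem_filter.1 hs).2, X_pow_eq_monomial, monomial_mul, mul_one,
    Finsupp.erase_add_single]

theorem degreeOf_sub_leadingCoeffIn_lt {v : DVar m n} {f : DiffPoly m n K}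
    (h : 0 < f.degreeOf v) :
    (f - leadingCoeffIn v f * X v ^ f.degreeOf v).degreeOf v < f.degreeOf v := by
  classical
  have h1 : f - leadingCoeffIn v f * X v ^ f.degreeOf v =
      ∑ s ∈ f.support with ¬ s v = f.degreeOf v, monomial s (coeff s f) := by
    rw [leadingCoeffIn_mul_X_pow, sub_eq_iff_eq_add', Finset.sum_filter_add_sum_filter_not]
    exact f.as_sum
  rw [h1]
  refine lt_of_le_of_lt (degreeOf_sum_le _ _ _) ((Finset.sup_lt_iff h).2 fun s hs => ?_)
  rw [Finset.mem_filter] at hs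
  rw [degreeOf_monomial_eq _ _ (mem_support_iff.1 hs.1)]
  exact lt_of_le_of_ne (monomial_le_degreeOf v hs.1) hs.2

theorem degreeOf_leadingCoeffIn_le (v w : DVar m n) (f : DiffPoly m n K) :
    (leadingCoeffIn v f).degreeOf w ≤ f.degreeOf w := by
  classical
  refine (degreeOf_sum_le _ _ _).trans (Finset.sup_le fun s hs => ?_)
  rw [Finset.mem_filter] at hs
  rw [degreeOf_monomial_eq _ _ (mem_support_iff.1 hs.1)]
  refine le_trans ?_ (monomial_le_degreeOf w hs.1)
  rw [Finsupp.erase_apply]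
  split_ifs <;> simp

theorem degreeOf_leadingCoeffIn_self (v : DVar m n) (f : DiffPoly m n K) :
    (leadingCoeffIn v f).degreeOf v = 0 := by
  classical
  refine Nat.le_zero.1 ((degreeOf_sum_le _ _ _).trans (Finset.sup_le fun s hs => ?_))
  rw [Finset.mem_filter] at hs
  rw [degreeOf_monomial_eq _ _ (mem_support_iff.1 hs.1), Finsupp.erase_same]

theorem leadingCoeffIn_ne_zero {v : DVar m n} {f : DiffPoly m n K} (h : 0 < f.degreeOf v) :
    leadingCoeffIn v f ≠ 0 := by
  intro h0
  have := degreeOf_sub_leadingCoeffIn_lt h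
  rw [h0, zero_mul, sub_zero] at this
  exact lt_irrefl _ this

theorem mem_supported_of_degreeOf_le {σ : Type*} {s : Set σ} {p q : MvPolynomial σ K}
    (hp : p ∈ supported K s) (h : ∀ v, q.degreeOf v ≤ p.degreeOf v) : q ∈ supported K s := by
  refine mem_supported_of_vars fun v hv => vars_of_mem_supported hp v ?_
  rw [← degreeOf_ne_zero_iff_mem_vars] at hv ⊢
  have := h v
  omega

theorem leadingCoeffIn_mem_supported {s : Set (DVar m n)} (v : DVar m n) {f : DiffPoly m n K}
    (hf : f ∈ supported K s) : leadingCoeffIn v f ∈ supported K s :=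
  mem_supported_of_degreeOf_le hf fun w => degreeOf_leadingCoeffIn_le v w f

theorem leadingCoeffIn_mem_supported_lt {v : DVar m n} {f : DiffPoly m n K}
    (hf : f ∈ supported K {w | w ≤ v}) : leadingCoeffIn v f ∈ supported K {w | w < v} := by
  refine mem_supported_of_vars fun w hw => ?_
  refine Set.mem_ofPred_eq ▸ lt_of_le_of_ne (a := w)
    (vars_of_mem_supported (leadingCoeffIn_mem_supported v hf) w hw) ?_
  rintro rfl
  exact degreeOf_ne_zero_iff_mem_vars.2 hw (degreeOf_leadingCoeffIn_self w f)

theorem degreeOf_sub_leadingCoeffIn_le (v w : DVar m n) (f : DiffPoly m n K) :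
    (f - leadingCoeffIn v f * X v ^ f.degreeOf v).degreeOf w ≤ f.degreeOf w := by
  classical
  have h1 : f - leadingCoeffIn v f * X v ^ f.degreeOf v =
      ∑ s ∈ f.support with ¬ s v = f.degreeOf v, monomial s (coeff s f) := by
    rw [leadingCoeffIn_mul_X_pow, sub_eq_iff_eq_add', Finset.sum_filter_add_sum_filter_not]
    exact f.as_sum
  rw [h1]
  refine (degreeOf_sum_le _ _ _).trans (Finset.sup_le fun s hs => ?_)
  rw [Finset.mem_filter] at hs
  rw [degreeOf_monomial_eq _ _ (mem_support_iff.1 hs.1)]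
  exact monomial_le_degreeOf w hs.1

/-- A pseudo-division step: the leading term in `v` is cancelled, and the degrees in the
indeterminates above `v` do not grow. -/
theorem exists_pseudoDivision_step {s : Set (DVar m n)} {v : DVar m n} {d : ℕ}
    {A B p : DiffPoly m n K} (hd : 0 < d) (hA : A ∈ supported K {w | w < v})
    (hB : B ∈ supported K {w | w ≤ v}) (hBd : B.degreeOf v < d) (hAs : A ∈ supported K s)
    (hBs : B ∈ supported K s) (hps : p ∈ supported K s) (hp : d ≤ p.degreeOf v) :
    ∃ c p₁ : DiffPoly m n K, A * p = p₁ + c * (A * X v ^ d + B) ∧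
      p₁.degreeOf v < p.degreeOf v ∧ (∀ w, v < w → p₁.degreeOf w ≤ p.degreeOf w) ∧
      p₁ ∈ supported K s := by
  have hAv : A.degreeOf v = 0 := degreeOf_eq_zero_of_mem_supported hA (lt_irrefl v)
  obtain ⟨e, he⟩ := Nat.exists_eq_add_of_le hp
  have hvs : v ∈ s := vars_of_mem_supported hps v (degreeOf_ne_zero_iff_mem_vars.1 (by omega))
  set c := leadingCoeffIn v p
  set q := p - c * X v ^ p.degreeOf v with hq
  have hc := leadingCoeffIn_mem_supported v hps
  have hX : ∀ w, w ≠ v → (X v ^ e : DiffPoly m n K).degreeOf w = 0 := fun w hw =>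
    Nat.le_zero.1 ((degreeOf_pow_le _ _ _).trans (by rw [degreeOf_X_of_ne hw, mul_zero]))
  have hXv : (X v ^ e : DiffPoly m n K).degreeOf v ≤ e :=
    (degreeOf_pow_le _ _ _).trans (by rw [degreeOf_X_self, mul_one])
  -- With `p = c v^(d+e) + q`, subtracting `c v^e (A v^d + B)` from `A p` cancels the leading term
  -- and leaves `A q - c v^e B`.
  refine ⟨c * X v ^ e, A * q - c * X v ^ e * B, ?_, ?_, fun w hw => ?_, ?_⟩
  · have : p = c * X v ^ (d + e) + q := by rw [hq, he]; ring
    rw [this]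
    ring
  · refine lt_of_le_of_lt (degreeOf_sub_le _ _ _) (max_lt ?_ ?_)
    · refine lt_of_le_of_lt (degreeOf_mul_le _ _ _) ?_
      rw [hAv, zero_add]
      exact degreeOf_sub_leadingCoeffIn_lt (by omega)
    · refine lt_of_le_of_lt (degreeOf_mul_le _ _ _) ?_
      have := degreeOf_mul_le v c (X v ^ e)
      have h0 : c.degreeOf v = 0 := degreeOf_leadingCoeffIn_self v p
      omega
  · have hAw : A.degreeOf w = 0 := degreeOf_eq_zero_of_mem_supported hA (not_lt.2 hw.le)
    have hBw : B.degreeOf w = 0 := degreeOf_eq_zero_of_mem_supported hB (not_le.2 hw)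
    refine (degreeOf_sub_le _ _ _).trans (max_le ?_ ?_)
    · refine (degreeOf_mul_le _ _ _).trans ?_
      rw [hAw, zero_add]
      exact degreeOf_sub_leadingCoeffIn_le v w p
    · refine (degreeOf_mul_le _ _ _).trans ?_
      have := degreeOf_mul_le w c (X v ^ e)
      have h1 : c.degreeOf w ≤ _ := degreeOf_leadingCoeffIn_le v w p
      have h2 := hX w hw.ne'
      omega
  · refine sub_mem (mul_mem hAs (sub_mem hps (mul_mem hc (pow_mem (X_mem_supported.2 hvs) _))))
      (mul_mem (mul_mem hc (pow_mem (X_mem_supported.2 hvs) _)) hBs)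

/-- Reduction of differential polynomials modulo the polynomials `A i * θ i ^ d i + B i`, where
`A i` only involves indeterminates below `θ i` and `B i` has degree `< d i` in `θ i`. -/
theorem exists_reduction {ι : Type*} (θ : ι → DVar m n) (d : ι → ℕ) (A B : ι → DiffPoly m n K)
    (s : Set (DVar m n)) (hd : ∀ i, 0 < d i) (hA : ∀ i, A i ∈ supported K {w | w < θ i})
    (hB : ∀ i, B i ∈ supported K {w | w ≤ θ i}) (hBd : ∀ i, (B i).degreeOf (θ i) < d i)
    (hAs : ∀ i, A i ∈ supported K s) (hBs : ∀ i, B i ∈ supported K s)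
    (p : DiffPoly m n K) (hp : p ∈ supported K s) :
    ∃ h ∈ Submonoid.closure (Set.range A), ∃ p' ∈ supported K s,
      (∀ i, p'.degreeOf (θ i) < d i) ∧
      h * p - p' ∈ Ideal.span (Set.range fun i => A i * X (θ i) ^ d i + B i) := by
  classical
  -- Outer well-founded induction on a bound `v` from which upwards `p` is already reduced; `⊤`
  -- carries no information and starts the descent.
  have key : ∀ v : WithTop (DVar m n), ∀ p ∈ supported K s,
      (∀ i, v ≤ (θ i : WithTop _) → p.degreeOf (θ i) < d i) →
      ∃ h ∈ Submonoid.closure (Set.range A), ∃ p' ∈ supported K s,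
      (∀ i, p'.degreeOf (θ i) < d i) ∧
      h * p - p' ∈ Ideal.span (Set.range fun i => A i * X (θ i) ^ d i + B i) := by
    intro v
    induction v using WellFoundedLT.induction with
    | ind v ih =>
      intro p hp hpv
      by_cases hred : ∀ i, p.degreeOf (θ i) < d i
      · exact ⟨1, one_mem _, p, hp, hred, by simp⟩
      push Not at hred
      let bad : Finset (DVar m n) := p.vars.filter fun w => ∃ i, θ i = w ∧ d i ≤ p.degreeOf w
      have hbad : bad.Nonempty := by
        obtain ⟨i, hi⟩ := hred
        refine ⟨θ i, Finset.mem_filter.2 ⟨?_, i, rfl, hi⟩⟩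
        have := hd i
        exact degreeOf_ne_zero_iff_mem_vars.1 (by omega)
      obtain ⟨w, hw, hmax⟩ := bad.exists_max_image id hbad
      obtain ⟨-, i₀, hi₀, -⟩ := Finset.mem_filter.1 hw
      have hwv : (w : WithTop _) < v := by
        obtain ⟨-, i, rfl, hi⟩ := Finset.mem_filter.1 hw
        by_contra! h
        exact absurd (hpv i h) (not_lt.2 hi)
      have habove : ∀ i, w < θ i → p.degreeOf (θ i) < d i := by
        intro i hi
        by_contra! h
        have := hd i
        refine absurd (hmax (θ i) (Finset.mem_filter.2
          ⟨degreeOf_ne_zero_iff_mem_vars.1 (by omega), i, rfl, h⟩)) (not_le.2 hi)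
      clear hw hmax hbad hred hpv
      -- Inner induction on the degree in the highest offending indeterminate `w`. Pseudo-division
      -- lowers this degree without disturbing anything above `w`; once `w` is harmless, `w` becomes
      -- the new bound.
      obtain ⟨e, he⟩ : ∃ e, p.degreeOf w = e := ⟨_, rfl⟩
      induction e using Nat.strong_induction_on generalizing p with
      | _ e ihe =>
        by_cases hw : ∃ i, θ i = w ∧ d i ≤ p.degreeOf w
        · obtain ⟨i, rfl, hi⟩ := hw
          obtain ⟨c, p₁, h1, h2, h3, h4⟩ := exists_pseudoDivision_step (hd i) (hA i) (hB i)
            (hBd i) (hAs i) (hBs i) hp hi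
          obtain ⟨h, hh, p', hp', hp'r, hp's⟩ := ihe _ (he ▸ h2) p₁ h4
            (fun j hj => lt_of_le_of_lt (h3 _ hj) (habove j hj)) rfl
          refine ⟨h * A i, mul_mem hh (Submonoid.subset_closure ⟨i, rfl⟩), p', hp', hp'r, ?_⟩
          have : h * A i * p - p' = (h * p₁ - p') + h * c * (A i * X (θ i) ^ d i + B i) := by
            rw [mul_assoc, h1]
            ring
          rw [this]
          exact add_mem hp's (Ideal.mul_mem_left _ _ (Ideal.subset_span ⟨i, rfl⟩))
        · push Not at hw
          refine ih w hwv p hp fun i hi => ?_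
          rcases (WithTop.coe_le_coe.1 hi).eq_or_lt with h | h
          · rw [← h]
            exact hw i h.symm
          · exact habove i h
  exact key ⊤ p hp fun i hi => absurd hi (by simp)

end Reduction

/-! ### Autoreduced sets and existence of characteristic sets -/

section CharSet

variable {m n : ℕ} {K : Type*} [Field K]

/-- Two strictly increasing lists first differ at the least element of their symmetric difference,
and the smaller list is the one containing it. A proper extension counts as smaller for the same
reason. This replaces indices by membership of ranks. -/
theorem sortedList_lt_iff {α : Type*} [LinearOrder α] (l' l : List α)
    (hl' : l'.Pairwise (· < ·)) (hl : l.Pairwise (· < ·)) :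
    ((∃ i : ℕ, (∀ j < i, l'[j]? = l[j]?) ∧ ∃ a ∈ l'[i]?, ∃ b ∈ l[i]?, a < b) ∨
      (l.length < l'.length ∧ ∀ j < l.length, l'[j]? = l[j]?)) ↔
    ∃ a ∈ l', a ∉ l ∧ ∀ x < a, (x ∈ l ↔ x ∈ l') := by
  induction l' generalizing l with
  | nil => simp
  | cons a s ih =>
    rw [List.pairwise_cons] at hl'
    cases l with
    | nil =>
      refine iff_of_true (Or.inr (by simp)) ⟨a, by simp, by simp, fun x hx => ?_⟩
      simp only [List.not_mem_nil, List.mem_cons, false_iff, not_or]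
      exact ⟨hx.ne, fun h => absurd (hl'.1 x h) (not_lt.2 hx.le)⟩
    | cons b t =>
      have hl0 := hl
      rw [List.pairwise_cons] at hl
      rcases lt_trichotomy a b with hab | rfl | hab
      · refine iff_of_true (Or.inl ⟨0, by simp, a, by simp, b, by simp, hab⟩)
          ⟨a, by simp, ?_, fun x hx => ?_⟩
        · simp only [List.mem_cons, not_or]
          exact ⟨hab.ne, fun h => absurd (hl.1 a h) (not_lt.2 hab.le)⟩
        · simp only [List.mem_cons]
          refine iff_of_false ?_ ?_
          · rintro (rfl | h)
            · exact absurd hx (not_lt.2 hab.le)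
            · exact absurd (hl.1 x h) (not_lt.2 (hx.trans hab).le)
          · rintro (rfl | h)
            · exact lt_irrefl _ hx
            · exact absurd (hl'.1 x h) (not_lt.2 hx.le)
      · have h1 := ih t hl'.2 hl.2
        have h2 : (∃ c ∈ a :: s, c ∉ a :: t ∧ ∀ x < c, (x ∈ a :: t ↔ x ∈ a :: s)) ↔
            ∃ c ∈ s, c ∉ t ∧ ∀ x < c, (x ∈ t ↔ x ∈ s) := by
          constructor
          · rintro ⟨c, hc, hct, h⟩
            simp only [List.mem_cons, not_or] at hc hct
            refine ⟨c, hc.resolve_left hct.1, hct.2, fun x hx => ?_⟩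
            have := h x hx
            simp only [List.mem_cons] at this
            by_cases hxa : x = a
            · subst hxa
              exact iff_of_false (fun h => lt_irrefl _ (hl.1 x h))
                (fun h => lt_irrefl _ (hl'.1 x h))
            · simpa [hxa] using this
          · rintro ⟨c, hc, hct, h⟩
            refine ⟨c, List.mem_cons_of_mem _ hc, ?_, fun x hx => ?_⟩
            · simp only [List.mem_cons, not_or]
              exact ⟨(hl'.1 c hc).ne', hct⟩
            · simp only [List.mem_cons, h x hx]
        rw [h2, ← h1]
        refine or_congr ⟨?_, ?_⟩ ⟨?_, ?_⟩
        · rintro ⟨i, hi, c, hc, d, hd, hcd⟩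
          cases i with
          | zero =>
            simp only [List.getElem?_cons_zero, Option.mem_def, Option.some.injEq] at hc hd
            exact absurd hcd (by rw [← hc, ← hd]; exact lt_irrefl _)
          | succ i =>
            refine ⟨i, fun j hj => ?_, c, by simpa using hc, d, by simpa using hd, hcd⟩
            simpa using hi (j + 1) (by omega)
        · rintro ⟨i, hi, c, hc, d, hd, hcd⟩
          refine ⟨i + 1, fun j hj => ?_, c, by simpa using hc, d, by simpa using hd, hcd⟩
          cases j with
          | zero => simp
          | succ j => simpa using hi j (by omega)
        · rintro ⟨h, h'⟩
          refine ⟨by simpa using h, fun j hj => ?_⟩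
          simpa using h' (j + 1) (by simpa using hj)
        · rintro ⟨h, h'⟩
          refine ⟨by simpa using h, fun j hj => ?_⟩
          cases j with
          | zero => simp
          | succ j => simpa using h' j (by simpa using hj)
      · refine iff_of_false ?_ ?_
        · rintro (⟨i, hi, c, hc, d, hd, hcd⟩ | ⟨-, h⟩)
          · cases i with
            | zero =>
              simp only [List.getElem?_cons_zero, Option.mem_def, Option.some.injEq] at hc hd
              exact absurd hcd (by rw [← hc, ← hd]; exact not_lt.2 hab.le)
            | succ i =>
              have := hi 0 (by omega)
              simp only [List.getElem?_cons_zero, Option.some.injEq] at this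
              exact hab.ne' this
          · have := h 0 (by simp)
            simp only [List.getElem?_cons_zero, Option.some.injEq] at this
            exact hab.ne' this
        · rintro ⟨c, hc, hcb, h⟩
          have hbc : b < c := by
            rcases List.mem_cons.1 hc with rfl | hc
            · exact hab
            · exact hab.trans (hl'.1 c hc)
          rcases List.mem_cons.1 ((h b hbc).1 (by simp)) with rfl | h
          · exact lt_irrefl _ hab
          · exact absurd (hl'.1 b h) (not_lt.2 hab.le)

/-- Being reduced with respect to `f` only involves the leader of `f` and its degree, which the rank
records. -/
theorem IsReducedWrt.of_polyRank_eq {g f f' : DiffPoly m n K} (h : IsReducedWrt g f)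
    (hf : f.vars.Nonempty) (hr : polyRank f = polyRank f') (hf' : f'.vars.Nonempty) :
    IsReducedWrt g f' := by
  obtain ⟨v, hv⟩ := exists_isLeader hf
  obtain ⟨v', hv'⟩ := exists_isLeader hf'
  rw [hv.polyRank_eq, hv'.polyRank_eq] at hr
  have h2 := Prod.ext_iff.1 (toLex.injective hr)
  obtain rfl : v = v' := WithBot.coe_injective h2.1
  intro w hw
  obtain rfl : v = w := WithBot.coe_injective (hv'.symm.trans hw)
  refine ⟨(h v hv).1, (h v hv).2.trans_eq h2.2⟩

theorem not_isReducedWrt_of_polyRank_eq {g f : DiffPoly m n K} (hf : f.vars.Nonempty)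
    (hg : g.vars.Nonempty) (hr : polyRank f = polyRank g) : ¬ IsReducedWrt g f := by
  intro h
  obtain ⟨v, hv⟩ := exists_isLeader hg
  exact lt_irrefl _ (h.of_polyRank_eq hf hr hg v hv).2

theorem IsReducedWrt.of_polyRank_lt {g f : DiffPoly m n K} (hf : f.vars.Nonempty)
    (hg : g.vars.Nonempty) (hr : polyRank g < polyRank f) : IsReducedWrt g f := by
  obtain ⟨v, hv⟩ := exists_isLeader hf
  obtain ⟨w, hw⟩ := exists_isLeader hg
  intro v' hv'
  obtain rfl : v = v' := WithBot.coe_injective (hv.symm.trans hv')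
  rw [hw.polyRank_eq, hv.polyRank_eq, Prod.Lex.toLex_lt_toLex] at hr
  have hwv : w ≤ v := by
    rcases hr with h | ⟨h, -⟩
    · exact (WithBot.coe_lt_coe.1 h).le
    · exact (WithBot.coe_injective h).le
  refine ⟨fun x hx hxv => absurd (hxv.lt.trans_le (hw.le hx)) (not_lt.2 hwv), ?_⟩
  rcases hr with h | ⟨h, h'⟩
  · have h0 : g.degreeOf v = 0 := degreeOf_eq_zero_of_mem_supported hw.mem_supported
      (not_le.2 (WithBot.coe_lt_coe.1 h))
    have := degreeOf_ne_zero_iff_mem_vars.2 hv.mem_vars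
    omega
  · obtain rfl : w = v := WithBot.coe_injective h
    exact h'

theorem IsReducedWrt.mono {g g' f : DiffPoly m n K} (h : IsReducedWrt g f)
    (hg : ∀ w, g'.degreeOf w ≤ g.degreeOf w) : IsReducedWrt g' f := by
  intro v hv
  refine ⟨fun w hw => (h v hv).1 w ?_, (hg v).trans_lt (h v hv).2⟩
  rw [← degreeOf_ne_zero_iff_mem_vars] at hw ⊢
  have := hg w
  omega

theorem IsAutoreduced.injOn_polyRank {Λ : Finset (DiffPoly m n K)} (h : IsAutoreduced Λ) :
    Set.InjOn polyRank (Λ : Set (DiffPoly m n K)) := by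
  intro f hf g hg hr
  by_contra hne
  exact not_isReducedWrt_of_polyRank_eq (h.1 f hf) (h.1 g hg) hr (h.2 f hf g hg hne)

theorem mem_rankList {Λ : Finset (DiffPoly m n K)} {ρ : WithBot (DVar m n) ×ₗ ℕ} :
    ρ ∈ rankList Λ ↔ ∃ f ∈ Λ, polyRank f = ρ := by
  simp [rankList]

theorem IsAutoreduced.pairwise_rankList {Λ : Finset (DiffPoly m n K)} (h : IsAutoreduced Λ) :
    (rankList Λ).Pairwise (· < ·) := by
  have h1 : (rankList Λ).Pairwise (· ≤ ·) := Multiset.pairwise_sort _ _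
  have h2 : (rankList Λ).Nodup := by
    rw [← Multiset.coe_nodup, rankList, Multiset.sort_eq]
    exact (Multiset.nodup_map_iff_inj_on Λ.nodup).2 fun f hf g hg hr => h.injOn_polyRank hf hg hr
  exact h1.imp₂ (fun a b hab hne => lt_of_le_of_ne hab hne) h2

theorem autoreducedLT_iff {G F : Finset (DiffPoly m n K)} (hG : IsAutoreduced G)
    (hF : IsAutoreduced F) :
    AutoreducedLT G F ↔ ∃ g ∈ G, (∀ f ∈ F, polyRank f ≠ polyRank g) ∧
      ∀ ρ < polyRank g, ((∃ f ∈ F, polyRank f = ρ) ↔ ∃ f ∈ G, polyRank f = ρ) := by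
  have hlen : ∀ Λ : Finset (DiffPoly m n K), Λ.card = (rankList Λ).length := by
    intro Λ
    simp [rankList]
  rw [AutoreducedLT, hlen, hlen, sortedList_lt_iff _ _ hG.pairwise_rankList hF.pairwise_rankList]
  simp only [mem_rankList]
  constructor
  · rintro ⟨_, ⟨g, hg, rfl⟩, h1, h2⟩
    exact ⟨g, hg, fun f hf hr => h1 ⟨f, hf, hr⟩, h2⟩
  · rintro ⟨g, hg, h1, h2⟩
    exact ⟨_, ⟨g, hg, rfl⟩, fun ⟨f, hf, hr⟩ => h1 f hf hr, h2⟩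

/-- A nonzero `p` is not constant, as `P` is proper, and its rank differs from those in `Λ`, as it
is reduced. Dropping the elements of `Λ` of higher rank and inserting `p` would then give a lower
autoreduced subset of `P`. -/
theorem IsCharSet.eq_zero_of_reduced {Λ : Finset (DiffPoly m n K)} {P : Ideal (DiffPoly m n K)}
    (h : IsCharSet Λ P) (hP : P ≠ ⊤) {p : DiffPoly m n K} (hp : p ∈ P)
    (hred : ∀ f ∈ Λ, IsReducedWrt p f) : p = 0 := by
  classical
  by_contra hp0
  have hpv : p.vars.Nonempty := by
    by_contra hv
    rw [Finset.not_nonempty_iff_eq_empty, vars_eq_empty_iff_eq_C] at hv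
    refine hP (Ideal.eq_top_of_isUnit_mem _ hp ?_)
    rw [hv] at hp0 ⊢
    refine (IsUnit.mk0 (coeff 0 p) fun h0 => hp0 (by rw [h0, C_0])).map C
  have hne : ∀ f ∈ Λ, polyRank f ≠ polyRank p := fun f hf hr =>
    not_isReducedWrt_of_polyRank_eq (h.1.1.1 f hf) hpv hr (hred f hf)
  have hauto : IsAutoreduced (insert p (Λ.filter fun f => polyRank f < polyRank p)) := by
    refine ⟨fun f hf => ?_, fun f hf g hg hfg => ?_⟩
    · rcases Finset.mem_insert.1 hf with rfl | hf
      · exact hpv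
      · exact h.1.1.1 f (Finset.mem_filter.1 hf).1
    · rcases Finset.mem_insert.1 hf with rfl | hf
      · rcases Finset.mem_insert.1 hg with rfl | hg
        · exact absurd rfl hfg
        · rw [Finset.mem_filter] at hg
          exact .of_polyRank_lt hpv (h.1.1.1 g hg.1) hg.2
      · rw [Finset.mem_filter] at hf
        rcases Finset.mem_insert.1 hg with rfl | hg
        · exact hred f hf.1
        · exact h.1.1.2 f hf.1 g (Finset.mem_filter.1 hg).1 hfg
  refine h.2 _ hauto ?_ ((autoreducedLT_iff hauto h.1.1).2
    ⟨p, Finset.mem_insert_self _ _, hne, fun ρ hρ => ⟨?_, ?_⟩⟩)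
  · intro f hf
    rcases Finset.mem_insert.1 (Finset.mem_coe.1 hf) with rfl | hf
    · exact hp
    · exact h.1.2 (Finset.mem_filter.1 hf).1
  · rintro ⟨f, hf, rfl⟩
    exact ⟨f, Finset.mem_insert_of_mem (Finset.mem_filter.2 ⟨hf, hρ⟩), rfl⟩
  · rintro ⟨f, hf, rfl⟩
    rcases Finset.mem_insert.1 hf with rfl | hf
    · exact absurd hρ (lt_irrefl _)
    · exact ⟨f, (Finset.mem_filter.1 hf).1, rfl⟩

/-- A polynomial that is smaller than an element of a characteristic set in the degrees is not
in the ideal. -/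
theorem IsCharSet.notMem_of_degreeOf_lt {Λ : Finset (DiffPoly m n K)}
    {P : Ideal (DiffPoly m n K)} (h : IsCharSet Λ P) (hP : P ≠ ⊤) {f q : DiffPoly m n K}
    (hf : f ∈ Λ) {v : DVar m n} (hv : IsLeader f v) (hq0 : q ≠ 0)
    (hq : ∀ w, q.degreeOf w ≤ f.degreeOf w) (hqv : q.degreeOf v < f.degreeOf v) : q ∉ P := by
  intro hqP
  refine hq0 (h.eq_zero_of_reduced hP hqP fun g hg => ?_)
  by_cases hfg : g = f
  · subst hfg
    intro v' hv'
    obtain rfl : v = v' := WithBot.coe_injective (hv.symm.trans hv')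
    refine ⟨fun w hw hwv => ?_, hqv⟩
    have : w ∈ g.vars := by
      rw [← degreeOf_ne_zero_iff_mem_vars] at hw ⊢
      have := hq w
      omega
    exact absurd hwv.lt (not_lt.2 (hv.le this))
  · exact (h.1.1.2 g hg f hf hfg).mono hq

theorem degreeOf_pderiv_le {σ : Type*} (v w : σ) (f : MvPolynomial σ K) :
    (pderiv v f).degreeOf w ≤ f.degreeOf w := by
  refine degreeOf_le_iff.2 fun s hs => ?_
  rw [mem_support_iff, coeff_pderiv] at hs
  have := monomial_le_degreeOf w (mem_support_iff.2 (left_ne_zero_of_mul hs))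
  rw [Finsupp.add_apply] at this
  omega

theorem degreeOf_pderiv_lt {σ : Type*} {v : σ} {f : MvPolynomial σ K} (h : 0 < f.degreeOf v) :
    (pderiv v f).degreeOf v < f.degreeOf v := by
  refine (degreeOf_lt_iff h).2 fun s hs => ?_
  rw [mem_support_iff, coeff_pderiv] at hs
  have := monomial_le_degreeOf v (mem_support_iff.2 (left_ne_zero_of_mul hs))
  rw [Finsupp.add_apply, Finsupp.single_eq_same] at this
  omega

/-- The exponent of `v` in a monomial containing it appears as a factor and is nonzero in
characteristic zero. -/
theorem pderiv_ne_zero {σ : Type*} [CharZero K] {v : σ} {f : MvPolynomial σ K}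
    (h : v ∈ f.vars) : pderiv v f ≠ 0 := by
  obtain ⟨s, hs, hv⟩ := (mem_vars_iff_mem_support v).1 h
  intro h0
  have h1 := coeff_pderiv (i := v) f (s - Finsupp.single v 1)
  have h2 : s - Finsupp.single v 1 + Finsupp.single v 1 = s := by
    refine tsub_add_cancel_of_le (Finsupp.single_le_iff.2 ?_)
    have := Finsupp.mem_support_iff.1 hv
    omega
  rw [h0, coeff_zero, h2] at h1
  exact mul_ne_zero (mem_support_iff.1 hs) (Nat.cast_add_one_ne_zero _) h1.symm

theorem IsCharSet.initial_notMem {Λ : Finset (DiffPoly m n K)} {P : Ideal (DiffPoly m n K)}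
    (h : IsCharSet Λ P) (hP : P ≠ ⊤) {f : DiffPoly m n K} (hf : f ∈ Λ) : initial f ∉ P := by
  obtain ⟨v, hv⟩ := exists_isLeader (h.1.1.1 f hf)
  have h0 : 0 < f.degreeOf v := Nat.pos_of_ne_zero (degreeOf_ne_zero_iff_mem_vars.2 hv.mem_vars)
  rw [hv.initial_eq]
  refine h.notMem_of_degreeOf_lt hP hf hv (leadingCoeffIn_ne_zero h0)
    (fun w => degreeOf_leadingCoeffIn_le v w f) ?_
  rwa [degreeOf_leadingCoeffIn_self]

theorem IsCharSet.separant_notMem [CharZero K] {Λ : Finset (DiffPoly m n K)}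
    {P : Ideal (DiffPoly m n K)} (h : IsCharSet Λ P) (hP : P ≠ ⊤) {f : DiffPoly m n K}
    (hf : f ∈ Λ) : separant f ∉ P := by
  obtain ⟨v, hv⟩ := exists_isLeader (h.1.1.1 f hf)
  have h0 : 0 < f.degreeOf v := Nat.pos_of_ne_zero (degreeOf_ne_zero_iff_mem_vars.2 hv.mem_vars)
  rw [hv.separant_eq]
  exact h.notMem_of_degreeOf_lt hP hf hv (pderiv_ne_zero hv.mem_vars)
    (fun w => degreeOf_pderiv_le v w f) (degreeOf_pderiv_lt h0)

theorem IsCharSet.hProd_notMem [CharZero K] {Λ : Finset (DiffPoly m n K)}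
    {P : Ideal (DiffPoly m n K)} (h : IsCharSet Λ P) (hP : P.IsPrime) : HProd Λ ∉ P := by
  rw [HProd, hP.prod_mem_iff]
  rintro ⟨f, hf, hfP⟩
  rcases hP.mem_or_mem hfP with h' | h'
  · exact h.initial_notMem hP.ne_top hf h'
  · exact h.separant_notMem hP.ne_top hf h'

/-- The ranks of the elements of a characteristic set: `ρ` is one of them if it is the rank of
an element of `P` that is reduced with respect to those of lower rank. -/
def IsCharRank (P : Ideal (DiffPoly m n K)) : WithBot (DVar m n) ×ₗ ℕ → Prop :=
  (wellFounded_lt (α := WithBot (DVar m n) ×ₗ ℕ)).fix fun ρ ih =>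
    ∃ p ∈ P, p.vars.Nonempty ∧ polyRank p = ρ ∧
      ∀ (ρ' : WithBot (DVar m n) ×ₗ ℕ) (h : ρ' < ρ), ih ρ' h →
        ∀ f : DiffPoly m n K, f.vars.Nonempty → polyRank f = ρ' → IsReducedWrt p f

theorem isCharRank_iff (P : Ideal (DiffPoly m n K)) (ρ : WithBot (DVar m n) ×ₗ ℕ) :
    IsCharRank P ρ ↔ ∃ p ∈ P, p.vars.Nonempty ∧ polyRank p = ρ ∧
      ∀ ρ' < ρ, IsCharRank P ρ' →
        ∀ f : DiffPoly m n K, f.vars.Nonempty → polyRank f = ρ' → IsReducedWrt p f := by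
  rw [IsCharRank, WellFounded.fix_eq]

/-- One element of `P` is chosen for each rank accepted by `IsCharRank`. Dickson's lemma makes these
ranks finite in number: among infinitely many, one leader would be a derivative of a lower-ranked
element's leader, or equal to it, against reducedness. A lower autoreduced set would contain an
element whose rank meets the acceptance rule yet is missing, so the choice is minimal. -/
theorem exists_isCharSet (P : Ideal (DiffPoly m n K)) : ∃ Λ, IsCharSet Λ P := by
  classical
  choose! p hpP hpv hpr hp using fun ρ => (isCharRank_iff P ρ).1
  have hfin : {ρ | IsCharRank P ρ}.Finite := by
    by_contra hinf
    have hinf : {ρ | IsCharRank P ρ}.Infinite := hinf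
    choose v hv using fun ρ : {ρ | IsCharRank P ρ} => exists_isLeader (hpv ρ.1 ρ.2)
    -- The rank is compared along with the exponent, so that the pair found is increasing in rank
    -- although the enumeration `e` is in no particular order.
    have hwqo : WellQuasiOrdered fun a b :
        Fin n × ((WithBot (DVar m n) ×ₗ ℕ) × (Fin m → ℕ)) => a.1 = b.1 ∧ a.2 ≤ b.2 :=
      (Finite.wellQuasiOrdered (· = ·)).prod wellQuasiOrdered_le
    let e : ℕ → {ρ | IsCharRank P ρ} := hinf.natEmbedding
    obtain ⟨i, j, hij, hidx, hle⟩ := hwqo fun i => ((v (e i)).idx, ((e i).1, (v (e i)).exp))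
    have hlt : (e i).1 < (e j).1 := lt_of_le_of_ne hle.1 fun h =>
      hij.ne (hinf.natEmbedding.injective (Subtype.ext h))
    have hred := hp _ (e j).2 _ hlt (e i).2 _ (hpv _ (e i).2) (hpr _ (e i).2) _ (hv (e i))
    rcases (show (v (e i)).exp ≤ (v (e j)).exp from hle.2).lt_or_eq with h | h
    · exact hred.1 _ (hv (e j)).mem_vars ⟨hidx.symm, h⟩
    · have hvv : v (e i) = v (e j) := DVar.ext hidx h
      rw [← hpr _ (e i).2, ← hpr _ (e j).2, (hv (e i)).polyRank_eq,
        (hv (e j)).polyRank_eq, hvv, Prod.Lex.toLex_lt_toLex] at hlt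
      rw [hvv] at hred
      rcases hlt with h | h
      · exact lt_irrefl _ h
      · exact lt_asymm h.2 hred.2
  have hauto : IsAutoreduced (hfin.toFinset.image p) := by
    refine ⟨?_, ?_⟩
    · intro f hf
      obtain ⟨ρ, hρ, rfl⟩ := Finset.mem_image.1 hf
      exact hpv ρ (hfin.mem_toFinset.1 hρ)
    · intro f hf g hg hfg
      obtain ⟨ρ, hρ, rfl⟩ := Finset.mem_image.1 hf
      obtain ⟨ρ', hρ', rfl⟩ := Finset.mem_image.1 hg
      have hρ : IsCharRank P ρ := hfin.mem_toFinset.1 hρ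
      have hρ' : IsCharRank P ρ' := hfin.mem_toFinset.1 hρ'
      rcases lt_trichotomy ρ ρ' with h | rfl | h
      · exact hp ρ' hρ' ρ h hρ _ (hpv ρ hρ) (hpr ρ hρ)
      · exact absurd rfl hfg
      · exact .of_polyRank_lt (hpv _ hρ) (hpv _ hρ') (by rwa [hpr _ hρ, hpr _ hρ'])
  refine ⟨hfin.toFinset.image p, ⟨hauto, ?_⟩, ?_⟩
  · intro f hf
    obtain ⟨ρ, hρ, rfl⟩ := Finset.mem_image.1 (Finset.mem_coe.1 hf)
    exact hpP ρ (hfin.mem_toFinset.1 hρ)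
  · intro Λ' hΛ' hΛ'P hlt
    rw [autoreducedLT_iff hΛ' hauto] at hlt
    obtain ⟨g, hg, hne, hiff⟩ := hlt
    have hmem : IsCharRank P (polyRank g) := by
      refine (isCharRank_iff P _).2 ⟨g, hΛ'P hg, hΛ'.1 g hg, rfl, fun ρ' hρ' h f hf hfr => ?_⟩
      obtain ⟨g', hg', hr⟩ := (hiff ρ' hρ').1
        ⟨p ρ', Finset.mem_image.2 ⟨ρ', hfin.mem_toFinset.2 h, rfl⟩, hpr ρ' h⟩
      refine (hΛ'.2 g' hg' g hg ?_).of_polyRank_eq (hΛ'.1 g' hg') (hr.trans hfr.symm) hf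
      rintro rfl
      exact hρ'.ne hr.symm
    exact hne _ (Finset.mem_image.2 ⟨_, hfin.mem_toFinset.2 hmem, rfl⟩) (hpr _ hmem)

end CharSet

/-! ### Reduction modulo a characteristic set and extension of points to all orders -/

section CharSetReduction

variable {m n : ℕ} {K : Type*} [Field K]

theorem orderLE_iff {r : ℕ} {f : DiffPoly m n K} :
    OrderLE r f ↔ f ∈ supported K {v : DVar m n | v.order ≤ r} :=
  ⟨fun h => mem_supported_of_vars h, fun h => vars_of_mem_supported h⟩

theorem exists_orderLE (f : DiffPoly m n K) : ∃ r, OrderLE r f :=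
  ⟨f.vars.sup DVar.order, fun _ hv => Finset.le_sup hv⟩

theorem OrderLE.mono {r s : ℕ} {f : DiffPoly m n K} (h : OrderLE r f) (hrs : r ≤ s) :
    OrderLE s f := fun v hv => (h v hv).trans hrs

theorem aeval_congr_of_mem_supported {σ L : Type*} [CommRing L] [Algebra K L] {s : Set σ}
    {a b : σ → L} (hab : ∀ v ∈ s, a v = b v) {f : MvPolynomial σ K} (hf : f ∈ supported K s) :
    aeval a f = aeval b f := by
  refine Algebra.adjoin_induction (p := fun f _ => aeval a f = aeval b f) ?_ ?_ ?_ ?_ hf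
  · rintro _ ⟨v, hv, rfl⟩
    rw [aeval_X, aeval_X, hab v hv]
  · intro c
    rw [AlgHom.commutes, AlgHom.commutes]
  · intro p q _ _ hp hq
    rw [map_add, map_add, hp, hq]
  · intro p q _ _ hp hq
    rw [map_mul, map_mul, hp, hq]

theorem mem_supported_le_of_lt {θ : DVar m n} {f : DiffPoly m n K}
    (hf : f ∈ supported K {w | w < θ}) : f ∈ supported K {w | w ≤ θ} :=
  mem_supported_of_vars fun w hw => le_of_lt (a := w) (vars_of_mem_supported hf w hw)

theorem orderLE_of_mem_supported_lt {r : ℕ} {θ : DVar m n} (hθ : θ.order ≤ r)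
    {f : DiffPoly m n K} (hf : f ∈ supported K {w | w < θ}) :
    f ∈ supported K {v : DVar m n | v.order ≤ r} :=
  mem_supported_of_vars fun w hw =>
    (DVar.order_le_of_le (le_of_lt (a := w) (vars_of_mem_supported hf w hw))).trans hθ

/-- The initials and separants of the elements of `Λ`. -/
def initialsAndSeparants (Λ : Finset (DiffPoly m n K)) : Set (DiffPoly m n K) :=
  {q | ∃ f ∈ Λ, q = initial f ∨ q = separant f}

/-- Reduction multiplies by products of initials and separants. Each such product divides a power of
`H_Λ`, so nonvanishing of `H_Λ` is all that need be assumed. -/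
theorem exists_dvd_hProd_pow {Λ : Finset (DiffPoly m n K)} {h : DiffPoly m n K}
    (hh : h ∈ Submonoid.closure (initialsAndSeparants Λ)) : ∃ k, h ∣ HProd Λ ^ k := by
  induction hh using Submonoid.closure_induction with
  | mem q hq =>
    obtain ⟨f, hf, h⟩ := hq
    have h1 : initial f * separant f ∣ HProd Λ :=
      Finset.dvd_prod_of_mem (fun f => initial f * separant f) hf
    refine ⟨1, ?_⟩
    rw [pow_one]
    rcases h with rfl | rfl
    · exact (dvd_mul_right _ _).trans h1
    · exact (dvd_mul_left _ _).trans h1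
  | one => exact ⟨0, by simp⟩
  | mul p q _ _ hp hq =>
    obtain ⟨k, hk⟩ := hp
    obtain ⟨l, hl⟩ := hq
    exact ⟨k + l, by rw [pow_add]; exact mul_dvd_mul hk hl⟩

theorem map_ne_zero_of_mem_closure {Λ : Finset (DiffPoly m n K)} {h : DiffPoly m n K}
    (hh : h ∈ Submonoid.closure (initialsAndSeparants Λ)) {L : Type*} [CommRing L] [IsDomain L]
    {φ : DiffPoly m n K →+* L} (hφ : φ (HProd Λ) ≠ 0) : φ h ≠ 0 := by
  obtain ⟨k, c, hc⟩ := exists_dvd_hProd_pow hh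
  intro h0
  apply pow_ne_zero k hφ
  rw [← map_pow, hc, map_mul, h0, zero_mul]

theorem IsAutoreduced.orderLE_hProd {Λ : Finset (DiffPoly m n K)} (h : IsAutoreduced Λ) {r : ℕ}
    (hr : ∀ f ∈ Λ, OrderLE r f) : OrderLE r (HProd Λ) := by
  rw [orderLE_iff]
  refine prod_mem fun f hf => ?_
  obtain ⟨v, hv⟩ := exists_isLeader (h.1 f hf)
  rw [hv.initial_eq, hv.separant_eq]
  exact mul_mem (leadingCoeffIn_mem_supported _ (orderLE_iff.1 (hr f hf)))
    (pderiv_mem_supported _ (orderLE_iff.1 (hr f hf)))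

/-- `θ` is a proper derivative of the leader of an element of `Λ`. -/
def IsPrincipal (Λ : Finset (DiffPoly m n K)) (θ : DVar m n) : Prop :=
  ∃ f ∈ Λ, ∃ v, IsLeader f v ∧ θ.IsProperDerivative v

/-- A principal derivative can arise from several elements of `Λ`. Fixing one for each yields a
triangular system, with a single equation per principal derivative, linear in it with a separant as
coefficient. -/
theorem exists_choice_of_derivatives [DiffRing m K] (Λ : Finset (DiffPoly m n K)) :
    ∃ F T : DVar m n → DiffPoly m n K, ∀ θ, IsPrincipal Λ θ →
      F θ ∈ Λ ∧ (∃ v < θ, IsLeader (F θ) v) ∧ T θ ∈ supported K {w | w < θ} ∧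
      ∃ ξ : Fin m → ℕ, DiffRing.iter ξ (F θ) = separant (F θ) * X θ + T θ := by
  have h : ∀ θ : DVar m n, ∃ F T : DiffPoly m n K, IsPrincipal Λ θ →
      F ∈ Λ ∧ (∃ v < θ, IsLeader F v) ∧ T ∈ supported K {w | w < θ} ∧
      ∃ ξ : Fin m → ℕ, DiffRing.iter ξ F = separant F * X θ + T := by
    intro θ
    by_cases hθ : IsPrincipal Λ θ
    · obtain ⟨f, hf, v, hv, hvθ⟩ := hθ
      obtain ⟨ξ, hξ, rfl⟩ := hvθ.exists_deriv
      obtain ⟨T, hT, he⟩ := hv.exists_iter_eq hξ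
      exact ⟨f, T, fun _ => ⟨hf, ⟨v, hvθ.lt, hv⟩, hT, ξ, he⟩⟩
    · exact ⟨0, 0, fun h => absurd h hθ⟩
  choose F T hFT using h
  exact ⟨F, T, hFT⟩

/-- The divisors are the elements of `Λ`, led by their initials, and the chosen equations of order
at most `r`, led by separants. Degree less than `1` in the principal derivatives means that no
proper derivative of a leader appears. -/
theorem exists_reduction_charSet {Λ : Finset (DiffPoly m n K)} (hΛ : IsAutoreduced Λ)
    {F T : DVar m n → DiffPoly m n K} (hFT : ∀ θ, IsPrincipal Λ θ →
      F θ ∈ Λ ∧ (∃ v < θ, IsLeader (F θ) v) ∧ T θ ∈ supported K {w | w < θ})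
    {r : ℕ} (hr : ∀ f ∈ Λ, OrderLE r f) {p : DiffPoly m n K} (hp : OrderLE r p) :
    ∃ h ∈ Submonoid.closure (initialsAndSeparants Λ), ∃ p' : DiffPoly m n K, OrderLE r p' ∧
      (∀ f ∈ Λ, IsReducedWrt p' f) ∧
      h * p - p' ∈ Ideal.span ((Λ : Set (DiffPoly m n K)) ∪
        {g | ∃ θ, IsPrincipal Λ θ ∧ θ.order ≤ r ∧ g = separant (F θ) * X θ + T θ}) := by
  choose v hv using fun f : {f // f ∈ Λ} => exists_isLeader (hΛ.1 f.1 f.2)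
  have hdeg : ∀ f : {f // f ∈ Λ}, 0 < f.1.degreeOf (v f) := fun f =>
    Nat.pos_of_ne_zero (degreeOf_ne_zero_iff_mem_vars.2 (hv f).mem_vars)
  have hr' : ∀ f ∈ Λ, f ∈ supported K {v : DVar m n | v.order ≤ r} := fun f hf =>
    orderLE_iff.1 (hr f hf)
  have hSlt : ∀ θ, IsPrincipal Λ θ → separant (F θ) ∈ supported K {w | w < θ} := by
    intro θ hθ
    obtain ⟨v, hvθ, hv⟩ := (hFT θ hθ).2.1
    rw [hv.separant_eq]
    refine supported_mono ?_ (pderiv_mem_supported v hv.mem_supported)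
    exact fun w hw => lt_of_le_of_lt hw hvθ
  let ι := {f // f ∈ Λ} ⊕ {θ : DVar m n // IsPrincipal Λ θ ∧ θ.order ≤ r}
  obtain ⟨h, hh, p', hp', hred, hspan⟩ := exists_reduction (ι := ι)
    (Sum.elim (fun f => v f) (fun θ => θ.1))
    (Sum.elim (fun f => f.1.degreeOf (v f)) (fun _ => 1))
    (Sum.elim (fun f => leadingCoeffIn (v f) f.1) (fun θ => separant (F θ.1)))
    (Sum.elim (fun f => f.1 - leadingCoeffIn (v f) f.1 * X (v f) ^ f.1.degreeOf (v f))
      (fun θ => T θ.1)) {v | v.order ≤ r}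
    (by
      rintro (f | θ)
      · exact hdeg f
      · exact one_pos)
    (by
      rintro (f | θ)
      · exact leadingCoeffIn_mem_supported_lt (hv f).mem_supported
      · exact hSlt θ.1 θ.2.1)
    (by
      rintro (f | θ)
      · exact mem_supported_of_degreeOf_le (hv f).mem_supported
          fun w => degreeOf_sub_leadingCoeffIn_le (v f) w f.1
      · exact mem_supported_le_of_lt (hFT θ.1 θ.2.1).2.2)
    (by
      rintro (f | θ)
      · exact degreeOf_sub_leadingCoeffIn_lt (hdeg f)
      · refine Nat.lt_one_iff.2 (degreeOf_eq_zero_of_mem_supported (hFT θ.1 θ.2.1).2.2 ?_)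
        exact lt_irrefl θ.1)
    (by
      rintro (f | θ)
      · exact leadingCoeffIn_mem_supported _ (hr' f.1 f.2)
      · exact orderLE_of_mem_supported_lt θ.2.2
          (hSlt θ.1 θ.2.1))
    (by
      rintro (f | θ)
      · exact mem_supported_of_degreeOf_le (hr' f.1 f.2)
          fun w => degreeOf_sub_leadingCoeffIn_le (v f) w f.1
      · exact orderLE_of_mem_supported_lt θ.2.2
          (hFT θ.1 θ.2.1).2.2)
    p (orderLE_iff.1 hp)
  refine ⟨h, Submonoid.closure_mono ?_ hh, p', orderLE_iff.2 hp', fun f hf v' hv' => ?_,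
    Ideal.span_mono ?_ hspan⟩
  · rintro _ ⟨f | θ, rfl⟩
    · exact ⟨f.1, f.2, Or.inl (hv f).initial_eq.symm⟩
    · exact ⟨F θ.1, (hFT θ.1 θ.2.1).1, Or.inr rfl⟩
  · obtain rfl : v ⟨f, hf⟩ = v' := WithBot.coe_injective ((hv ⟨f, hf⟩).symm.trans hv')
    refine ⟨fun w hw hwv => ?_, hred (Sum.inl ⟨f, hf⟩)⟩
    have := hred (Sum.inr ⟨w, ⟨f, hf, _, hv ⟨f, hf⟩, hwv⟩, vars_of_mem_supported hp' w hw⟩)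
    exact degreeOf_ne_zero_iff_mem_vars.2 hw (Nat.lt_one_iff.1 this)
  · rintro _ ⟨f | θ, rfl⟩
    · refine Or.inl ?_
      simp only [Sum.elim_inl, add_sub_cancel]
      exact f.2
    · refine Or.inr ⟨θ.1, θ.2.1, θ.2.2, ?_⟩
      simp only [Sum.elim_inr, pow_one]

section

variable [DiffRing m K] {Λ : Finset (DiffPoly m n K)} {P : Ideal (DiffPoly m n K)}

/-- An element of order at most `r` of the ideal vanishes where the derivatives of order at
most `r` of a characteristic set vanish, but not the initials and separants. -/
theorem IsCharSet.map_eq_zero (h : IsCharSet Λ P) (hP : P.IsPrime)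
    (hδ : DiffRing.IsDiffIdeal m P) {r : ℕ} (hr : ∀ f ∈ Λ, OrderLE r f) {L : Type*}
    [CommRing L] [IsDomain L] {φ : DiffPoly m n K →+* L}
    (hφ : ∀ f ∈ derivsUpTo r (Λ : Set (DiffPoly m n K)), φ f = 0) (hφH : φ (HProd Λ) ≠ 0)
    {p : DiffPoly m n K} (hp : p ∈ P) (hpr : OrderLE r p) : φ p = 0 := by
  obtain ⟨F, T, hFT⟩ := exists_choice_of_derivatives Λ
  obtain ⟨q, hq, p', hp'r, hp', hspan⟩ := exists_reduction_charSet h.1.1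
    (fun θ hθ => ⟨(hFT θ hθ).1, (hFT θ hθ).2.1, (hFT θ hθ).2.2.1⟩) hr hpr
  have hsub : ((Λ : Set (DiffPoly m n K)) ∪
      {g | ∃ θ, IsPrincipal Λ θ ∧ θ.order ≤ r ∧ g = separant (F θ) * X θ + T θ}) ⊆
      derivsUpTo r (Λ : Set (DiffPoly m n K)) := by
    rintro g (hg | ⟨θ, hθ, hθr, rfl⟩)
    · exact ⟨hr g hg, g, hg, 0, (DiffRing.iter_zero g).symm⟩
    · obtain ⟨hF, ⟨v, hvθ, hv⟩, hT, ξ, hξ⟩ := hFT θ hθ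
      refine ⟨orderLE_iff.2 (add_mem (mul_mem ?_ (X_mem_supported.2 hθr)) ?_), F θ, hF, ξ, hξ.symm⟩
      · rw [hv.separant_eq]
        exact pderiv_mem_supported v (orderLE_iff.1 (hr _ hF))
      · exact orderLE_of_mem_supported_lt hθr hT
  have hsubP : derivsUpTo r (Λ : Set (DiffPoly m n K)) ⊆ P := by
    rintro _ ⟨-, f, hf, ξ, rfl⟩
    exact hδ.iter_mem (h.1.2 hf) ξ
  -- The remainder is a reduced element of `P`, so nothing is left of it.
  have hp'0 : p' = 0 := by
    refine h.eq_zero_of_reduced hP.ne_top ?_ hp'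
    have := P.sub_mem (P.mul_mem_left q hp) (Ideal.span_le.2 (hsub.trans hsubP) hspan)
    rwa [sub_sub_cancel] at this
  rw [hp'0, sub_zero] at hspan
  have h0 : q * p ∈ RingHom.ker φ := by
    refine Ideal.span_le.2 ?_ hspan
    exact fun g hg => hφ g (hsub hg)
  rw [RingHom.mem_ker, map_mul] at h0
  exact (mul_eq_zero.1 h0).resolve_left (map_ne_zero_of_mem_closure hq hφH)

/-- Points of the truncation at an order `r` that is at least the orders of a characteristic set
extend to points of the whole ideal. -/
theorem IsCharSet.exists_point [CharZero K] (h : IsCharSet Λ P) (hP : P.IsPrime)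
    (hδ : DiffRing.IsDiffIdeal m P) {r : ℕ} (hr : ∀ f ∈ Λ, OrderLE r f)
    (hdense : ∀ c : DiffPoly m n K, c ∉ P → OrderLE r c → ∃ φ : DVar m n → K,
      (∀ p ∈ P, OrderLE r p → aeval φ p = 0) ∧ aeval φ c ≠ 0)
    {g : DiffPoly m n K} (hg : g ∉ P) :
    ∃ φ : DVar m n → K, (∀ p ∈ P, aeval φ p = 0) ∧ aeval φ g ≠ 0 := by
  classical
  obtain ⟨F, T, hFT⟩ := exists_choice_of_derivatives Λ
  have hred : ∀ p : DiffPoly m n K, ∃ q ∈ Submonoid.closure (initialsAndSeparants Λ),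
      ∃ p' : DiffPoly m n K, (∀ f ∈ Λ, IsReducedWrt p' f) ∧
      q * p - p' ∈ Ideal.span ((Λ : Set (DiffPoly m n K)) ∪
        {g | ∃ θ, IsPrincipal Λ θ ∧ g = separant (F θ) * X θ + T θ}) := by
    intro p
    obtain ⟨s, hs⟩ := exists_orderLE p
    obtain ⟨q, hq, p', -, hp', hspan⟩ := exists_reduction_charSet h.1.1
      (fun θ hθ => ⟨(hFT θ hθ).1, (hFT θ hθ).2.1, (hFT θ hθ).2.2.1⟩)
      (r := max r s) (fun f hf => (hr f hf).mono (le_max_left _ _)) (hs.mono (le_max_right _ _))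
    refine ⟨q, hq, p', hp', Ideal.span_mono (Set.union_subset_union_right _ ?_) hspan⟩
    rintro _ ⟨θ, hθ, -, rfl⟩
    exact ⟨θ, hθ, rfl⟩
  have hspanP : Ideal.span ((Λ : Set (DiffPoly m n K)) ∪
      {g | ∃ θ, IsPrincipal Λ θ ∧ g = separant (F θ) * X θ + T θ}) ≤ P := by
    refine Ideal.span_le.2 ?_
    rintro g (hg | ⟨θ, hθ, rfl⟩)
    · exact h.1.2 hg
    · obtain ⟨hF, -, -, ξ, hξ⟩ := hFT θ hθ
      rw [← hξ]
      exact hδ.iter_mem (h.1.2 hF) ξ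
  have hH := h.hProd_notMem hP
  obtain ⟨q, hq, g', hg'red, hg'⟩ := hred g
  have hqP : q ∉ P := by
    obtain ⟨k, c, hc⟩ := exists_dvd_hProd_pow hq
    intro hqP
    exact hH (hP.mem_of_pow_mem k (hc ▸ P.mul_mem_right c hqP))
  have hg'0 : g' ≠ 0 := by
    rintro rfl
    rw [sub_zero] at hg'
    exact (hP.mem_or_mem (hspanP hg')).elim hqP hg
  -- `K` is infinite, so the reduced form of `g` takes a nonzero value somewhere. Above order `r`,
  -- the coordinates of `η` serve as the values of the free indeterminates.
  obtain ⟨η, hη⟩ : ∃ η : DVar m n → K, aeval η g' ≠ 0 := by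
    by_contra! h0
    refine hg'0 (MvPolynomial.funext fun x => ?_)
    rw [map_zero, ← aeval_eq_eval]
    exact h0 x
  let sub : DVar m n → DiffPoly m n K := fun v => if v.order ≤ r then X v else C (η v)
  have hsub : ∀ (φ : DVar m n → K) (f : DiffPoly m n K), aeval φ (aeval sub f) =
      aeval (fun v => if v.order ≤ r then φ v else η v) f := by
    intro φ f
    rw [← AlgHom.comp_apply, comp_aeval]
    congr 2
    funext v
    simp only [sub]
    split_ifs
    · rw [aeval_X]
    · rw [aeval_C]; rfl
  have hsub0 : aeval sub g' ≠ 0 := by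
    intro h0
    have := hsub η g'
    simp only [h0, map_zero, ite_self] at this
    exact hη this.symm
  have hsubdeg : ∀ w : DVar m n, (aeval sub g').degreeOf w ≤ g'.degreeOf w := by
    intro w
    have hdw : ∀ v, (sub v).degreeOf w ≤ if v = w then 1 else 0 := by
      intro v
      simp only [sub]
      by_cases hvr : v.order ≤ r
      · rw [if_pos hvr, degreeOf_X]
        simp only [eq_comm, le_refl]
      · rw [if_neg hvr, degreeOf_C]
        exact Nat.zero_le _
    rw [aeval_def, eval₂_eq]
    refine (degreeOf_sum_le _ _ _).trans (Finset.sup_le fun d hd => ?_)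
    refine (degreeOf_C_mul_le _ _ _).trans ((degreeOf_prod_le _ _ _).trans ?_)
    refine le_trans (Finset.sum_le_sum fun v _ => (degreeOf_pow_le _ _ _).trans
      (Nat.mul_le_mul_left (d v) (hdw v))) ?_
    simp only [mul_ite, mul_one, mul_zero, Finset.sum_ite_eq', Finsupp.mem_support_iff]
    split_ifs
    · exact monomial_le_degreeOf w hd
    · exact Nat.zero_le _
  have hsubr : OrderLE r (aeval sub g') := by
    rw [orderLE_iff, aeval_def, eval₂_eq]
    refine sum_mem fun d _ => mul_mem (Subalgebra.algebraMap_mem _ _)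
      (prod_mem fun v _ => pow_mem ?_ _)
    simp only [sub]
    split_ifs with hvr
    · exact X_mem_supported.2 hvr
    · exact Subalgebra.algebraMap_mem _ _
  -- Fixing the indeterminates above order `r` raises no degree, so the result is still reduced;
  -- being nonzero, it lies outside `P`, and density at order `r` applies to it.
  have hsubP : aeval sub g' ∉ P := fun hmem => hsub0 (h.eq_zero_of_reduced hP.ne_top hmem
    fun f hf => (hg'red f hf).mono hsubdeg)
  have hHr : OrderLE r (HProd Λ) := h.1.1.orderLE_hProd hr
  obtain ⟨φ₀, hφ₀, hφ₀c⟩ := hdense (aeval sub g' * HProd Λ)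
    (fun hmem => (hP.mem_or_mem hmem).elim hsubP hH)
    (orderLE_iff.2 (mul_mem (orderLE_iff.1 hsubr) (orderLE_iff.1 hHr)))
  rw [map_mul, mul_ne_zero_iff] at hφ₀c
  -- Up to order `r` the given point is kept. Above it, a principal derivative is solved for from
  -- its linear equation in terms of lower values, and every other indeterminate takes its value
  -- from `η`.
  let φ : DVar m n → K := (wellFounded_lt (α := DVar m n)).fix fun θ ih =>
    if θ.order ≤ r then φ₀ θ else if IsPrincipal Λ θ then
      - aeval (fun w => if hw : w < θ then ih w hw else 0) (T θ) / aeval φ₀ (separant (F θ))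
    else η θ
  have hφ : ∀ θ, φ θ = if θ.order ≤ r then φ₀ θ else if IsPrincipal Λ θ then
      - aeval (fun w => if w < θ then φ w else 0) (T θ) / aeval φ₀ (separant (F θ))
    else η θ := by
    intro θ
    simp only [φ]
    rw [WellFounded.fix_eq]
    rfl
  have hφr : ∀ f : DiffPoly m n K, OrderLE r f → aeval φ f = aeval φ₀ f := by
    intro f hf
    refine aeval_congr_of_mem_supported (fun v hv => ?_) (orderLE_iff.1 hf)
    rw [hφ v, if_pos (show v.order ≤ r from hv)]
  have hφP : ∀ f ∈ Ideal.span ((Λ : Set (DiffPoly m n K)) ∪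
      {g | ∃ θ, IsPrincipal Λ θ ∧ g = separant (F θ) * X θ + T θ}), aeval φ f = 0 := by
    intro f hf
    suffices hle : Ideal.span ((Λ : Set (DiffPoly m n K)) ∪
      {g | ∃ θ, IsPrincipal Λ θ ∧ g = separant (F θ) * X θ + T θ}) ≤
        RingHom.ker (aeval φ : DiffPoly m n K →ₐ[K] K) from hle hf
    refine Ideal.span_le.2 ?_
    rintro g (hg | ⟨θ, hθ, rfl⟩)
    · change aeval φ g = 0
      rw [hφr g (hr g hg)]
      exact hφ₀ g (h.1.2 hg) (hr g hg)
    · obtain ⟨hF, ⟨v, hvθ, hv⟩, hT, ξ, hξ⟩ := hFT θ hθ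
      have hS : OrderLE r (separant (F θ)) := by
        rw [orderLE_iff, hv.separant_eq]
        exact pderiv_mem_supported v (orderLE_iff.1 (hr _ hF))
      change aeval φ (separant (F θ) * X θ + T θ) = 0
      by_cases hθr : θ.order ≤ r
      · have hor : OrderLE r (separant (F θ) * X θ + T θ) := by
          refine orderLE_iff.2 (add_mem (mul_mem (orderLE_iff.1 hS) (X_mem_supported.2 hθr)) ?_)
          exact orderLE_of_mem_supported_lt hθr hT
        rw [hφr _ hor]
        exact hφ₀ _ (hspanP (Ideal.subset_span (Or.inr ⟨θ, hθ, rfl⟩))) hor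
      · have hS0 : aeval φ₀ (separant (F θ)) ≠ 0 := by
          have : separant (F θ) ∈ Submonoid.closure (initialsAndSeparants Λ) :=
            Submonoid.subset_closure ⟨_, hF, Or.inr rfl⟩
          exact map_ne_zero_of_mem_closure this (φ := (aeval φ₀ : DiffPoly m n K →ₐ[K] K).toRingHom)
            hφ₀c.2
        have hT' : aeval (fun w => if w < θ then φ w else 0) (T θ) = aeval φ (T θ) :=
          aeval_congr_of_mem_supported (fun w hw => if_pos hw) hT
        rw [map_add, map_mul, aeval_X, hφ θ, if_neg hθr, if_pos hθ, hT', hφr _ hS,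
          mul_div_cancel₀ _ hS0, neg_add_cancel]
  have hφH : aeval φ (HProd Λ) ≠ 0 := by
    rw [hφr _ hHr]
    exact hφ₀c.2
  have hne : ∀ q ∈ Submonoid.closure (initialsAndSeparants Λ), aeval φ q ≠ 0 := fun q hq =>
    map_ne_zero_of_mem_closure hq (φ := (aeval φ : DiffPoly m n K →ₐ[K] K).toRingHom) hφH
  refine ⟨φ, fun p hp => ?_, fun h0 => ?_⟩
  · obtain ⟨q, hq, p', hp', hspan⟩ := hred p
    have hp'0 : p' = 0 := by
      refine h.eq_zero_of_reduced hP.ne_top ?_ hp'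
      have := P.sub_mem (P.mul_mem_left q hp) (hspanP hspan)
      rwa [sub_sub_cancel] at this
    have := hφP _ hspan
    rw [hp'0, sub_zero, map_mul] at this
    exact (mul_eq_zero.1 this).resolve_left (hne q hq)
  · have h1 := hφP _ hg'
    rw [map_sub, map_mul, h0, mul_zero, zero_sub, neg_eq_zero] at h1
    -- The reduced `g'` contains no principal derivative, and elsewhere `φ` agrees with the
    -- substitution by `φ₀` and `η`; hence its value is the nonzero one arranged above.
    refine hφ₀c.1 ((hsub φ₀ g').trans (Eq.trans ?_ h1))
    refine aeval_congr_of_mem_supported (s := {v | ¬ IsPrincipal Λ v}) (fun v hv => ?_)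
      (mem_supported_of_vars fun v hv => ?_)
    · rw [hφ v, if_neg (show ¬ IsPrincipal Λ v from hv)]
    · rintro ⟨f, hf, w, hw, hvw⟩
      exact (hg'red f hf w hw).1 v hv hvw

end

end CharSetReduction

/-! ### Smooth points, large fields and specialisation -/

section Smooth

/-- An isomorphism is a localisation away from `1`, and the smooth locus is compatible with
localisation. -/
theorem mem_smoothLocus_algEquiv {R A B : Type*} [CommRing R] [CommRing A] [CommRing B]
    [Algebra R A] [Algebra R B] (e : A ≃ₐ[R] B) (p : PrimeSpectrum B) :
    PrimeSpectrum.comap (e : A →+* B) p ∈ Algebra.smoothLocus R A ↔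
      p ∈ Algebra.smoothLocus R B := by
  algebraize [(e : A →+* B)]
  have : IsScalarTower R A B := .of_algebraMap_eq fun r => (e.commutes r).symm
  have : IsLocalization.Away (1 : A) B :=
    IsLocalization.away_of_isUnit_of_bijective B isUnit_one e.bijective
  rw [← Algebra.smoothLocus_comap_of_isLocalization (R := R) (Af := B) (1 : A)]
  rfl

theorem IsSmoothPoint.rename {σ τ K : Type*} [Field K] (e : σ ≃ τ)
    {I : Ideal (MvPolynomial σ K)} {a : σ → K} (ha : IsSmoothPoint I a) :
    IsSmoothPoint (I.comap (renameEquiv K e.symm)) (a ∘ e.symm) := by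
  obtain ⟨h, hs⟩ := ha
  have haev : ∀ p : MvPolynomial τ K,
      aeval a (renameEquiv K e.symm p) = aeval (a ∘ e.symm) p := by
    intro p
    rw [renameEquiv_apply, aeval_rename]
  have h' : ∀ f ∈ I.comap (renameEquiv K e.symm),
      (aeval (a ∘ e.symm) : MvPolynomial τ K →ₐ[K] K) f = 0 := by
    intro f hf
    rw [← haev]
    exact h _ hf
  refine ⟨h', ?_⟩
  have hI : I = (I.comap (renameEquiv K e.symm)).map
      (renameEquiv K e.symm : MvPolynomial τ K →+* MvPolynomial σ K) :=
    (Ideal.map_comap_of_surjective (renameEquiv K e.symm : MvPolynomial τ K →+* MvPolynomial σ K)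
      (renameEquiv K e.symm).surjective I).symm
  rw [← mem_smoothLocus_algEquiv
    (Ideal.quotientEquivAlg (I.comap (renameEquiv K e.symm)) I (renameEquiv K e.symm) hI)] at hs
  refine (congrArg (· ∈ Algebra.smoothLocus K _) (PrimeSpectrum.ext (Ideal.ext fun x => ?_))).mp hs
  obtain ⟨p, rfl⟩ := Ideal.Quotient.mk_surjective x
  exact iff_of_eq (congrArg (· = 0) (haev p))

theorem IsLargeField.dense_points {K σ : Type*} [Field K] [Finite σ] (hK : IsLargeField K)
    {P : Ideal (MvPolynomial σ K)} (hP : P.IsPrime) {a : σ → K} (ha : IsSmoothPoint P a)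
    {g : MvPolynomial σ K} (hg : g ∉ P) :
    ∃ b : σ → K, (∀ f ∈ P, aeval b f = 0) ∧ aeval b g ≠ 0 := by
  obtain ⟨n, ⟨e⟩⟩ := Finite.exists_equiv_fin σ
  have hmem : ∀ f, renameEquiv K e f ∈ P.comap (renameEquiv K e.symm) ↔ f ∈ P := by
    intro f
    rw [Ideal.mem_comap]
    simp
  obtain ⟨b, hb, hbg⟩ := hK n (P.comap (renameEquiv K e.symm)) (Ideal.comap_isPrime _ _)
    ⟨_, ha.rename e⟩ (renameEquiv K e g) (fun h => hg ((hmem g).1 h))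
  refine ⟨b ∘ e, fun f hf => ?_, ?_⟩
  · rw [← aeval_rename]
    exact hb _ ((hmem f).2 hf)
  · rw [← aeval_rename]
    exact hbg

/-- The function field is formally smooth over the perfect field `K`, so the generic point lies in
the smooth locus; this locus is open and contains a basic open set `q ≠ 0`. The generic point `α`
satisfies `q h ≠ 0`, and existential closedness moves this condition to a `K`-point. -/
theorem FieldEC.exists_isSmoothPoint {K L σ : Type*} [Field K] [CharZero K] [Field L] [Algebra K L]
    [Finite σ] (hL : FieldEC K L) {P : Ideal (MvPolynomial σ K)} {α : σ → L}
    (hP : ∀ f, f ∈ P ↔ aeval α f = 0) {h : MvPolynomial σ K} (hh : h ∉ P) :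
    ∃ c : σ → K, IsSmoothPoint P c ∧ aeval c h ≠ 0 := by
  have hprime : P.IsPrime := by
    have : P = RingHom.ker (aeval α : MvPolynomial σ K →ₐ[K] L) := Ideal.ext hP
    rw [this]
    exact RingHom.ker_isPrime _
  have : Algebra.FinitePresentation K (MvPolynomial σ K ⧸ P) :=
    Algebra.FinitePresentation.of_finiteType.1 inferInstance
  have hbot : (⊥ : PrimeSpectrum (MvPolynomial σ K ⧸ P)) ∈
      Algebra.smoothLocus K (MvPolynomial σ K ⧸ P) := by
    let F := FractionRing (MvPolynomial σ K ⧸ P)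
    have : Algebra.EssFiniteType (MvPolynomial σ K ⧸ P) F :=
      .of_isLocalization _ (nonZeroDivisors (MvPolynomial σ K ⧸ P))
    have : Algebra.EssFiniteType K F := .comp _ (MvPolynomial σ K ⧸ P) _
    have : Algebra.FormallySmooth K F := .of_perfectField
    have : IsFractionRing (MvPolynomial σ K ⧸ P)
        (Localization.AtPrime (⊥ : Ideal (MvPolynomial σ K ⧸ P))) := by
      simpa [Ideal.primeCompl_bot] using
        Localization.isLocalization (M := (⊥ : Ideal (MvPolynomial σ K ⧸ P)).primeCompl)
    exact .of_equiv ((IsLocalization.algEquiv (nonZeroDivisors (MvPolynomial σ K ⧸ P)) F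
      (Localization.AtPrime (⊥ : Ideal (MvPolynomial σ K ⧸ P)))).restrictScalars K)
  obtain ⟨_, ⟨_, ⟨q, rfl⟩, rfl⟩, hq, hsub⟩ :=
    PrimeSpectrum.isBasis_basic_opens.exists_subset_of_mem_open hbot Algebra.isOpen_smoothLocus
  obtain ⟨q, rfl⟩ := Ideal.Quotient.mk_surjective q
  have hqP : q ∉ P := by
    intro hqP
    rw [Ideal.Quotient.eq_zero_iff_mem.2 hqP] at hq
    simp at hq
  have hα : aeval α (q * h) ≠ 0 := by
    rw [Ne, ← hP]
    exact fun hm => (hprime.mem_or_mem hm).elim hqP hh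
  obtain ⟨n, ⟨e⟩⟩ := Finite.exists_equiv_fin σ
  let ι : σ → Fin (n + 1) := fun i => (e i).castSucc
  -- The last coordinate is an inverse of `q h`, which makes the inequation an equation.
  obtain ⟨c, hc⟩ := hL (n + 1)
    ({f | ∃ p ∈ P, f = MvPolynomial.rename ι p} ∪
      {X (Fin.last n) * MvPolynomial.rename ι (q * h) - 1})
    ⟨Fin.snoc (α := fun _ => L) (α ∘ e.symm) (aeval α (q * h))⁻¹, by
      have hι : (Fin.snoc (α := fun _ => L) (α ∘ e.symm) (aeval α (q * h))⁻¹ :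
          Fin (n + 1) → L) ∘ ι = α := by
        funext i
        simp [ι]
      rintro f (⟨p, hp, rfl⟩ | rfl)
      · rw [aeval_rename, hι]
        exact (hP p).1 hp
      · rw [map_sub, map_mul, aeval_rename, hι, aeval_X, Fin.snoc_last, map_one,
          inv_mul_cancel₀ hα, sub_self]⟩
  have hc0 : ∀ f ∈ P, aeval (c ∘ ι) f = 0 := by
    intro f hf
    rw [← aeval_rename]
    exact hc _ (Or.inl ⟨f, hf, rfl⟩)
  have hc1 : aeval (c ∘ ι) (q * h) ≠ 0 := by
    intro h0
    have := hc _ (Or.inr rfl)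
    rw [map_sub, map_mul, aeval_rename, h0, mul_zero, map_one, zero_sub, neg_eq_zero] at this
    exact one_ne_zero this
  rw [map_mul, mul_ne_zero_iff] at hc1
  refine ⟨c ∘ ι, ⟨hc0, hsub ?_⟩, hc1.2⟩
  exact hc1.1

/-- A point over the field generated by `α` can be specialised to a point over `K` if the locus
of `α` has a dense set of points over `K`. -/
theorem exists_specialization {K L τ : Type*} [Field K] [Field L] [Algebra K L] {α : τ → L}
    (hα : ∀ g : MvPolynomial τ K, aeval α g ≠ 0 → ∃ φ : τ → K,
      (∀ p : MvPolynomial τ K, aeval α p = 0 → aeval φ p = 0) ∧ aeval φ g ≠ 0)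
    {n : ℕ} {b : Fin n → L} {r s : Fin n → MvPolynomial τ K} (hs : ∀ i, aeval α (s i) ≠ 0)
    (hb : ∀ i, b i = aeval α (r i) / aeval α (s i)) :
    ∃ c : Fin n → K, ∀ f : MvPolynomial (Fin n) K, aeval b f = 0 → aeval c f = 0 := by
  obtain ⟨φ, hφ, hφs⟩ := hα (∏ i, s i) (by
    rw [map_prod]
    exact Finset.prod_ne_zero_iff.2 fun i _ => hs i)
  rw [map_prod, Finset.prod_ne_zero_iff] at hφs
  -- Clearing denominators formally gives one pair `G`, `S` that represents the value of `f` both at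
  -- `α` and at its specialisation `φ`.
  have key : ∀ f : MvPolynomial (Fin n) K, ∃ G S : MvPolynomial τ K,
      aeval α S ≠ 0 ∧ aeval φ S ≠ 0 ∧ aeval α S * aeval b f = aeval α G ∧
      aeval φ S * aeval (fun i => aeval φ (r i) / aeval φ (s i)) f = aeval φ G := by
    intro f
    induction f using MvPolynomial.induction_on with
    | C a => exact ⟨C a, 1, by simp, by simp, by simp, by simp⟩
    | add p q hp hq =>
      obtain ⟨G, S, h1, h2, h3, h4⟩ := hp
      obtain ⟨G', S', h1', h2', h3', h4'⟩ := hq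
      refine ⟨G * S' + G' * S, S * S', ?_, ?_, ?_, ?_⟩
      · rw [map_mul]; exact mul_ne_zero h1 h1'
      · rw [map_mul]; exact mul_ne_zero h2 h2'
      · simp only [map_mul, map_add, ← h3, ← h3']; ring
      · simp only [map_mul, map_add, ← h4, ← h4']; ring
    | mul_X p i hp =>
      obtain ⟨G, S, h1, h2, h3, h4⟩ := hp
      have hφi := hφs i (Finset.mem_univ i)
      refine ⟨G * r i, S * s i, ?_, ?_, ?_, ?_⟩
      · rw [map_mul]; exact mul_ne_zero h1 (hs i)
      · rw [map_mul]; exact mul_ne_zero h2 hφi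
      · rw [map_mul, map_mul, map_mul, ← h3, aeval_X, hb]
        field_simp [hs i]
      · rw [map_mul, map_mul, map_mul, ← h4, aeval_X]
        field_simp
  refine ⟨fun i => aeval φ (r i) / aeval φ (s i), fun f hf => ?_⟩
  obtain ⟨G, S, h1, h2, h3, h4⟩ := key f
  rw [hf, mul_zero] at h3
  rw [hφ G h3.symm] at h4
  exact (mul_eq_zero.1 h4).resolve_left h2

end Smooth

/-! ### Truncations of a differential ideal -/

section JetIdeal

variable {m n : ℕ} {K : Type*} [Field K]

instance (r : ℕ) : Finite (JetVar m n r) := by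
  have hle : ∀ (v : JetVar m n r) (k : Fin m), v.1.exp k < r + 1 := fun v k =>
    Nat.lt_succ_of_le ((Finset.single_le_sum (f := v.1.exp) (fun _ _ => Nat.zero_le _)
      (Finset.mem_univ k)).trans v.2)
  let e : JetVar m n r → Fin n × (Fin m → Fin (r + 1)) := fun v =>
    (v.1.idx, fun k => ⟨v.1.exp k, hle v k⟩)
  refine Finite.of_injective e fun v w h => Subtype.ext (DVar.ext (congrArg Prod.fst h) ?_)
  funext k
  exact congrArg Fin.val (congrFun (congrArg Prod.snd h) k)

/-- The ideal of the elements of order at most `r`, in the polynomial ring in the indeterminates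
of order at most `r`. -/
noncomputable def jetIdeal (P : Ideal (DiffPoly m n K)) (r : ℕ) :
    Ideal (MvPolynomial (JetVar m n r) K) :=
  P.comap (rename Subtype.val : MvPolynomial (JetVar m n r) K →ₐ[K] DiffPoly m n K)

theorem mem_jetIdeal {P : Ideal (DiffPoly m n K)} {r : ℕ} {p : MvPolynomial (JetVar m n r) K} :
    p ∈ jetIdeal P r ↔ rename Subtype.val p ∈ P := Iff.rfl

theorem orderLE_rename (r : ℕ) (p : MvPolynomial (JetVar m n r) K) :
    OrderLE r (rename Subtype.val p : DiffPoly m n K) := by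
  classical
  intro v hv
  obtain ⟨w, -, rfl⟩ := Finset.mem_image.1 (vars_rename _ p hv)
  exact w.2

theorem OrderLE.exists_rename_eq {r : ℕ} {f : DiffPoly m n K} (h : OrderLE r f) :
    ∃ p : MvPolynomial (JetVar m n r) K, rename Subtype.val p = f :=
  (exists_rename_eq_of_vars_subset_range f (Subtype.val : JetVar m n r → DVar m n)
    Subtype.val_injective fun v hv => ⟨⟨v, h v hv⟩, rfl⟩)

theorem aeval_nabla {L : Type*} [Field L] [DiffRing m L] [Algebra K L] (r : ℕ)
    (a : Fin n → L) (p : MvPolynomial (JetVar m n r) K) :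
    aeval (nabla m r a) p = DiffPoly.val (rename Subtype.val p : DiffPoly m n K) a := by
  rw [DiffPoly.val, aeval_rename]
  rfl

/-- The points over `K` of order `r` are dense in the zero set of `P`. -/
def DenseAtOrder (P : Ideal (DiffPoly m n K)) (r : ℕ) : Prop :=
  ∀ c : DiffPoly m n K, c ∉ P → OrderLE r c → ∃ φ : DVar m n → K,
    (∀ p ∈ P, OrderLE r p → aeval φ p = 0) ∧ aeval φ c ≠ 0

theorem DenseAtOrder.mono {P : Ideal (DiffPoly m n K)} {r s : ℕ} (h : DenseAtOrder P s)
    (hrs : r ≤ s) : DenseAtOrder P r := by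
  intro c hc hcr
  obtain ⟨φ, h1, h2⟩ := h c hc (hcr.mono hrs)
  exact ⟨φ, fun p hp hpr => h1 p hp (hpr.mono hrs), h2⟩

theorem IsLargeField.denseAtOrder (hK : IsLargeField K) {P : Ideal (DiffPoly m n K)}
    (hP : P.IsPrime) {r : ℕ} {a : JetVar m n r → K} (ha : IsSmoothPoint (jetIdeal P r) a) :
    DenseAtOrder P r := by
  intro c hc hcr
  obtain ⟨c, rfl⟩ := hcr.exists_rename_eq
  obtain ⟨b, hb, hbc⟩ := hK.dense_points (P := jetIdeal P r) (Ideal.comap_isPrime _ _) ha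
    (g := c) hc
  -- The value `0` above order `r` is immaterial: only polynomials of order at most `r` are
  -- evaluated.
  let φ : DVar m n → K := fun v => if h : v.order ≤ r then b ⟨v, h⟩ else 0
  have hφ : φ ∘ Subtype.val = b := by
    funext v
    exact dif_pos v.2
  refine ⟨φ, fun p hp hpr => ?_, ?_⟩
  · obtain ⟨p, rfl⟩ := hpr.exists_rename_eq
    rw [aeval_rename, hφ]
    exact hb p hp
  · rw [aeval_rename, hφ]
    exact hbc

end JetIdeal

/-! ### The differential field generated by a generic point -/

section GenericExtension

theorem δ_inv {m : ℕ} {U : Type*} [Field U] [DiffRing m U] (k : Fin m) (x : U) :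
    DiffRing.δ k x⁻¹ = - (x⁻¹ * x⁻¹ * DiffRing.δ k x) := by
  by_cases hx : x = 0
  · simp [hx, DiffRing.δ_zero]
  · have h := DiffRing.δ_mul k x x⁻¹
    rw [mul_inv_cancel₀ hx, DiffRing.δ_one] at h
    have h2 : x⁻¹ * (x * DiffRing.δ k x⁻¹ + x⁻¹ * DiffRing.δ k x) = 0 := by rw [← h, mul_zero]
    rw [mul_add, inv_mul_cancel_left₀ hx] at h2
    rw [eq_neg_iff_add_eq_zero, mul_assoc]
    exact h2

theorem δ_mem_adjoin {m n : ℕ} {K U : Type*} [Field K] [DiffRing m K] [Field U] [DiffRing m U]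
    [Algebra K U] [DiffExt m K U] (a : Fin n → U) (k : Fin m) {x : U}
    (hx : x ∈ IntermediateField.adjoin K (Set.range (nablaAll m a))) :
    DiffRing.δ k x ∈ IntermediateField.adjoin K (Set.range (nablaAll m a)) := by
  induction hx using IntermediateField.adjoin_induction with
  | mem x hx =>
    obtain ⟨v, rfl⟩ := hx
    rw [← nablaAll_shift]
    exact IntermediateField.subset_adjoin _ _ ⟨_, rfl⟩
  | algebraMap x =>
    rw [← DiffExt.map_δ]
    exact IntermediateField.algebraMap_mem _ _
  | add x y _ _ hx hy =>
    rw [DiffRing.δ_add]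
    exact add_mem hx hy
  | inv x hx' hx =>
    rw [δ_inv]
    exact neg_mem (mul_mem (mul_mem (inv_mem hx') (inv_mem hx')) hx)
  | mul x y hx' hy' hx hy =>
    rw [DiffRing.δ_mul]
    exact add_mem (mul_mem hx' hy) (mul_mem hy' hx)

/-- A differential structure on an intermediate field that is closed under the derivations. -/
abbrev DiffRing.ofIntermediateField {m : ℕ} {K U : Type*} [Field K] [Field U] [DiffRing m U]
    [Algebra K U] (F : IntermediateField K U) (hF : ∀ (k : Fin m), ∀ x ∈ F, DiffRing.δ k x ∈ F) :
    DiffRing m F where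
  δ k x := ⟨DiffRing.δ k x.1, hF k x.1 x.2⟩
  δ_add k a b := Subtype.ext (DiffRing.δ_add k a.1 b.1)
  δ_mul k a b := Subtype.ext (DiffRing.δ_mul k a.1 b.1)
  δ_comm i j a := Subtype.ext (DiffRing.δ_comm i j a.1)

/-- The differential structure on a lift to a higher universe. -/
abbrev DiffRing.ofULift (m : ℕ) (F : Type u) [CommRing F] [DiffRing m F] :
    DiffRing m (ULift.{w} F) where
  δ k x := ⟨DiffRing.δ k x.down⟩
  δ_add k a b := ULift.ext _ _ (DiffRing.δ_add k a.down b.down)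
  δ_mul k a b := ULift.ext _ _ (DiffRing.δ_mul k a.down b.down)
  δ_comm i j a := ULift.ext _ _ (DiffRing.δ_comm i j a.down)

/-- Finitely many elements of the generated field are quotients of differential polynomials in `a`
of a common order `R`. Density at order `R` specialises them to `K` with their denominators kept
nonzero, preserving all polynomial relations. -/
theorem fieldEC_adjoin {m n : ℕ} {K U : Type*} [Field K] [DiffRing m K] [Field U] [DiffRing m U]
    [Algebra K U] {P : Ideal (DiffPoly m n K)} {a : Fin n → U}
    (ha : ∀ f : DiffPoly m n K, f ∈ P ↔ f.val a = 0) (hP : ∀ r, DenseAtOrder P r) :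
    FieldEC K (IntermediateField.adjoin K (Set.range (nablaAll m a))) := by
  rintro l S ⟨b, hb⟩
  have hrs : ∀ i, ∃ r s : DiffPoly m n K, s.val a ≠ 0 ∧ (b i : U) = r.val a / s.val a := by
    intro i
    obtain ⟨r, s, h⟩ := (IntermediateField.mem_adjoin_range_iff K _ _).1 (b i).2
    -- A quotient with vanishing denominator has the value `0` and is rewritten as `0 / 1`.
    by_cases hs : DiffPoly.val s a = 0
    · refine ⟨0, 1, by simp [DiffPoly.val], ?_⟩
      rw [h, show aeval (nablaAll m a) s = 0 from hs]
      simp [DiffPoly.val]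
    · exact ⟨r, s, hs, h⟩
  choose r s hs hrs using hrs
  choose oR hor using fun i => exists_orderLE (r i)
  choose os hos using fun i => exists_orderLE (s i)
  let R := Finset.univ.sup fun i => max (oR i) (os i)
  have hR : ∀ i, max (oR i) (os i) ≤ R := fun i =>
    Finset.le_sup (f := fun i => max (oR i) (os i)) (Finset.mem_univ i)
  choose r' hr' using fun i =>
    ((hor i).mono ((le_max_left _ _).trans (hR i))).exists_rename_eq
  choose s' hs' using fun i =>
    ((hos i).mono ((le_max_right _ _).trans (hR i))).exists_rename_eq
  obtain ⟨c, hc⟩ := exists_specialization (α := nabla m R a) (b := fun i => (b i : U))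
    (r := r') (s := s') (fun g hg => by
      rw [aeval_nabla, Ne, ← ha] at hg
      obtain ⟨φ, h1, h2⟩ := hP R _ hg (orderLE_rename R g)
      refine ⟨φ ∘ Subtype.val, fun p hp => ?_, ?_⟩
      · rw [← aeval_rename]
        rw [aeval_nabla, ← ha] at hp
        exact h1 _ hp (orderLE_rename R p)
      · rwa [← aeval_rename])
    (fun i => by rw [aeval_nabla, hs']; exact hs i)
    (fun i => by rw [aeval_nabla, aeval_nabla, hs', hr']; exact hrs i)
  refine ⟨c, fun f hf => hc f ?_⟩
  have h2 := aeval_algebraMap_apply U b f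
  rw [hb f hf, map_zero] at h2
  exact h2

/-- The extension is `K⟨a⟩`, which is closed under the derivations. It is lifted to a larger
universe to match the range of extensions quantified over in the theorem. -/
theorem exists_fieldEC_extension {m n : ℕ} {K U : Type u} [Field K] [DiffRing m K] [Field U]
    [DiffRing m U] [Algebra K U] [DiffExt m K U] {P : Ideal (DiffPoly m n K)} {a : Fin n → U}
    (ha : ∀ f : DiffPoly m n K, f ∈ P ↔ f.val a = 0) (hP : ∀ r, DenseAtOrder P r) :
    ∃ (L : Type (max u w)) (_ : Field L) (_ : DiffRing m L) (_ : Algebra K L)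
      (_ : DiffExt m K L) (b : Fin n → L), FieldEC K L ∧
      ∀ f : DiffPoly m n K, f ∈ P ↔ f.val b = 0 := by
  let F := IntermediateField.adjoin K (Set.range (nablaAll m a))
  let _ : DiffRing m F := DiffRing.ofIntermediateField F fun k x hx => δ_mem_adjoin a k hx
  have : DiffExt m K F := ⟨fun k x => Subtype.ext (DiffExt.map_δ k x)⟩
  have : DiffExt m F U := ⟨fun k x => rfl⟩
  let _ : DiffRing m (ULift.{w} F) := DiffRing.ofULift m F
  have : DiffExt m K (ULift.{w} F) := ⟨fun k x => ULift.ext _ _ (DiffExt.map_δ k x)⟩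
  have : DiffExt m F (ULift.{w} F) := ⟨fun k x => rfl⟩
  let b : Fin n → F := fun i => ⟨a i, IntermediateField.subset_adjoin _ _
    ⟨⟨i, 0⟩, nablaAll_zero a i⟩⟩
  refine ⟨ULift.{w} F, inferInstance, inferInstance, inferInstance, inferInstance,
    fun i => algebraMap F (ULift.{w} F) (b i), ?_, fun f => ?_⟩
  · rintro l S ⟨c, hc⟩
    refine fieldEC_adjoin ha hP l S ⟨fun i => (c i).down, fun f hf => ?_⟩
    have h := hc f hf
    have h2 := aeval_algebraMap_apply (ULift.{w} F) (fun i => (c i).down) f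
    have h3 : (algebraMap F (ULift.{w} F) ∘ fun i => (c i).down) = c := rfl
    rw [h3, h] at h2
    exact congrArg ULift.down h2.symm
  · rw [DiffPoly.val_algebraMap (m := m) f b, ha f]
    have h1 := DiffPoly.val_algebraMap (m := m) (L := U) f b
    have h2 : (fun i => algebraMap F U (b i)) = a := rfl
    rw [← h2, h1, map_eq_zero_iff _ (algebraMap F U).injective,
      map_eq_zero_iff _ (algebraMap F (ULift.{w} F)).injective]

end GenericExtension

/-! ### From `UC_m` to differential existential closedness -/

section Affine

variable {m n : ℕ} {K U : Type*} [Field K] [DiffRing m K] [Field U] [DiffRing m U] [Algebra K U]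

instance {m : ℕ} {K : Type*} [Field K] [DiffRing m K] : DiffExt m K K := ⟨fun _ _ => rfl⟩

theorem aeval_toPol_rename {m n : ℕ} {K U : Type*} [Field K] [Field U] [Algebra K U] {r : ℕ} (z : JetVar m n r → U) (p : MvPolynomial (JetVar m n r) K) :
    aeval z (toPol r (rename Subtype.val p : DiffPoly m n K)) = aeval z p := by
  rw [toPol, killCompl_rename_app]

theorem derivsUpTo_subset {Λ : Finset (DiffPoly m n K)} {P : Ideal (DiffPoly m n K)}
    (hΛ : (Λ : Set (DiffPoly m n K)) ⊆ P) (hδ : DiffRing.IsDiffIdeal m P) (r : ℕ) :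
    derivsUpTo r (Λ : Set (DiffPoly m n K)) ⊆ P := by
  rintro _ ⟨-, f, hf, ξ, rfl⟩
  exact hδ.iter_mem (hΛ hf) ξ

/-- The generic point's jet `∇_r(a)` lies in the set, which bounds the vanishing ideal above;
reduction modulo `Λ` gives the other inclusion. -/
theorem IsCharSet.vanishingIdeal_eq [CharZero K] {Λ : Finset (DiffPoly m n K)}
    {P : Ideal (DiffPoly m n K)} (h : IsCharSet Λ P) (hP : P.IsPrime)
    (hδ : DiffRing.IsDiffIdeal m P) {r : ℕ} (hr : ∀ f ∈ Λ, OrderLE r f) {a : Fin n → U}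
    (ha : ∀ f : DiffPoly m n K, f ∈ P ↔ f.val a = 0) :
    vanishingIdeal K (algZeros U r (derivsUpTo r (Λ : Set (DiffPoly m n K))) \
      algZeros U r {HProd Λ}) = jetIdeal P r := by
  obtain ⟨H, hH⟩ := (h.1.1.orderLE_hProd hr).exists_rename_eq
  ext p
  rw [mem_vanishingIdeal_iff, mem_jetIdeal]
  constructor
  · intro hp
    rw [ha, ← aeval_nabla]
    refine hp _ ⟨fun f hf => ?_, fun h0 => ?_⟩
    · obtain ⟨q, rfl⟩ := hf.1.exists_rename_eq
      rw [aeval_toPol_rename, aeval_nabla]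
      exact (ha _).1 (derivsUpTo_subset h.1.2 hδ r hf)
    · have := h0 _ rfl
      rw [← hH, aeval_toPol_rename, aeval_nabla, hH] at this
      exact h.hProd_notMem hP ((ha _).2 this)
  · intro hp z hz
    let φ : DVar m n → U := fun v => if h : v.order ≤ r then z ⟨v, h⟩ else 0
    have hφ : φ ∘ Subtype.val = z := by
      funext v
      exact dif_pos v.2
    have h1 := h.map_eq_zero hP hδ hr (φ := (aeval φ : DiffPoly m n K →ₐ[K] U).toRingHom)
      (fun f hf => ?_) (fun h0 => hz.2 ?_) hp (orderLE_rename r p)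
    · have h2 : aeval φ (rename Subtype.val p : DiffPoly m n K) = 0 := h1
      rwa [aeval_rename, hφ] at h2
    · have h2 := hz.1 f hf
      obtain ⟨q, rfl⟩ := hf.1.exists_rename_eq
      rw [aeval_toPol_rename] at h2
      change aeval φ _ = 0
      rwa [aeval_rename, hφ]
    · rintro _ rfl
      have h2 : aeval φ (HProd Λ) = 0 := h0
      rw [← hH, aeval_rename, hφ] at h2
      rwa [← hH, aeval_toPol_rename]

theorem IsModelUC.diffEC [CharZero K] [DiffExt m K U]
    (hgen : ∀ (n : ℕ) (P : Ideal (DiffPoly m n K)), P.IsPrime → DiffRing.IsDiffIdeal m P →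
      ∃ a : Fin n → U, ∀ f : DiffPoly m n K, f ∈ P ↔ f.val a = 0)
    (hUC : IsModelUC m K U) {L : Type*} [Field L] [DiffRing m L] [Algebra K L] [DiffExt m K L]
    (hL : FieldEC K L) : DiffEC m K L := by
  rintro n S ⟨a, ha⟩
  let P : Ideal (DiffPoly m n K) := RingHom.ker (aeval (nablaAll m a) : DiffPoly m n K →ₐ[K] L)
  have hPa : ∀ f : DiffPoly m n K, f ∈ P ↔ f.val a = 0 := fun f => Iff.rfl
  have hP : P.IsPrime := RingHom.ker_isPrime _
  have hδ : DiffRing.IsDiffIdeal m P := by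
    intro k f hf
    rw [hPa, DiffPoly.val_δ, (hPa f).1 hf, DiffRing.δ_zero]
  obtain ⟨Λ, hΛ⟩ := exists_isCharSet P
  choose o ho using fun f : DiffPoly m n K => exists_orderLE f
  have hr : ∀ f ∈ Λ, OrderLE (Λ.sup o) f := fun f hf => (ho f).mono (Finset.le_sup hf)
  obtain ⟨H, hH⟩ := (hΛ.1.1.orderLE_hProd hr).exists_rename_eq
  -- The order is taken just large enough for `Λ`; the algebraic locus of `∇_r(a)` is the truncation
  -- of `P`, and `H_Λ` does not vanish at its generic point.
  obtain ⟨c, hc, hcH⟩ := hL.exists_isSmoothPoint (P := jetIdeal P (Λ.sup o))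
    (α := nabla m (Λ.sup o) a) (fun f => by rw [aeval_nabla, ← hPa, mem_jetIdeal]) (h := H)
    (by rw [mem_jetIdeal, hH]; exact hΛ.hProd_notMem hP)
  obtain ⟨g, hg⟩ := hgen n P hP hδ
  obtain ⟨b, hb, hbH⟩ : ∃ b : Fin n → K, (∀ f ∈ Λ, f.val b = 0) ∧ (HProd Λ).val b ≠ 0 := by
    refine hUC n P hP hδ Λ hΛ ⟨Λ.sup o, hr, c, ⟨fun f hf => ?_, fun h0 => ?_⟩, ?_⟩
    · have h1 := derivsUpTo_subset hΛ.1.2 hδ _ hf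
      obtain ⟨q, rfl⟩ := hf.1.exists_rename_eq
      rw [aeval_toPol_rename]
      refine (aeval_algebraMap_apply U c q).trans ?_
      rw [hc.1 q h1, map_zero]
    · have h1 := h0 _ rfl
      rw [← hH, aeval_toPol_rename] at h1
      have h2 := (aeval_algebraMap_apply U c H).symm.trans h1
      exact hcH ((map_eq_zero_iff _ (algebraMap K U).injective).1 h2)
    · rwa [hΛ.vanishingIdeal_eq hP hδ hr hg]
  refine ⟨b, fun f hf => ?_⟩
  -- As `b` is a differential zero of `Λ`, it annihilates derivatives of every order, so reduction
  -- can be used at an order that also accommodates `f`.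
  refine hΛ.map_eq_zero hP hδ (r := max (Λ.sup o) (o f))
    (φ := (aeval (nablaAll m b) : DiffPoly m n K →ₐ[K] K).toRingHom)
    (fun f hf => (hr f hf).mono (le_max_left _ _)) ?_ hbH (ha f hf)
    ((ho f).mono (le_max_right _ _))
  rintro _ ⟨-, f, hf, ξ, rfl⟩
  exact DiffPoly.val_iter_eq_zero (hb f hf) ξ

/-- The indeterminates in one more differential variable. -/
def DVar.castSucc (v : DVar m n) : DVar m (n + 1) := ⟨v.idx.castSucc, v.exp⟩

theorem DiffPoly.val_rename_castSucc {m n : ℕ} {K L : Type*} [Field K] [Field L] [DiffRing m L]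
    [Algebra K L] (x : Fin (n + 1) → L) (f : DiffPoly m n K) :
    DiffPoly.val (rename DVar.castSucc f : DiffPoly m (n + 1) K) x =
      f.val fun i => x i.castSucc := by
  rw [DiffPoly.val, aeval_rename]
  rfl

/-- Rabinowitsch's trick: a further differential indeterminate, inverse to `q`, encodes `q ≠ 0` as
an equation. -/
theorem DiffEC.exists_point {L : Type*} [Field L] [DiffRing m L] [Algebra K L]
    (hL : DiffEC m K L) {P : Ideal (DiffPoly m n K)} {b : Fin n → L}
    (hb : ∀ f : DiffPoly m n K, f ∈ P ↔ f.val b = 0) {q : DiffPoly m n K} (hq : q ∉ P) :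
    ∃ c : Fin n → K, (∀ f ∈ P, f.val c = 0) ∧ q.val c ≠ 0 := by
  let y : DVar m (n + 1) := ⟨Fin.last n, 0⟩
  have hq0 : q.val b ≠ 0 := fun h => hq ((hb q).2 h)
  obtain ⟨c, hc⟩ := hL (n + 1) ({f | ∃ p ∈ P, f = rename DVar.castSucc p} ∪ {X y * rename DVar.castSucc q - 1})
    ⟨Fin.snoc (α := fun _ => L) b (q.val b)⁻¹, by
      have hs : (fun i : Fin n =>
          (Fin.snoc (α := fun _ => L) b (q.val b)⁻¹ : Fin (n + 1) → L) i.castSucc) = b := by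
        funext i
        simp
      rintro f (⟨p, hp, rfl⟩ | rfl)
      · rw [DiffPoly.val_rename_castSucc, hs]
        exact (hb p).1 hp
      · have h1 := DiffPoly.val_rename_castSucc (Fin.snoc (α := fun _ => L) b (q.val b)⁻¹) q
        rw [hs] at h1
        simp only [DiffPoly.val] at h1 hq0 ⊢
        rw [map_sub, map_mul, h1, aeval_X, map_one]
        simp only [y, nablaAll_zero, Fin.snoc_last]
        rw [inv_mul_cancel₀ hq0, sub_self]⟩
  refine ⟨fun i => c i.castSucc, fun f hf => ?_, fun h0 => ?_⟩
  · rw [← DiffPoly.val_rename_castSucc]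
    exact hc _ (Or.inl ⟨f, hf, rfl⟩)
  · have := hc _ (Or.inr rfl)
    rw [← DiffPoly.val_rename_castSucc] at h0
    simp only [DiffPoly.val] at h0 this
    rw [map_sub, map_mul, h0, mul_zero, map_one, zero_sub, neg_eq_zero] at this
    exact one_ne_zero this

end Affine

/-! ### Closed sets of the Zariski and Kolchin topologies -/

section Topologies

variable {m n N : ℕ} {K U : Type*} [Field K] [Field U] [Algebra K U]

theorem isClosed_zariski_iff {σ : Type*} {Z : Set (σ → U)} :
    IsClosed[zariskiTopology K U σ] Z ↔
      ∃ S : Set (MvPolynomial σ K), Z = {a | ∀ f ∈ S, aeval a f = 0} := by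
  rw [← @isOpen_compl_iff _ _ (zariskiTopology K U σ)]
  change Zᶜᶜ ∈ _ ↔ _
  rw [compl_compl]
  rfl

theorem mem_closure_zariski_iff {σ : Type*} {Z : Set (σ → U)} {p : σ → U} :
    p ∈ closure[zariskiTopology K U σ] Z ↔
      ∀ f : MvPolynomial σ K, (∀ z ∈ Z, aeval z f = 0) → aeval p f = 0 := by
  let _ := zariskiTopology K U σ
  constructor
  · intro hp f hf
    have h : IsClosed[zariskiTopology K U σ] {a : σ → U | ∀ g ∈ ({f} : Set _), aeval a g = 0} :=
      isClosed_zariski_iff.2 ⟨_, rfl⟩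
    have h2 : Z ⊆ {a : σ → U | ∀ g ∈ ({f} : Set _), aeval a g = 0} := by
      rintro z hz g rfl
      exact hf z hz
    exact closure_minimal h2 h hp f rfl
  · intro h
    obtain ⟨S, hS⟩ := isClosed_zariski_iff.1 (isClosed_closure (s := Z))
    rw [hS]
    refine fun f hf => h f fun z hz => ?_
    have h2 : z ∈ closure Z := subset_closure hz
    rw [hS] at h2
    exact h2 f hf

variable [DiffRing m U]

theorem isClosed_kolchin_iff {Z : Set (Fin n → U)} :
    IsClosed[kolchinTopology m K U n] Z ↔
      ∃ S : Set (DiffPoly m n K), Z = {a | ∀ f ∈ S, f.val a = 0} := by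
  rw [@isClosed_induced_iff _ _ (zariskiTopology K U (DVar m n))]
  constructor
  · rintro ⟨_, hC, rfl⟩
    obtain ⟨S, rfl⟩ := isClosed_zariski_iff.1 hC
    exact ⟨S, rfl⟩
  · rintro ⟨S, rfl⟩
    exact ⟨_, isClosed_zariski_iff.2 ⟨S, rfl⟩, rfl⟩

theorem isOpen_kolchin_ne (f : DiffPoly m n K) :
    IsOpen[kolchinTopology m K U n] {a | f.val a ≠ 0} := by
  rw [← @isClosed_compl_iff _ (kolchinTopology m K U n), isClosed_kolchin_iff]
  refine ⟨{f}, ?_⟩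
  ext a
  simp

theorem isClosed_projZariski_iff {C : Set (ProjSpace U N)} :
    IsClosed[projZariski K U N] C ↔
      ∀ j, IsClosed[zariskiTopology K U (Fin N)] (chart j ⁻¹' C) := by
  rw [← @isOpen_compl_iff _ _ (projZariski K U N), isOpen_iSup_iff]
  refine forall_congr' fun j => ?_
  rw [← @isOpen_compl_iff _ _ (zariskiTopology K U (Fin N))]
  rfl

theorem isOpen_projKolchin_iff {O : Set (ProjSpace U N)} :
    IsOpen[projKolchin m K U N] O ↔
      ∀ j, IsOpen[kolchinTopology m K U N] (chart j ⁻¹' O) := by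
  rw [isOpen_iSup_iff]
  rfl

theorem isClosed_projKolchin_iff {C : Set (ProjSpace U N)} :
    IsClosed[projKolchin m K U N] C ↔
      ∀ j, IsClosed[kolchinTopology m K U N] (chart j ⁻¹' C) := by
  rw [← @isOpen_compl_iff _ _ (projKolchin m K U N), isOpen_projKolchin_iff]
  refine forall_congr' fun j => ?_
  rw [← @isOpen_compl_iff _ _ (kolchinTopology m K U N)]
  rfl

end Topologies

/-! ### Standard affine charts -/

section Charts

variable {N : ℕ} {U : Type*} [Field U]

theorem chart_injective (j : Fin (N + 1)) : Function.Injective (chart (U := U) j) := by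
  intro a b h
  obtain ⟨l, hl⟩ := (Projectivization.mk_eq_mk_iff' _ _ _ _ _).1 h
  have h1 : l = 1 := by
    have := congrFun hl j
    simpa using this
  subst h1
  rw [one_smul] at hl
  funext i
  have := congrFun hl (j.succAbove i)
  simpa using this.symm

theorem chart_eq_mk_iff (j : Fin (N + 1)) (a : Fin N → U) {x : Fin (N + 1) → U} (hx : x ≠ 0) :
    chart j a = Projectivization.mk U x hx ↔ x j ≠ 0 ∧ ∀ i, a i = x (j.succAbove i) / x j := by
  rw [chart, Projectivization.mk_eq_mk_iff']
  constructor
  · rintro ⟨l, hl⟩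
    have h1 : l * x j = 1 := by
      have := congrFun hl j
      simpa using this
    have hj : x j ≠ 0 := right_ne_zero_of_mul_eq_one h1
    refine ⟨hj, fun i => ?_⟩
    have := congrFun hl (j.succAbove i)
    simp only [Pi.smul_apply, smul_eq_mul, Fin.insertNth_apply_succAbove] at this
    rw [← this, eq_div_iff hj, mul_right_comm, h1, one_mul]
  · rintro ⟨hj, h⟩
    refine ⟨(x j)⁻¹, funext fun i => ?_⟩
    refine Fin.succAboveCases j ?_ (fun i => ?_) i
    · simp [hj]
    · simp [h, div_eq_inv_mul]

end Charts

/-! ### Change of charts in the Kolchin topology -/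

section Homogenization

variable {m n l : ℕ} {K U : Type*} [Field K] [DiffRing m K] [Field U] [DiffRing m U]
  [Algebra K U] [DiffExt m K U]

/-- Iterating the quotient rule: `δ(G / E₀^k) = (E₀ δG - k G δE₀) / E₀^(k+1)`. -/
theorem exists_iter_div_eq (E₀ E : DiffPoly m l K) (ξ : Fin m → ℕ) :
    ∃ (G : DiffPoly m l K) (k : ℕ), ∀ a : Fin l → U, E₀.val a ≠ 0 →
      E₀.val a ^ k * DiffRing.iter ξ (E.val a / E₀.val a) = G.val a := by
  induction ξ using multiIndex_induction with
  | h0 =>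
    refine ⟨E, 1, fun a ha => ?_⟩
    rw [DiffRing.iter_zero, pow_one, mul_div_cancel₀ _ ha]
  | h1 ξ i ih =>
    obtain ⟨G, k, hG⟩ := ih
    refine ⟨E₀ * DiffRing.δ i G - (k : DiffPoly m l K) * G * DiffRing.δ i E₀, k + 1,
      fun a ha => ?_⟩
    have h1 : DiffPoly.val (E₀ * DiffRing.δ i G - (k : DiffPoly m l K) * G * DiffRing.δ i E₀) a =
        E₀.val a * DiffRing.δ i (G.val a) - k * G.val a * DiffRing.δ i (E₀.val a) := by
      rw [← DiffPoly.val_δ (K := K), ← DiffPoly.val_δ (K := K)]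
      simp only [DiffPoly.val, map_sub, map_mul, map_natCast]
    rw [h1, DiffRing.iter_add_single, ← hG a ha, DiffRing.δ_mul]
    linear_combination (-DiffRing.iter ξ (E.val a / E₀.val a)) *
      DiffRing.δ_pow_succ i (E₀.val a) k

/-- Transition maps between charts are quotients with a common denominator; clearing it carries
differential equations from one chart to another. -/
theorem exists_homogenization (E₀ : DiffPoly m l K) (E : Fin n → DiffPoly m l K)
    (f : DiffPoly m n K) :
    ∃ (G : DiffPoly m l K) (k : ℕ), ∀ a : Fin l → U, E₀.val a ≠ 0 →
      E₀.val a ^ k * f.val (fun i => (E i).val a / E₀.val a) = G.val a := by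
  induction f using MvPolynomial.induction_on with
  | C c => exact ⟨C c, 0, fun a _ => by simp [DiffPoly.val]⟩
  | add p q hp hq =>
    obtain ⟨G, k, h⟩ := hp
    obtain ⟨G', k', h'⟩ := hq
    refine ⟨G * E₀ ^ k' + G' * E₀ ^ k, k + k', fun a ha => ?_⟩
    have h1 := h a ha
    have h2 := h' a ha
    simp only [DiffPoly.val, map_add, map_mul, map_pow] at h1 h2 ⊢
    rw [← h1, ← h2]
    ring
  | mul_X p v hp =>
    obtain ⟨G, k, h⟩ := hp
    obtain ⟨G', k', h'⟩ := exists_iter_div_eq (U := U) E₀ (E v.idx) v.exp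
    refine ⟨G * G', k + k', fun a ha => ?_⟩
    have h1 := h a ha
    have h2 := h' a ha
    simp only [DiffPoly.val, map_mul, aeval_X, nablaAll] at h1 h2 ⊢
    rw [← h1, ← h2]
    ring

/-- The homogeneous coordinates on the `i`-th chart, as differential polynomials. -/
noncomputable def homogCoord (m : ℕ) {N : ℕ} (K : Type*) [Field K] (i t : Fin (N + 1)) :
    DiffPoly m N K :=
  i.insertNth (α := fun _ => DiffPoly m N K) 1 (fun s => X ⟨s, 0⟩) t

omit [DiffRing m K] [DiffExt m K U] in
theorem val_homogCoord {N : ℕ} (i t : Fin (N + 1)) (a : Fin N → U) :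
    (homogCoord m K i t).val a = i.insertNth (α := fun _ => U) 1 a t := by
  refine Fin.succAboveCases i ?_ (fun t => ?_) t
  · simp [homogCoord, DiffPoly.val]
  · simp [homogCoord, DiffPoly.val, nablaAll_zero]

/-- The charts are open embeddings for the Kolchin topology. -/
theorem isOpen_chart_image {N : ℕ} (j : Fin (N + 1)) {O : Set (Fin N → U)}
    (hO : IsOpen[kolchinTopology m K U N] O) : IsOpen[projKolchin m K U N] (chart j '' O) := by
  rw [isOpen_projKolchin_iff]
  intro i
  rw [← @isClosed_compl_iff _ (kolchinTopology m K U N)] at hO ⊢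
  obtain ⟨S, hS⟩ := isClosed_kolchin_iff.1 hO
  choose G k hG using exists_homogenization (U := U) (homogCoord m K i j)
    (fun t : Fin N => homogCoord m K i (j.succAbove t))
  -- The factor `homogCoord m K i j` puts all points outside the `j`-th chart into the closed set.
  refine isClosed_kolchin_iff.2 ⟨{g | ∃ f ∈ S, g = homogCoord m K i j * G f}, ?_⟩
  have hmem : ∀ a, a ∈ chart i ⁻¹' (chart j '' O) ↔ (homogCoord m K i j).val a ≠ 0 ∧
      (fun t : Fin N => (homogCoord m K i (j.succAbove t)).val a / (homogCoord m K i j).val a)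
        ∈ O := by
    intro a
    simp only [val_homogCoord]
    constructor
    · rintro ⟨b, hb, hba⟩
      obtain ⟨h1, h2⟩ := (chart_eq_mk_iff j b _).1 hba
      refine ⟨h1, ?_⟩
      rwa [← funext h2]
    · rintro ⟨h1, h2⟩
      exact ⟨_, h2, (chart_eq_mk_iff j _ _).2 ⟨h1, fun _ => rfl⟩⟩
  ext a
  rw [Set.mem_compl_iff, hmem]
  have hO' : ∀ b, b ∈ O ↔ ¬ ∀ f ∈ S, f.val b = 0 := by
    intro b
    have : b ∈ Oᶜ ↔ ∀ f ∈ S, f.val b = 0 := by rw [hS]; rfl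
    rw [← this, Set.mem_compl_iff, not_not]
  rw [hO', not_and_not_right]
  constructor
  · rintro h _ ⟨f, hf, rfl⟩
    by_cases h0 : (homogCoord m K i j).val a = 0
    · simp only [DiffPoly.val] at h0 ⊢
      rw [map_mul, h0, zero_mul]
    · have h1 := hG f a h0
      rw [h h0 f hf, mul_zero] at h1
      simp only [DiffPoly.val] at h1 ⊢
      rw [map_mul, ← h1, mul_zero]
  · intro h h0 f hf
    have h1 := h _ ⟨f, hf, rfl⟩
    have h2 := hG f a h0
    simp only [DiffPoly.val] at h0 h1 h2 ⊢
    rw [map_mul] at h1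
    rw [(mul_eq_zero.1 h1).resolve_left h0] at h2
    exact (mul_eq_zero.1 h2).resolve_left (pow_ne_zero _ h0)

end Homogenization

/-! ### Differential varieties, their chart ideals and their jets -/

namespace DiffVariety

variable {m N : ℕ} {K U : Type*} [Field K] [DiffRing m K] [Field U] [DiffRing m U]
  [Algebra K U]

/-- The ideal of the differential polynomials that vanish on the part of `V` in the `j`-th
standard affine chart. -/
def chartIdeal (V : DiffVariety m K U N) (j : Fin (N + 1)) : Ideal (DiffPoly m N K) where
  carrier := {f | ∀ a, chart j a ∈ V.points → f.val a = 0}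
  zero_mem' _ _ := map_zero _
  add_mem' {f g} hf hg a ha := by
    have h1 := hf a ha
    have h2 := hg a ha
    simp only [DiffPoly.val] at h1 h2 ⊢
    rw [map_add, h1, h2, add_zero]
  smul_mem' f g hg a ha := by
    have h1 := hg a ha
    simp only [DiffPoly.val] at h1 ⊢
    rw [smul_eq_mul, map_mul, h1, mul_zero]

omit [DiffRing m K] in
theorem mem_chartIdeal {V : DiffVariety m K U N} {j : Fin (N + 1)} {f : DiffPoly m N K} :
    f ∈ V.chartIdeal j ↔ ∀ a, chart j a ∈ V.points → f.val a = 0 := Iff.rfl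

theorem isDiffIdeal_chartIdeal [DiffExt m K U] (V : DiffVariety m K U N) (j : Fin (N + 1)) :
    DiffRing.IsDiffIdeal m (V.chartIdeal j) := by
  intro k f hf a ha
  rw [DiffPoly.val_δ, hf a ha, DiffRing.δ_zero]

/-- If neither `f` nor `g` vanishes on the chart, their nonvanishing loci are open in projective
space and meet `V`, so irreducibility gives a common point, where `f g` is nonzero. -/
theorem isPrime_chartIdeal [DiffExt m K U] {V : DiffVariety m K U N} (hV : V.IsKIrreducible)
    {j : Fin (N + 1)} {w : Fin N → U} (hw : chart j w ∈ V.points) :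
    (V.chartIdeal j).IsPrime := by
  refine ⟨fun h => ?_, fun {f g} hfg => ?_⟩
  · have h1 : (1 : DiffPoly m N K) ∈ V.chartIdeal j := h ▸ Submodule.mem_top
    have := h1 w hw
    simp [DiffPoly.val] at this
  · by_contra! h
    simp only [mem_chartIdeal, not_forall] at h
    obtain ⟨⟨a, ha, hfa⟩, b, hb, hgb⟩ := h
    obtain ⟨_, hx, ⟨c, hfc, rfl⟩, ⟨c', hgc, hcc⟩⟩ :=
      hV.2 _ _ (isOpen_chart_image j (isOpen_kolchin_ne f))
        (isOpen_chart_image j (isOpen_kolchin_ne g)) ⟨_, ha, a, hfa, rfl⟩ ⟨_, hb, b, hgb, rfl⟩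
    obtain rfl : c' = c := chart_injective j hcc
    have := hfg c' hx
    simp only [DiffPoly.val, Set.mem_ofPred_eq] at this hfc hgc
    rw [map_mul] at this
    exact mul_ne_zero hfc hgc this

/-- A polynomial as a differential polynomial of order zero. -/
noncomputable def toOrderZero (m : ℕ) (f : MvPolynomial (Fin N) K) : DiffPoly m N K :=
  rename (fun i => ⟨i, 0⟩) f

omit [DiffRing m K] in
theorem val_toOrderZero {L : Type*} [Field L] [DiffRing m L] [Algebra K L]
    (f : MvPolynomial (Fin N) K) (a : Fin N → L) : (toOrderZero m f).val a = aeval a f := by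
  rw [DiffPoly.val, toOrderZero, aeval_rename]
  congr 2
  funext i
  exact nablaAll_zero a i

/-- A jet coordinate of order zero. -/
def zeroJet (m : ℕ) {N : ℕ} (r : ℕ) (i : Fin N) : JetVar m N r := ⟨⟨i, 0⟩, by simp [DVar.order]⟩

omit [DiffRing m K] in
/-- Near the points of the variety in a chart, the ambient variety is the zero set of the
polynomials in the ideal. -/
theorem exists_mem_ambient {V : DiffVariety m K U N} {j : Fin (N + 1)} {w : Fin N → U}
    (hw : chart j w ∈ V.points) :
    ∃ h : MvPolynomial (Fin N) K, toOrderZero m h ∉ V.chartIdeal j ∧ ∀ x : Fin N → U,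
      (∀ f : MvPolynomial (Fin N) K, toOrderZero m f ∈ V.chartIdeal j → aeval x f = 0) →
      aeval x h ≠ 0 → chart j x ∈ V.ambient := by
  obtain ⟨A, B, hA, hB, hAB⟩ := V.ambient_locallyClosed
  obtain ⟨C, -, hC⟩ := V.points_closed
  obtain ⟨SA, hSA⟩ := isClosed_zariski_iff.1 (isClosed_projZariski_iff.1 hA j)
  obtain ⟨SB, hSB⟩ := isClosed_zariski_iff.1 (isClosed_projZariski_iff.1 hB j)
  have hA' : ∀ x, chart j x ∈ A ↔ ∀ f ∈ SA, aeval x f = 0 := fun x => Set.ext_iff.1 hSA x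
  have hB' : ∀ x, chart j x ∈ B ↔ ∀ f ∈ SB, aeval x f = 0 := fun x => Set.ext_iff.1 hSB x
  have hV : ∀ x, x ∈ V.points → x ∈ A ∧ x ∉ B := by
    intro x hx
    rw [hC, hAB] at hx
    exact hx.1
  have hwB := (hV _ hw).2
  rw [hB'] at hwB
  push Not at hwB
  obtain ⟨h, hhS, hh⟩ := hwB
  -- `h` is an equation of the removed set `B` that fails at `w`; the equations of `A` vanish on
  -- `V`, hence belong to the ideal.
  refine ⟨h, fun hmem => ?_, fun x hx hxh => ?_⟩
  · have := hmem w hw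
    rw [val_toOrderZero] at this
    exact hh this
  · rw [hAB]
    refine ⟨(hA' x).2 fun f hf => hx f fun a ha => ?_, fun hxB => hxh ((hB' x).1 hxB h hhS)⟩
    rw [val_toOrderZero]
    exact (hA' a).1 (hV _ ha).1 f hf

omit [DiffRing m K] in
theorem vanishingIdeal_jetChart (V : DiffVariety m K U N) (r : ℕ) (j : Fin (N + 1)) :
    vanishingIdeal K (V.jetChart r j) = jetIdeal (V.chartIdeal j) r := by
  obtain ⟨C, -, hC⟩ := V.points_closed
  ext p
  rw [mem_vanishingIdeal_iff, mem_jetIdeal, mem_chartIdeal]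
  constructor
  · intro hp a ha
    rw [← aeval_nabla]
    refine hp _ ⟨@subset_closure _ (zariskiTopology K U (JetVar m N r)) _ _ ⟨a, ha, rfl⟩, ?_⟩
    have h1 : (fun i => nabla m r a (zeroJet m r i)) = a := funext fun i => nablaAll_zero a i
    change chart j (fun i => nabla m r a (zeroJet m r i)) ∈ V.ambient
    rw [h1]
    rw [hC] at ha
    exact ha.1
  · rintro hp z ⟨hz, -⟩
    refine mem_closure_zariski_iff.1 hz p ?_
    rintro _ ⟨a, ha, rfl⟩
    rw [aeval_nabla]
    exact hp a ha

omit [DiffRing m K] in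
theorem exists_chart_mem_points {V : DiffVariety m K U N} {r : ℕ} {j : Fin (N + 1)}
    (h : HasSmoothKPoint K (V.jetChart r j)) : ∃ w, chart j w ∈ V.points := by
  obtain ⟨a, ha, -⟩ := h
  by_contra! hne
  have h1 : nabla m r '' (chart j ⁻¹' V.points) = ∅ := by
    rw [Set.image_eq_empty]
    exact Set.eq_empty_of_forall_notMem hne
  have h2 := ha.1
  rw [h1, @closure_empty _ (zariskiTopology K U (JetVar m N r))] at h2
  exact h2

omit [DiffRing m K] in
-- The jet of `b` is a generic point of the truncated chart ideal, so smooth `K`-points exist;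
-- asking in addition that `h` be nonzero makes the chosen point project into the ambient variety.
theorem jetHasSmoothKPoint_of_fieldEC [CharZero K] {V : DiffVariety m K U N} {j : Fin (N + 1)}
    {w : Fin N → U} (hw : chart j w ∈ V.points) {L : Type*} [Field L] [DiffRing m L] [Algebra K L]
    (hL : FieldEC K L) {b : Fin N → L} (hb : ∀ f : DiffPoly m N K, f ∈ V.chartIdeal j ↔ f.val b = 0)
    (r : ℕ) : V.JetHasSmoothKPoint r := by
  obtain ⟨h, hh, hamb⟩ := exists_mem_ambient hw
  have hren : ∀ f : MvPolynomial (Fin N) K,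
      (rename Subtype.val (rename (zeroJet m r) f) : DiffPoly m N K) = toOrderZero m f := by
    intro f
    rw [rename_rename]
    rfl
  obtain ⟨c, hc, hch⟩ := hL.exists_isSmoothPoint (P := jetIdeal (V.chartIdeal j) r)
    (α := nabla m r b) (fun f => by rw [aeval_nabla, ← hb, mem_jetIdeal])
    (h := rename (zeroJet m r) h) (by rwa [mem_jetIdeal, hren])
  have haev : ∀ p : MvPolynomial (JetVar m N r) K,
      aeval (fun s => algebraMap K U (c s)) p = algebraMap K U (aeval c p) := fun p =>
    aeval_algebraMap_apply U c p
  refine ⟨j, c, ⟨mem_closure_zariski_iff.2 fun f hf => ?_, hamb _ (fun f hf => ?_) ?_⟩, ?_⟩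
  · rw [haev, hc.1 f, map_zero]
    rw [← vanishingIdeal_jetChart]
    exact fun z hz => mem_closure_zariski_iff.1 hz.1 f hf
  · have h1 := hc.1 (rename (zeroJet m r) f) (by rwa [mem_jetIdeal, hren])
    have h2 := haev (rename (zeroJet m r) f)
    rw [h1, map_zero, aeval_rename] at h2
    exact h2
  · have h2 := haev (rename (zeroJet m r) h)
    rw [aeval_rename] at h2
    intro h0
    have h3 : aeval ((fun s => algebraMap K U (c s)) ∘ zeroJet m r) h = 0 := h0
    rw [h3] at h2
    exact hch ((map_eq_zero_iff _ (algebraMap K U).injective).1 h2.symm)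
  · rwa [vanishingIdeal_jetChart]

theorem chart_mem_projKPoints (j : Fin (N + 1)) (c : Fin N → K) :
    chart j (fun i => algebraMap K U (c i)) ∈ projKPoints K U N := by
  have h : (fun i => algebraMap K U (j.insertNth (α := fun _ => K) 1 c i)) =
      j.insertNth (α := fun _ => U) 1 (fun i => algebraMap K U (c i)) := by
    funext i
    refine Fin.succAboveCases j ?_ (fun i => ?_) i
    · simp
    · simp
  refine ⟨j.insertNth (α := fun _ => K) 1 c, ?_, ?_⟩
  · intro h0
    have := congrFun h0 j
    simp at this
  · rw [chart]
    congr 1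
    exact h.symm

/-- If the closure of the `K`-points missed a point of `V`, irreducibility would give a missed point
inside the chart, hence a `g` outside the chart ideal that vanishes on that closure. Existential
closedness gives a `K`-zero of the ideal off `h g`: by `h` it lies on `V`, and by `g` it lies
outside the closure of the `K`-points, a contradiction. -/
theorem kPointsDense_of_diffEC [DiffExt m K U] {V : DiffVariety m K U N} (hV : V.IsKIrreducible)
    {j : Fin (N + 1)} {w : Fin N → U} (hw : chart j w ∈ V.points) {L : Type*} [Field L]
    [DiffRing m L] [Algebra K L] (hL : DiffEC m K L) {b : Fin N → L}
    (hb : ∀ f : DiffPoly m N K, f ∈ V.chartIdeal j ↔ f.val b = 0) : V.KPointsDense := by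
  have hprime := isPrime_chartIdeal hV hw
  obtain ⟨h, hh, hamb⟩ := exists_mem_ambient hw
  obtain ⟨C, hC, hVC⟩ := V.points_closed
  obtain ⟨S, hS⟩ := isClosed_kolchin_iff.1 (isClosed_projKolchin_iff.1 hC j)
  have hS' : ∀ x, chart j x ∈ C ↔ ∀ f ∈ S, f.val x = 0 := fun x => Set.ext_iff.1 hS x
  intro x hx
  by_contra hxD
  have hDc := @isClosed_closure _ (projKolchin m K U N) (V.points ∩ projKPoints K U N)
  obtain ⟨_, hy, hyD, ⟨a, -, rfl⟩⟩ := hV.2 _ _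
    ((@isOpen_compl_iff _ _ (projKolchin m K U N)).2 hDc)
    (isOpen_chart_image (K := K) (m := m) j
      (@isOpen_univ _ (kolchinTopology m K U N)))
    ⟨x, hx, hxD⟩ ⟨_, hw, w, Set.mem_univ _, rfl⟩
  obtain ⟨T, hT⟩ := isClosed_kolchin_iff.1 (isClosed_projKolchin_iff.1 hDc j)
  have hT' : ∀ x, chart j x ∈ closure[projKolchin m K U N] (V.points ∩ projKPoints K U N) ↔
      ∀ f ∈ T, f.val x = 0 := fun x => Set.ext_iff.1 hT x
  rw [Set.mem_compl_iff, hT'] at hyD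
  push Not at hyD
  obtain ⟨g, hgT, hga⟩ := hyD
  obtain ⟨c, hc, hcq⟩ := hL.exists_point hb (q := toOrderZero m h * g) (fun hmem =>
    (hprime.mem_or_mem hmem).elim hh fun hg => hga (hg a hy))
  have hval : ∀ f : DiffPoly m N K,
      f.val (fun i => algebraMap K U (c i)) = algebraMap K U (f.val c) := fun f =>
    DiffPoly.val_algebraMap f c
  have hcq' : DiffPoly.val (toOrderZero m h) c ≠ 0 ∧ DiffPoly.val g c ≠ 0 := by
    simp only [DiffPoly.val] at hcq ⊢
    rwa [map_mul, mul_ne_zero_iff] at hcq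
  have hcV : chart j (fun i => algebraMap K U (c i)) ∈ V.points := by
    rw [hVC]
    refine ⟨hamb _ (fun f hf => ?_) (fun h0 => ?_), (hS' _).2 fun f hf => ?_⟩
    · rw [← val_toOrderZero (m := m), hval, hc _ hf, map_zero]
    · rw [← val_toOrderZero (m := m), hval] at h0
      exact hcq'.1 ((map_eq_zero_iff _ (algebraMap K U).injective).1 h0)
    · rw [hval, hc f, map_zero]
      intro a ha
      rw [hVC] at ha
      exact (hS' a).1 ha.2 f hf
  have hcD := @subset_closure _ (projKolchin m K U N) _ _
    (show _ ∈ V.points ∩ projKPoints K U N from ⟨hcV, chart_mem_projKPoints j c⟩)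
  have h0 := (hT' _).1 hcD g hgT
  rw [hval] at h0
  exact hcq'.2 ((map_eq_zero_iff _ (algebraMap K U).injective).1 h0)

/-- If infinitely many jets have a smooth `K`-point, then over one of the charts `V` has points,
and the points over `K` of its ideal are dense at every order. -/
theorem exists_chart_denseAtOrder [DiffExt m K U] (hK : IsLargeField K) {V : DiffVariety m K U N}
    (hV : V.IsKIrreducible) (h : {r : ℕ | V.JetHasSmoothKPoint r}.Infinite) :
    ∃ (j : Fin (N + 1)) (w : Fin N → U), chart j w ∈ V.points ∧
      ∀ r, DenseAtOrder (V.chartIdeal j) r := by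
  -- The chart may vary with `r`, but there are finitely many, so one serves infinitely many orders;
  -- density at these orders descends to all lower ones.
  obtain ⟨j, hj⟩ : ∃ j, {r : ℕ | HasSmoothKPoint K (V.jetChart r j)}.Infinite := by
    by_contra! hfin
    refine h ((Set.finite_iUnion hfin).subset ?_)
    rintro r ⟨j, hj⟩
    exact Set.mem_iUnion.2 ⟨j, hj⟩
  obtain ⟨r₀, hr₀⟩ := hj.nonempty
  obtain ⟨w, hw⟩ := exists_chart_mem_points hr₀
  refine ⟨j, w, hw, fun r => ?_⟩
  obtain ⟨s, ⟨a, -, ha⟩, hs⟩ := hj.exists_gt r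
  rw [vanishingIdeal_jetChart] at ha
  exact (hK.denseAtOrder (isPrime_chartIdeal hV hw) ha).mono hs.le

/-- The differential variety in projective space whose points are the zeros of `P` in the first
standard affine chart. -/
noncomputable def ofIdeal [DiffExt m K U] (P : Ideal (DiffPoly m N K)) : DiffVariety m K U N where
  ambient := Set.range (chart 0)
  points := chart 0 '' {a | ∀ f ∈ P, f.val a = 0}
  ambient_locallyClosed := by
    refine ⟨Set.univ, (Set.range (chart 0))ᶜ, @isClosed_univ _ (projZariski K U N), ?_, ?_⟩
    · rw [isClosed_projZariski_iff]
      intro i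
      refine isClosed_zariski_iff.2
        ⟨{i.insertNth (α := fun _ => MvPolynomial (Fin N) K) 1 (fun s => X s) 0}, ?_⟩
      ext a
      have h1 : aeval a (i.insertNth (α := fun _ => MvPolynomial (Fin N) K) 1 (fun s => X s) 0) =
          i.insertNth (α := fun _ => U) 1 a 0 := by
        generalize (0 : Fin (N + 1)) = t
        refine Fin.succAboveCases i ?_ (fun t => ?_) t
        · simp
        · simp
      have h2 : chart i a ∈ Set.range (chart (U := U) 0) ↔
          i.insertNth (α := fun _ => U) 1 a 0 ≠ 0 := by
        constructor
        · rintro ⟨b, hb⟩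
          exact ((chart_eq_mk_iff 0 b _).1 hb).1
        · intro h
          exact ⟨_, (chart_eq_mk_iff 0 _ _).2 ⟨h, fun _ => rfl⟩⟩
      simp only [Set.mem_preimage, Set.mem_compl_iff, h2, not_not, Set.mem_ofPred_eq,
        Set.mem_singleton_iff, forall_eq, h1]
    · rw [Set.sdiff_compl, Set.univ_inter]
  points_closed := by
    -- The closed set contains the whole hyperplane at infinity; the ambient chart removes it again.
    refine ⟨(chart 0 '' {a | ∀ f ∈ P, f.val a = 0}ᶜ)ᶜ, ?_, ?_⟩
    · rw [@isClosed_compl_iff _ (projKolchin m K U N)]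
      refine isOpen_chart_image 0 ?_
      rw [@isOpen_compl_iff _ _ (kolchinTopology m K U N)]
      exact isClosed_kolchin_iff.2 ⟨P, rfl⟩
    · ext x
      constructor
      · rintro ⟨a, ha, rfl⟩
        refine ⟨⟨a, rfl⟩, ?_⟩
        rintro ⟨b, hb, hba⟩
        exact hb (chart_injective 0 hba ▸ ha)
      · rintro ⟨⟨a, rfl⟩, ha⟩
        refine ⟨a, ?_, rfl⟩
        by_contra h
        exact ha ⟨a, h, rfl⟩

theorem chart_mem_points_ofIdeal [DiffExt m K U] {P : Ideal (DiffPoly m N K)} {a : Fin N → U} :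
    chart 0 a ∈ (ofIdeal (U := U) P).points ↔ ∀ f ∈ P, f.val a = 0 := by
  constructor
  · rintro ⟨b, hb, hba⟩
    exact chart_injective 0 hba ▸ hb
  · exact fun h => ⟨a, h, rfl⟩

/-- Every open set that meets the variety contains the generic point `a`. -/
theorem isKIrreducible_ofIdeal [DiffExt m K U] {P : Ideal (DiffPoly m N K)} {a : Fin N → U}
    (ha : ∀ f : DiffPoly m N K, f ∈ P ↔ f.val a = 0) :
    (ofIdeal (U := U) P).IsKIrreducible := by
  have haP : chart 0 a ∈ (ofIdeal (U := U) P).points :=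
    chart_mem_points_ofIdeal.2 fun f hf => (ha f).1 hf
  have key : ∀ O : Set (ProjSpace U N), IsOpen[projKolchin m K U N] O →
      ((ofIdeal (U := U) P).points ∩ O).Nonempty → chart 0 a ∈ O := by
    rintro O hO ⟨_, ⟨b, hb, rfl⟩, hbO⟩
    by_contra haO
    have h1 := isOpen_projKolchin_iff.1 hO 0
    rw [← @isClosed_compl_iff _ (kolchinTopology m K U N)] at h1
    obtain ⟨S, hS⟩ := isClosed_kolchin_iff.1 h1
    have hS' : ∀ x, chart 0 x ∉ O ↔ ∀ f ∈ S, f.val x = 0 := fun x => Set.ext_iff.1 hS x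
    exact (hS' b).2 (fun f hf => hb f ((ha f).2 ((hS' a).1 haO f hf))) hbO
  exact ⟨⟨_, haP⟩, fun O O' hO hO' h h' => ⟨_, haP, key O hO h, key O' hO' h'⟩⟩

theorem chartIdeal_ofIdeal [DiffExt m K U] {P : Ideal (DiffPoly m N K)} {a : Fin N → U}
    (ha : ∀ f : DiffPoly m N K, f ∈ P ↔ f.val a = 0) :
    (ofIdeal (U := U) P).chartIdeal 0 = P := by
  ext f
  rw [mem_chartIdeal]
  constructor
  · intro h
    exact (ha f).2 (h a (chart_mem_points_ofIdeal.2 fun g hg => (ha g).1 hg))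
  · intro hf b hb
    exact chart_mem_points_ofIdeal.1 hb f hf

theorem KPointsDense.exists_point [DiffExt m K U] {P : Ideal (DiffPoly m N K)}
    (h : (ofIdeal (U := U) P).KPointsDense) {a : Fin N → U}
    (ha : ∀ f : DiffPoly m N K, f ∈ P ↔ f.val a = 0) {q : DiffPoly m N K} (hq : q ∉ P) :
    ∃ c : Fin N → K, (∀ f ∈ P, f.val c = 0) ∧ q.val c ≠ 0 := by
  have haP : chart 0 a ∈ (ofIdeal (U := U) P).points :=
    chart_mem_points_ofIdeal.2 fun f hf => (ha f).1 hf
  obtain ⟨_, ⟨b, hb, rfl⟩, hbP, ⟨k, hk, hkb⟩⟩ :=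
    (@mem_closure_iff _ (projKolchin m K U N) _ _).1 (h haP) _
      (isOpen_chart_image 0 (isOpen_kolchin_ne q)) ⟨a, fun h => hq ((ha q).2 h), rfl⟩
  have hbk := ((chart_eq_mk_iff 0 b hk).1 hkb).2
  -- Dehomogenising a `K`-rational point keeps its affine coordinates in `K`.
  have hbc : b = fun i => algebraMap K U (k (Fin.succAbove 0 i) / k 0) := by
    funext i
    rw [hbk, map_div₀]
  have hval : ∀ f : DiffPoly m N K,
      f.val b = algebraMap K U (f.val fun i => k (Fin.succAbove 0 i) / k 0) := fun f => by
    rw [hbc]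
    exact DiffPoly.val_algebraMap f _
  refine ⟨fun i => k (Fin.succAbove 0 i) / k 0, fun f hf => ?_, fun h0 => hb ?_⟩
  · have h1 := chart_mem_points_ofIdeal.1 hbP f hf
    rw [hval] at h1
    exact (map_eq_zero_iff _ (algebraMap K U).injective).1 h1
  · rw [hval, h0, map_zero]

end DiffVariety

/-! ### The main theorem -/

theorem theorem5p2 (m : ℕ) (K U : Type u) [Field K] [CharZero K] [DiffRing m K]
    [Field U] [DiffRing m U] [Algebra K U] [DiffExt m K U]
    (hU : IsDiffClosed m U) (hsat : IsDiffSaturated m U) (hKU : Cardinal.mk K < Cardinal.mk U)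
    (hK : IsLargeField K) :
    List.TFAE [
      IsModelUC m K U,
      ∀ (L : Type (max u w)) [Field L] [DiffRing m L] [Algebra K L] [DiffExt m K L],
        FieldEC K L → DiffEC m K L,
      ∀ (N : ℕ) (V : DiffVariety m K U N), V.IsKIrreducible →
        {r : ℕ | V.JetHasSmoothKPoint r}.Infinite → V.KPointsDense] ∧
    ∀ (N : ℕ) (V : DiffVariety m K U N), V.IsKIrreducible →
      ({r : ℕ | V.JetHasSmoothKPoint r}.Infinite ↔ ∀ r : ℕ, V.JetHasSmoothKPoint r) := by
  have hgen : ∀ (n : ℕ) (P : Ideal (DiffPoly m n K)), P.IsPrime → DiffRing.IsDiffIdeal m P →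
      ∃ a : Fin n → U, ∀ f : DiffPoly m n K, f ∈ P ↔ f.val a = 0 := fun n P hP hδ =>
    hsat K hKU n P hP hδ
  refine ⟨?_, fun N V hV => ⟨fun h => ?_, fun h => ?_⟩⟩
  · tfae_have 1 → 2 := fun h L _ _ _ _ hL => h.diffEC hgen hL
    tfae_have 2 → 3 := by
      intro h N V hV hinf
      obtain ⟨j, w, hw, hdense⟩ := DiffVariety.exists_chart_denseAtOrder hK hV hinf
      obtain ⟨a, ha⟩ := hgen N _ (DiffVariety.isPrime_chartIdeal hV hw)
        (V.isDiffIdeal_chartIdeal j)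
      obtain ⟨L, _, _, _, _, b, hL, hb⟩ := exists_fieldEC_extension.{u, w} ha hdense
      exact DiffVariety.kPointsDense_of_diffEC hV hw (h L hL) hb
    tfae_have 3 → 1 := by
      rintro h n P hP hδ Λ hΛ ⟨r, hr, c, -, hc⟩
      obtain ⟨a, ha⟩ := hgen n P hP hδ
      rw [hΛ.vanishingIdeal_eq hP hδ hr ha] at hc
      -- Largeness gives density at the order `r` of the smooth point only; triangular extension
      -- modulo `Λ` carries it to all orders.
      have hdense : ∀ s, DenseAtOrder P s := by
        intro s g hg _
        obtain ⟨φ, h1, h2⟩ := hΛ.exists_point hP hδ hr (hK.denseAtOrder hP hc) hg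
        exact ⟨φ, fun p hp _ => h1 p hp, h2⟩
      obtain ⟨L, _, _, _, _, b, hL, hb⟩ := exists_fieldEC_extension.{u, u} ha hdense
      -- `K` is e.c. as a field in the generic extension, so every jet of the variety of `P` has a
      -- smooth `K`-point.
      have hKd := h n (DiffVariety.ofIdeal P) (DiffVariety.isKIrreducible_ofIdeal ha) (by
        rw [show {r : ℕ | (DiffVariety.ofIdeal (U := U) P).JetHasSmoothKPoint r} = Set.univ from
          Set.eq_univ_of_forall fun s => DiffVariety.jetHasSmoothKPoint_of_fieldEC
            (DiffVariety.chart_mem_points_ofIdeal.2 fun f hf => (ha f).1 hf) hL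
            (by rwa [DiffVariety.chartIdeal_ofIdeal ha]) s]
        exact Set.infinite_univ)
      obtain ⟨d, hd, hdH⟩ := hKd.exists_point ha (hΛ.hProd_notMem hP)
      exact ⟨d, fun f hf => hd f (hΛ.1.2 hf), hdH⟩
    tfae_finish
  · obtain ⟨j, w, hw, hdense⟩ := DiffVariety.exists_chart_denseAtOrder hK hV h
    obtain ⟨a, ha⟩ := hgen N _ (DiffVariety.isPrime_chartIdeal hV hw)
      (V.isDiffIdeal_chartIdeal j)
    obtain ⟨L, _, _, _, _, b, hL, hb⟩ := exists_fieldEC_extension.{u, u} ha hdense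
    exact DiffVariety.jetHasSmoothKPoint_of_fieldEC hw hL hb
  · rw [show {r : ℕ | V.JetHasSmoothKPoint r} = Set.univ from Set.eq_univ_of_forall h]
    exact Set.infinite_univ
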